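/- Let $k$ be a commutative ring, $I$ a finite set and $n\ge 0$. Let $\mathfrak S_n$ act on $I^n$ by permuting positions, $s_i=(i\ i+1)$. Let $\Psi_{I,n}$ be the quiver with vertex set $I^n$ and arrows $\tau_{i,v}:v\to s_i(v)$ ($1\le i\le n-1$, $v\in I^n$) and $x_{a,v}:v\to v$ ($1\le a\le n$, $v\in I^n$). The $k$-algebra of a quiver with relations is generated by the vertices (written $1_v$) and the arrows, with $1_v1_w=\delta_{v,w}1_v$, $\sum_v 1_v=1$, $1_w\alpha=\delta_{w,\mathrm{target}(\alpha)}\alpha$, $\alpha1_w=\delta_{w,\mathrm{source}(\alpha)}\alpha$ for arrows $\alpha$, and the given relations; products compose from right to left, and a relation with vertices omitted is imposed at every starting vertex $v$. Let $Q=(Q_{ij})_{i,j\in I}$ be a matrix with entries in $k[u,u']$ such that $Q_{ii}=0$, $Q_{ij}$ is not a zero-divisor for $i\neq j$, and $Q_{ij}(u,u')=Q_{ji}(u',u)$. The quiver Hecke algebra $H_n(Q)$ is the $k$-algebra of the quiver $\Psi_{I,n}$ with the relations * $\tau_{i,s_i(v)}\tau_{i,v}=Q_{v_i,v_{i+1}}(x_{i,v},x_{i+1,v})$;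 $\tau_i\tau_j=\tau_j\tau_i$ if $|i-j|>1$; $x_ax_b=x_bx_a$; * $\tau_{i,v}x_{a,v}-x_{s_i(a),s_i(v)}\tau_{i,v}$ equals $-1_v$ if $a=i$ and $v_i=v_{i+1}$, equals $1_v$ if $a=i+1$ and $v_i=v_{i+1}$, and equals $0$ otherwise; * $\tau_{i+1,s_is_{i+1}(v)}\tau_{i,s_{i+1}(v)}\tau_{i+1,v}-\tau_{i,s_{i+1}s_i(v)}\tau_{i+1,s_i(v)}\tau_{i,v}$ equals $(x_{i+2,v}-x_{i,v})^{-1}\bigl(Q_{v_i,v_{i+1}}(x_{i+2,v},x_{i+1,v})-Q_{v_i,v_{i+1}}(x_{i,v},x_{i+1,v})\bigr)$ (a polynomial) if $v_i=v_{i+2}\ne v_{i+1}$, and equals $0$ otherwise. **(1) Polynomial representation.** Let $P=(P_{ij})_{i,j\in I}$ be a matrix with entries in $k[u,u']$ such that $P_{ii}=0$ and $P_{ij}$ is not a zero-divisor for $i\ne j$, and let $Q_{ij}(u,u')=P_{ij}(u,u')P_{ji}(u',u)$. Let $M=\bigoplus_{v\in I^n}M_v$ with $M_v=k[x_1,\dots,x_n]$.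 Let $1_v$ act as the projection onto $M_v$, let $x_{a,v}$ act on $M_v$ as multiplication by $x_a$, and let $\tau_{i,v}:M_v\to M_{s_i(v)}$ act as $(x_i-x_{i+1})^{-1}(s_i-1)$ if $s_i(v)=v$ and as $P_{v_i,v_{i+1}}(x_{i+1},x_i)\,s_i$ otherwise (with $x_{a,v}$ and $\tau_{i,v}$ zero on $M_w$ for $w\ne v$). This defines a faithful representation of $H_n(Q)$ on $M$, i.e. an injective morphism of $k$-algebras $H_n(Q)\to\operatorname{End}_k(M)$. **(2) Poincaré–Birkhoff–Witt property.** Let $Q$ be any matrix as in the definition of $H_n(Q)$. Let $A'=k[x]^I\wr{}^0H_n^f$ be the nil-wreath algebra, i.e. the $k$-algebra of the quiver $\Psi_{I,n}$, with the arrows $\tau_{i,v}$ now written $T_{i,v}$, and with relations $T_i^2=0$, $T_iT_j=T_jT_i$ if $|i-j|>1$, $T_iT_{i+1}T_i=T_{i+1}T_iT_{i+1}$, $x_ax_b=x_bx_a$, $T_ix_a=x_aT_i$ if $a\ne i,i+1$, $T_ix_i=x_{i+1}T_i$, $T_ix_{i+1}=x_iT_i$. Filter $H_n(Q)$ by putting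 $1_v$ and $x_{a,v}$ in degree $0$ and $\tau_{i,v}$ in degree $1$ (so $F^i$ is the $k$-span of the products of generators with at most $i$ factors $\tau$, and $F^{-1}=0$), and let $\operatorname{gr}H_n(Q)=\bigoplus_{i\ge0}F^i/F^{i-1}$. Then there is an isomorphism of $k$-algebras $f:A'\to\operatorname{gr}H_n(Q)$ which sends $1_v$ and $x_{a,v}$ to their classes in degree $0$ and $T_{i,v}$ to the class of $\tau_{i,v}$ in degree $1$. **(3) Basis.** Let $Q$ be as in (2), and let $J$ be a set of finite sequences of elements of $\{1,\dots,n-1\}$ such that $(i_1,\dots,i_r)\mapsto s_{i_r}\cdots s_{i_1}$ is a bijection $J\to\mathfrak S_n$ and each sequence in $J$ has minimal length among the sequences giving the same permutation. Then $H_n(Q)$ is a free $k$-module with basis $$S=\bigl\{\tau_{i_r,s_{i_{r-1}}\cdots s_{i_1}(v)}\cdots\tau_{i_1,v}\,x_{1,v}^{a_1}\cdots x_{n,v}^{a_n}\bigr\},\qquad (i_1,\dots,i_r)\in J,\ (a_1,\dots,a_n)\in\mathbf Z_{\ge0}^n,\ v\in I^n,$$ the elements being indexed by the triples $((i_1,\dots,i_r),(a_1,\dots,a_n),v)$.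 -/

import Mathlib

namespace QuiverHecke

noncomputable section

/-! ### Quiver algebras with relations -/

section QuiverAlgebra

variable (k : Type*) [CommRing k] {V E : Type*} [Fintype V]

/-- The defining relations of the algebra of the quiver with vertex set `V`, arrow set `E`, source
map `src` and target map `tgt`, together with additional relations `R`. Products are composed from
right to left, as maps are. -/
inductive PathRel (src tgt : E → V) (R : FreeAlgebra k (V ⊕ E) → FreeAlgebra k (V ⊕ E) → Prop) :
    FreeAlgebra k (V ⊕ E) → FreeAlgebra k (V ⊕ E) → Prop
  | target (a : E) : PathRel src tgt R
      (FreeAlgebra.ι k (Sum.inl (tgt a)) * FreeAlgebra.ι k (Sum.inr a))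
      (FreeAlgebra.ι k (Sum.inr a))
  | target_ne (a : E) (s : V) (h : tgt a ≠ s) : PathRel src tgt R
      (FreeAlgebra.ι k (Sum.inl s) * FreeAlgebra.ι k (Sum.inr a)) 0
  | source (a : E) : PathRel src tgt R
      (FreeAlgebra.ι k (Sum.inr a) * FreeAlgebra.ι k (Sum.inl (src a)))
      (FreeAlgebra.ι k (Sum.inr a))
  | source_ne (a : E) (s : V) (h : src a ≠ s) : PathRel src tgt R
      (FreeAlgebra.ι k (Sum.inr a) * FreeAlgebra.ι k (Sum.inl s)) 0
  | idem (s : V) : PathRel src tgt R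
      (FreeAlgebra.ι k (Sum.inl s) * FreeAlgebra.ι k (Sum.inl s)) (FreeAlgebra.ι k (Sum.inl s))
  | orthogonal (s t : V) (h : s ≠ t) : PathRel src tgt R
      (FreeAlgebra.ι k (Sum.inl s) * FreeAlgebra.ι k (Sum.inl t)) 0
  | unit : PathRel src tgt R (∑ t : V, FreeAlgebra.ι k (Sum.inl t)) 1
  | rel (a b : FreeAlgebra k (V ⊕ E)) (h : R a b) : PathRel src tgt R a b

/-- The algebra of a quiver with relations `R`. -/
abbrev PathAlgebra (src tgt : E → V)
    (R : FreeAlgebra k (V ⊕ E) → FreeAlgebra k (V ⊕ E) → Prop) : Type _ :=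
  RingQuot (PathRel k src tgt R)

/-- The class of a generator (a vertex or an arrow) in the algebra of a quiver with relations. -/
def gen (src tgt : E → V) (R : FreeAlgebra k (V ⊕ E) → FreeAlgebra k (V ⊕ E) → Prop)
    (g : V ⊕ E) : PathAlgebra k src tgt R :=
  RingQuot.mkAlgHom k (PathRel k src tgt R) (FreeAlgebra.ι k g)

end QuiverAlgebra

/-! ### Filtered algebras and the associated graded algebra -/

section Filtration

variable {k A : Type*} [CommRing k] [Ring A] [Algebra k A]

/-- An increasing algebra filtration indexed by the natural numbers. -/
structure AlgFiltration (k A : Type*) [CommRing k] [Ring A] [Algebra k A] where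
  F : ℕ → Submodule k A
  mono : Monotone F
  one_mem : (1 : A) ∈ F 0
  mul_mem : ∀ {i j : ℕ} {a b : A}, a ∈ F i → b ∈ F j → a * b ∈ F (i + j)

namespace AlgFiltration

variable (G : AlgFiltration k A)

/-- `prev i` is `F (i - 1)`, with the convention that `F (-1) = 0`. -/
def prev : ℕ → Submodule k A
  | 0 => ⊥
  | i + 1 => G.F i

lemma mul_mem_prev_left {i j : ℕ} {a b : A} (ha : a ∈ G.prev i) (hb : b ∈ G.F j) :
    a * b ∈ G.prev (i + j) := by
  cases i with
  | zero =>
    have : a = 0 := by simpa [prev] using ha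
    simp [this]
  | succ i =>
    have h := G.mul_mem (show a ∈ G.F i from ha) hb
    rw [show i + 1 + j = (i + j) + 1 by omega]
    exact h

lemma mul_mem_prev_right {i j : ℕ} {a b : A} (ha : a ∈ G.F i) (hb : b ∈ G.prev j) :
    a * b ∈ G.prev (i + j) := by
  cases j with
  | zero =>
    have : b = 0 := by simpa [prev] using hb
    simp [this]
  | succ j => exact G.mul_mem ha (show b ∈ G.F j from hb)

/-- The degree `i` part `F i / F (i - 1)` of the associated graded algebra. -/
def Piece (i : ℕ) : Type _ := G.F i ⧸ (G.prev i).comap (G.F i).subtype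

instance (i : ℕ) : AddCommGroup (G.Piece i) :=
  inferInstanceAs (AddCommGroup (G.F i ⧸ (G.prev i).comap (G.F i).subtype))

instance (i : ℕ) : Module k (G.Piece i) :=
  inferInstanceAs (Module k (G.F i ⧸ (G.prev i).comap (G.F i).subtype))

/-- The class in `F i / F (i - 1)` of an element of `F i`. -/
def cls (i : ℕ) (a : A) (ha : a ∈ G.F i) : G.Piece i := Submodule.Quotient.mk ⟨a, ha⟩

/-- The multiplication `F i / F (i - 1) × F j / F (j - 1) → F (i + j) / F (i + j - 1)` induced by
the multiplication of `A`. -/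
def pieceMul {i j : ℕ} (a : G.Piece i) (b : G.Piece j) : G.Piece (i + j) :=
  Quotient.liftOn₂' a b
    (fun a b => G.cls (i + j) (a.1 * b.1) (G.mul_mem a.2 b.2))
    (by
      intro a b a' b' h h'
      rw [Submodule.quotientRel_def] at h h'
      refine (Submodule.Quotient.eq _).2 ?_
      change a.1 * b.1 - a'.1 * b'.1 ∈ G.prev (i + j)
      have e : a.1 * b.1 - a'.1 * b'.1 = (a.1 - a'.1) * b.1 + a'.1 * (b.1 - b'.1) := by
        noncomm_ring
      rw [e]
      exact Submodule.add_mem _ (G.mul_mem_prev_left h b.2) (G.mul_mem_prev_right a'.2 h'))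

lemma cls_surj {i : ℕ} (a : G.Piece i) : ∃ (x : A) (hx : x ∈ G.F i), a = G.cls i x hx := by
  obtain ⟨⟨x, hx⟩, rfl⟩ := Submodule.Quotient.mk_surjective _ a
  exact ⟨x, hx, rfl⟩

lemma cls_congr {i : ℕ} {a b : A} (h : a = b) (ha : a ∈ G.F i) (hb : b ∈ G.F i) :
    G.cls i a ha = G.cls i b hb := by
  subst h; rfl

lemma mk_congr {i j : ℕ} (hij : i = j) {a b : A} (h : a = b) (ha : a ∈ G.F i) (hb : b ∈ G.F j) :
    GradedMonoid.mk (A := G.Piece) i (G.cls i a ha) = GradedMonoid.mk j (G.cls j b hb) := by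
  subst hij; subst h; rfl

lemma algebraMap_mem (r : k) : algebraMap k A r ∈ G.F 0 := by
  rw [Algebra.algebraMap_eq_smul_one]
  exact Submodule.smul_mem _ _ G.one_mem

instance : GradedMonoid.GMul G.Piece := ⟨fun a b => G.pieceMul a b⟩

instance : GradedMonoid.GOne G.Piece := ⟨G.cls 0 1 G.one_mem⟩

instance : DirectSum.GSemiring G.Piece where
  mul := fun a b => G.pieceMul a b
  one := G.cls 0 1 G.one_mem
  mul_zero := by
    intro i j a
    obtain ⟨a, ha, rfl⟩ := G.cls_surj a
    exact G.cls_congr (mul_zero a) _ (Submodule.zero_mem _)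
  zero_mul := by
    intro i j a
    obtain ⟨a, ha, rfl⟩ := G.cls_surj a
    exact G.cls_congr (zero_mul a) _ (Submodule.zero_mem _)
  mul_add := by
    intro i j a b c
    obtain ⟨a, ha, rfl⟩ := G.cls_surj a
    obtain ⟨b, hb, rfl⟩ := G.cls_surj b
    obtain ⟨c, hc, rfl⟩ := G.cls_surj c
    exact G.cls_congr (mul_add a b c) _
      (Submodule.add_mem _ (G.mul_mem ha hb) (G.mul_mem ha hc))
  add_mul := by
    intro i j a b c
    obtain ⟨a, ha, rfl⟩ := G.cls_surj a
    obtain ⟨b, hb, rfl⟩ := G.cls_surj b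
    obtain ⟨c, hc, rfl⟩ := G.cls_surj c
    exact G.cls_congr (add_mul a b c) _
      (Submodule.add_mem _ (G.mul_mem ha hc) (G.mul_mem hb hc))
  one_mul := by
    rintro ⟨i, a⟩
    obtain ⟨a, ha, rfl⟩ := G.cls_surj a
    exact G.mk_congr (zero_add i) (one_mul a) _ _
  mul_one := by
    rintro ⟨i, a⟩
    obtain ⟨a, ha, rfl⟩ := G.cls_surj a
    exact G.mk_congr (add_zero i) (mul_one a) _ _
  mul_assoc := by
    rintro ⟨i, a⟩ ⟨j, b⟩ ⟨l, c⟩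
    obtain ⟨a, ha, rfl⟩ := G.cls_surj a
    obtain ⟨b, hb, rfl⟩ := G.cls_surj b
    obtain ⟨c, hc, rfl⟩ := G.cls_surj c
    exact G.mk_congr (add_assoc i j l) (mul_assoc a b c) _ _
  natCast := fun m => G.cls 0 (m : A) (by
    rw [← map_natCast (algebraMap k A)]; exact G.algebraMap_mem _)
  natCast_zero := G.cls_congr Nat.cast_zero _ (Submodule.zero_mem _)
  natCast_succ := fun m => G.cls_congr (Nat.cast_succ m) _
    (Submodule.add_mem _ (by rw [← map_natCast (algebraMap k A)]; exact G.algebraMap_mem _)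
      G.one_mem)

instance : DirectSum.GRing G.Piece where
  intCast := fun m => G.cls 0 (m : A) (by
    rw [← map_intCast (algebraMap k A)]; exact G.algebraMap_mem _)
  intCast_ofNat := fun m => G.cls_congr (Int.cast_natCast m) _ _
  intCast_negSucc_ofNat := fun m => G.cls_congr (Int.cast_negSucc m) _
    (Submodule.neg_mem _ (by rw [← map_natCast (algebraMap k A)]; exact G.algebraMap_mem _))

instance : DirectSum.GAlgebra k G.Piece where
  toFun :=
    { toFun := fun r => G.cls 0 (algebraMap k A r) (G.algebraMap_mem r)
      map_zero' := G.cls_congr (map_zero _) _ (Submodule.zero_mem _)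
      map_add' := fun r s => G.cls_congr (map_add _ r s) _
        (Submodule.add_mem _ (G.algebraMap_mem r) (G.algebraMap_mem s)) }
  map_one := G.cls_congr (map_one _) _ G.one_mem
  map_mul := fun r s => G.mk_congr rfl (map_mul _ r s) _ _
  commutes := by
    rintro r ⟨i, a⟩
    obtain ⟨a, ha, rfl⟩ := G.cls_surj a
    exact G.mk_congr (by omega) (Algebra.commutes r a) _ _
  smul_def := by
    rintro r ⟨i, a⟩
    obtain ⟨a, ha, rfl⟩ := G.cls_surj a
    exact G.mk_congr (zero_add i).symm (Algebra.smul_def r a) (Submodule.smul_mem _ r ha) _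

/-- The associated graded algebra `⨁ i, F i / F (i - 1)`. -/
abbrev Gr : Type _ := DirectSum ℕ G.Piece

/-- The class in degree `i` of the associated graded algebra of an element of `F i`. -/
def symbol (i : ℕ) (a : A) (ha : a ∈ G.F i) : G.Gr := DirectSum.of G.Piece i (G.cls i a ha)

/-- The filtration of an algebra defined by assigning degrees to a family `g` of elements:
`F i` is spanned by the products of members of the family of total degree at most `i`. -/
def ofDegrees {X : Type*} (k : Type*) {A : Type*} [CommRing k] [Ring A] [Algebra k A]
    (g : X → A) (deg : X → ℕ) : AlgFiltration k A where
  F i := Submodule.span k {a | ∃ l : List X, (l.map deg).sum ≤ i ∧ a = (l.map g).prod}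
  mono := by
    intro i j hij
    refine Submodule.span_mono ?_
    rintro a ⟨l, hl, rfl⟩
    exact ⟨l, hl.trans hij, rfl⟩
  one_mem := Submodule.subset_span ⟨[], by simp, by simp⟩
  mul_mem := by
    intro i j a b ha hb
    have h := Submodule.mul_mem_mul ha hb
    rw [Submodule.span_mul_span] at h
    refine Submodule.span_mono ?_ h
    rintro _ ⟨_, ⟨l, hl, rfl⟩, _, ⟨l', hl', rfl⟩, rfl⟩
    exact ⟨l ++ l', by simp only [List.map_append, List.sum_append]; omega, by simp⟩

lemma gen_mem_ofDegrees {X : Type*} (g : X → A) (deg : X → ℕ) (x : X) {i : ℕ} (h : deg x ≤ i) :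
    g x ∈ (ofDegrees k g deg).F i :=
  Submodule.subset_span ⟨[x], by simpa using h, by simp⟩

end AlgFiltration

end Filtration

/-! ### The quiver `Ψ_{I,n}` -/

section Psi

variable {I : Type*} {n : ℕ}

/-- For `i` in `Fin (n - 1)`, indexing the simple transposition exchanging the consecutive
positions `lo i` and `hi i`, the first of these positions. -/
def lo (i : Fin (n - 1)) : Fin n := ⟨i, by omega⟩

/-- The second of the two consecutive positions exchanged by the `i`-th simple transposition. -/
def hi (i : Fin (n - 1)) : Fin n := ⟨i + 1, by omega⟩

/-- The `i`-th simple transposition `s_i`. -/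
def sPerm (i : Fin (n - 1)) : Equiv.Perm (Fin n) := Equiv.swap (lo i) (hi i)

/-- The action of `s_i` on sequences. -/
def sAct (i : Fin (n - 1)) (v : Fin n → I) : Fin n → I := v ∘ sPerm i

/-- The arrows of `Ψ_{I,n}`, whose vertices are the elements of `I^n`. -/
inductive Arrow (I : Type*) (n : ℕ)
  | tau (i : Fin (n - 1)) (v : Fin n → I)
  | x (a : Fin n) (v : Fin n → I)

/-- The source of an arrow. -/
def Arrow.src : Arrow I n → (Fin n → I)
  | tau _ v => v
  | x _ v => v

/-- The target of an arrow. -/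
def Arrow.tgt : Arrow I n → (Fin n → I)
  | tau i v => sAct i v
  | x _ v => v

/-- The degrees of the generators: the idempotents `1_v` and the `x_{a,v}` have degree `0`, the
`τ_{i,v}` have degree `1`. -/
def genDegree : (Fin n → I) ⊕ Arrow I n → ℕ
  | Sum.inl _ => 0
  | Sum.inr (Arrow.tau _ _) => 1
  | Sum.inr (Arrow.x _ _) => 0

variable (k : Type*) [CommRing k]

/-- The free algebra on the vertices and the arrows of `Ψ_{I,n}`. -/
abbrev Free (I : Type*) (n : ℕ) : Type _ := FreeAlgebra k ((Fin n → I) ⊕ Arrow I n)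

/-- The generator `1_v` of the free algebra. -/
def fE (v : Fin n → I) : Free k I n := FreeAlgebra.ι k (Sum.inl v)

/-- The generator `τ_{i,v}` (or `T_{i,v}`) of the free algebra. -/
def fT (i : Fin (n - 1)) (v : Fin n → I) : Free k I n :=
  FreeAlgebra.ι k (Sum.inr (Arrow.tau i v))

/-- The generator `x_{a,v}` of the free algebra. -/
def fX (a : Fin n) (v : Fin n → I) : Free k I n := FreeAlgebra.ι k (Sum.inr (Arrow.x a v))

variable {k}

/-- The value `p(x_{1,v}, …, x_{n,v})` of a polynomial at the loops at `v`, its constant terms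
being multiples of `1_v`. (The loops commute in all the quotients considered.) -/
def polyAt (v : Fin n → I) (p : MvPolynomial (Fin n) k) : Free k I n :=
  ∑ m ∈ p.support, p.coeff m • (fE k v * (List.ofFn fun a => fX k a v ^ m a).prod)

end Psi

/-! ### Polynomials -/

section Polynomials

open MvPolynomial

variable {k : Type*} [CommRing k] {n : ℕ}

/-- `p(x_a, x_b)`, for a polynomial `p = p(u, u')` in two variables. -/
def eval₂At (p : MvPolynomial (Fin 2) k) (a b : Fin n) : MvPolynomial (Fin n) k :=
  aeval ![X a, X b] p

/-- `p(u', u)`, for a polynomial `p = p(u, u')` in two variables. -/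
def flipVars (p : MvPolynomial (Fin 2) k) : MvPolynomial (Fin 2) k :=
  aeval ![X 1, X 0] p

lemma sub_dvd_eval₂At_sub (p : MvPolynomial (Fin 2) k) (a b c : Fin n) :
    (X c - X a : MvPolynomial (Fin n) k) ∣ eval₂At p c b - eval₂At p a b := by
  unfold eval₂At
  induction p using MvPolynomial.induction_on with
  | C r => simp
  | add p q hp hq =>
    rw [map_add, map_add, add_sub_add_comm]
    exact dvd_add hp hq
  | mul_X p i hp =>
    rw [map_mul, map_mul, aeval_X, aeval_X]
    have e : ∀ s t y z : MvPolynomial (Fin n) k, s * y - t * z = (s - t) * y + t * (y - z) := by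
      intros; ring
    rw [e]
    refine dvd_add (hp.mul_right _) (Dvd.dvd.mul_left ?_ _)
    fin_cases i <;> simp

lemma sub_dvd_rename_swap_sub (i j : Fin n) (f : MvPolynomial (Fin n) k) :
    (X i - X j : MvPolynomial (Fin n) k) ∣ rename (Equiv.swap i j) f - f := by
  induction f using MvPolynomial.induction_on with
  | C r => simp
  | add p q hp hq =>
    rw [map_add, add_sub_add_comm]
    exact dvd_add hp hq
  | mul_X p l hp =>
    rw [map_mul, rename_X]
    have e : ∀ s t y z : MvPolynomial (Fin n) k, s * y - t * z = (s - t) * y + t * (y - z) := by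
      intros; ring
    rw [e]
    refine dvd_add (hp.mul_right _) (Dvd.dvd.mul_left ?_ _)
    rcases eq_or_ne l i with rfl | hi
    · rw [Equiv.swap_apply_left, ← neg_sub]
      exact neg_dvd.2 (dvd_refl _)
    · rcases eq_or_ne l j with rfl | hj
      · rw [Equiv.swap_apply_right]
      · rw [Equiv.swap_apply_of_ne_of_ne hi hj, sub_self]
        exact dvd_zero _

lemma X_sub_X_cancel {i j : Fin n} (hij : i ≠ j) {f g : MvPolynomial (Fin n) k}
    (h : (X i - X j) * f = (X i - X j) * g) : f = g := by
  let φ : MvPolynomial (Fin n) k →ₐ[k] MvPolynomial (Fin n) k :=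
    aeval fun l => if l = i then X i + X j else X l
  let ψ : MvPolynomial (Fin n) k →ₐ[k] MvPolynomial (Fin n) k :=
    aeval fun l => if l = i then X i - X j else X l
  have hψφ : ψ.comp φ = AlgHom.id k _ := by
    ext1 l
    by_cases hl : l = i
    · simp [φ, ψ, hl, hij.symm]
    · simp [φ, ψ, hl]
  have hinj : Function.Injective φ := by
    intro a b hab
    have := congrArg ψ hab
    rwa [← AlgHom.comp_apply, ← AlgHom.comp_apply, hψφ] at this
  have h' := congrArg φ h
  have hX : φ (X i - X j) = X i := by simp [φ, hij.symm]
  rw [map_mul, map_mul, hX] at h'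
  exact hinj ((isRegular_X (n := i)).left h')

/-- The polynomial `(x_c - x_a)⁻¹ (p(x_c, x_b) - p(x_a, x_b))`. -/
def diffQuot (p : MvPolynomial (Fin 2) k) (a b c : Fin n) : MvPolynomial (Fin n) k :=
  (sub_dvd_eval₂At_sub p a b c).choose

lemma diffQuot_spec (p : MvPolynomial (Fin 2) k) (a b c : Fin n) :
    (X c - X a) * diffQuot p a b c = eval₂At p c b - eval₂At p a b :=
  (sub_dvd_eval₂At_sub p a b c).choose_spec.symm

lemma lo_ne_hi (i : Fin (n - 1)) : lo i ≠ hi i := by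
  simp [lo, hi, Fin.ext_iff]

/-- The action of `s_i` on polynomials, by exchanging two consecutive variables. -/
def sPoly (k : Type*) [CommRing k] {n : ℕ} (i : Fin (n - 1)) :
    MvPolynomial (Fin n) k →ₗ[k] MvPolynomial (Fin n) k :=
  (rename (sPerm i)).toLinearMap

/-- The divided difference operator `f ↦ (x_i - x_{i+1})⁻¹ (s_i(f) - f)`. -/
def divDiff (k : Type*) [CommRing k] {n : ℕ} (i : Fin (n - 1)) :
    MvPolynomial (Fin n) k →ₗ[k] MvPolynomial (Fin n) k where
  toFun f := (sub_dvd_rename_swap_sub (lo i) (hi i) f).choose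
  map_add' f g := by
    apply X_sub_X_cancel (lo_ne_hi i)
    rw [mul_add, ← (sub_dvd_rename_swap_sub (lo i) (hi i) f).choose_spec,
      ← (sub_dvd_rename_swap_sub (lo i) (hi i) g).choose_spec,
      ← (sub_dvd_rename_swap_sub (lo i) (hi i) (f + g)).choose_spec, map_add]
    ring
  map_smul' r f := by
    apply X_sub_X_cancel (lo_ne_hi i)
    rw [RingHom.id_apply, mul_smul_comm,
      ← (sub_dvd_rename_swap_sub (lo i) (hi i) f).choose_spec,
      ← (sub_dvd_rename_swap_sub (lo i) (hi i) (r • f)).choose_spec, map_smul, smul_sub]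

lemma divDiff_spec (i : Fin (n - 1)) (f : MvPolynomial (Fin n) k) :
    (X (lo i) - X (hi i)) * divDiff k i f = sPoly k i f - f :=
  (sub_dvd_rename_swap_sub (lo i) (hi i) f).choose_spec.symm

end Polynomials

/-! ### The nil-wreath algebra -/

section NilWreath

variable (k : Type*) [CommRing k] (I : Type*) (n : ℕ)

/-- The relations of the nil-wreath algebra (with `T_i` denoted by `fT`). Each relation between
paths is written for every possible starting vertex `v`. -/
inductive NilRel : Free k I n → Free k I n → Prop
  | sq (i : Fin (n - 1)) (v : Fin n → I) : NilRel (fT k i (sAct i v) * fT k i v) 0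
  | far (i j : Fin (n - 1)) (h : (i : ℕ) + 1 < j) (v : Fin n → I) : NilRel
      (fT k i (sAct j v) * fT k j v) (fT k j (sAct i v) * fT k i v)
  | braid (i j : Fin (n - 1)) (h : (j : ℕ) = i + 1) (v : Fin n → I) : NilRel
      (fT k i (sAct j (sAct i v)) * fT k j (sAct i v) * fT k i v)
      (fT k j (sAct i (sAct j v)) * fT k i (sAct j v) * fT k j v)
  | xx (a b : Fin n) (v : Fin n → I) : NilRel (fX k a v * fX k b v) (fX k b v * fX k a v)
  | tx (i : Fin (n - 1)) (a : Fin n) (h : a ≠ lo i) (h' : a ≠ hi i) (v : Fin n → I) : NilRel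
      (fT k i v * fX k a v) (fX k a (sAct i v) * fT k i v)
  | tx_lo (i : Fin (n - 1)) (v : Fin n → I) : NilRel
      (fT k i v * fX k (lo i) v) (fX k (hi i) (sAct i v) * fT k i v)
  | tx_hi (i : Fin (n - 1)) (v : Fin n → I) : NilRel
      (fT k i v * fX k (hi i) v) (fX k (lo i) (sAct i v) * fT k i v)

variable [Fintype I]

/-- The nil-wreath algebra: the algebra of the quiver `Ψ_{I,n}` with relations `NilRel`. -/
abbrev NilWreath : Type _ :=
  PathAlgebra k (Arrow.src (I := I) (n := n)) Arrow.tgt (NilRel k I n)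

variable {I n}

/-- The element `1_v` of the nil-wreath algebra. -/
def NilWreath.e (v : Fin n → I) : NilWreath k I n := gen k Arrow.src Arrow.tgt _ (Sum.inl v)

/-- The element `T_{i,v}` of the nil-wreath algebra. -/
def NilWreath.T (i : Fin (n - 1)) (v : Fin n → I) : NilWreath k I n :=
  gen k Arrow.src Arrow.tgt _ (Sum.inr (Arrow.tau i v))

/-- The element `x_{a,v}` of the nil-wreath algebra. -/
def NilWreath.x (a : Fin n) (v : Fin n → I) : NilWreath k I n :=
  gen k Arrow.src Arrow.tgt _ (Sum.inr (Arrow.x a v))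

end NilWreath

/-! ### Quiver Hecke algebras -/

section QuiverHeckeAlgebra

variable {k : Type*} [CommRing k] {I : Type*} (Q : I → I → MvPolynomial (Fin 2) k) (n : ℕ)

/-- The relations of the quiver Hecke algebra (with `τ_i` denoted by `fT`). Each relation between
paths is written for every possible starting vertex `v`. -/
inductive HeckeRel : Free k I n → Free k I n → Prop
  | sq (i : Fin (n - 1)) (v : Fin n → I) : HeckeRel
      (fT k i (sAct i v) * fT k i v)
      (polyAt v (eval₂At (Q (v (lo i)) (v (hi i))) (lo i) (hi i)))
  | far (i j : Fin (n - 1)) (h : (i : ℕ) + 1 < j) (v : Fin n → I) : HeckeRel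
      (fT k i (sAct j v) * fT k j v) (fT k j (sAct i v) * fT k i v)
  | braid (i j : Fin (n - 1)) (h : (j : ℕ) = i + 1) (v : Fin n → I)
      (hv : v (lo i) ≠ v (hi j) ∨ (v (lo i) = v (hi i) ∧ v (hi i) = v (hi j))) : HeckeRel
      (fT k j (sAct i (sAct j v)) * fT k i (sAct j v) * fT k j v)
      (fT k i (sAct j (sAct i v)) * fT k j (sAct i v) * fT k i v)
  | braid_ne (i j : Fin (n - 1)) (h : (j : ℕ) = i + 1) (v : Fin n → I)
      (hv : v (lo i) = v (hi j)) (hv' : v (lo i) ≠ v (hi i)) : HeckeRel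
      (fT k j (sAct i (sAct j v)) * fT k i (sAct j v) * fT k j v
        - fT k i (sAct j (sAct i v)) * fT k j (sAct i v) * fT k i v)
      (polyAt v (diffQuot (Q (v (lo i)) (v (hi i))) (lo i) (hi i) (hi j)))
  | xx (a b : Fin n) (v : Fin n → I) : HeckeRel (fX k a v * fX k b v) (fX k b v * fX k a v)
  | tx_lo (i : Fin (n - 1)) (v : Fin n → I) (hv : v (lo i) = v (hi i)) : HeckeRel
      (fT k i v * fX k (lo i) v - fX k (sPerm i (lo i)) (sAct i v) * fT k i v) (-fE k v)
  | tx_hi (i : Fin (n - 1)) (v : Fin n → I) (hv : v (lo i) = v (hi i)) : HeckeRel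
      (fT k i v * fX k (hi i) v - fX k (sPerm i (hi i)) (sAct i v) * fT k i v) (fE k v)
  | tx (i : Fin (n - 1)) (a : Fin n) (v : Fin n → I)
      (h : ¬((a = lo i ∨ a = hi i) ∧ v (lo i) = v (hi i))) : HeckeRel
      (fT k i v * fX k a v - fX k (sPerm i a) (sAct i v) * fT k i v) 0

variable [Fintype I]

/-- The quiver Hecke algebra `H_n(Q)`. -/
abbrev Hn : Type _ :=
  PathAlgebra k (Arrow.src (I := I) (n := n)) Arrow.tgt (HeckeRel Q n)

namespace Hn

/-- The family of generators of `H_n(Q)`. -/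
def g (y : (Fin n → I) ⊕ Arrow I n) : Hn Q n := gen k Arrow.src Arrow.tgt _ y

variable {n}

/-- The element `1_v` of `H_n(Q)`. -/
def e (v : Fin n → I) : Hn Q n := g Q n (Sum.inl v)

/-- The element `τ_{i,v}` of `H_n(Q)`. -/
def τ (i : Fin (n - 1)) (v : Fin n → I) : Hn Q n := g Q n (Sum.inr (Arrow.tau i v))

/-- The element `x_{a,v}` of `H_n(Q)`. -/
def x (a : Fin n) (v : Fin n → I) : Hn Q n := g Q n (Sum.inr (Arrow.x a v))

variable (n)

/-- The filtration of `H_n(Q)` with `1_v` and `x_{a,v}` in degree `0` and `τ_{i,v}` in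
degree `1`. -/
def filtration : AlgFiltration k (Hn Q n) :=
  AlgFiltration.ofDegrees k (g Q n) genDegree

/-- The associated graded algebra of `H_n(Q)`. -/
abbrev Gr : Type _ := (filtration Q n).Gr

variable {n}

/-- The class of `1_v` in degree `0` of the associated graded algebra. -/
def grE (v : Fin n → I) : Gr Q n :=
  (filtration Q n).symbol 0 (e Q v) (AlgFiltration.gen_mem_ofDegrees _ _ _ le_rfl)

/-- The class of `x_{a,v}` in degree `0` of the associated graded algebra. -/
def grX (a : Fin n) (v : Fin n → I) : Gr Q n :=
  (filtration Q n).symbol 0 (x Q a v) (AlgFiltration.gen_mem_ofDegrees _ _ _ le_rfl)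

/-- The class of `τ_{i,v}` in degree `1` of the associated graded algebra. -/
def grT (i : Fin (n - 1)) (v : Fin n → I) : Gr Q n :=
  (filtration Q n).symbol 1 (τ Q i v) (AlgFiltration.gen_mem_ofDegrees _ _ _ le_rfl)

/-- For a sequence `(i_1, …, i_r)` and a vertex `v`, the product
`τ_{i_r, s_{i_{r-1}} ⋯ s_{i_1}(v)} ⋯ τ_{i_2, s_{i_1}(v)} τ_{i_1, v}`; it is `1_v` for the empty
sequence. -/
def tauWord : List (Fin (n - 1)) → (Fin n → I) → Hn Q n
  | [], v => e Q v
  | i :: l, v => tauWord l (sAct i v) * τ Q i v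

/-- The element `τ_{i_r, s_{i_{r-1}} ⋯ s_{i_1}(v)} ⋯ τ_{i_1, v} x_{1,v}^{a_1} ⋯ x_{n,v}^{a_n}`. -/
def basisElt (l : List (Fin (n - 1))) (a : Fin n → ℕ) (v : Fin n → I) : Hn Q n :=
  tauWord Q l v * (List.ofFn fun j => x Q j v ^ a j).prod

end Hn

end QuiverHeckeAlgebra

/-! ### Reduced words -/

/-- The permutation `s_{i_r} ⋯ s_{i_1}` attached to the sequence `(i_1, …, i_r)`. -/
def wordPerm {n : ℕ} (l : List (Fin (n - 1))) : Equiv.Perm (Fin n) := (l.reverse.map sPerm).prod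

/-- `J` contains exactly one sequence representing each permutation, and this sequence has minimal
length among all the sequences representing this permutation. -/
def IsReducedRepresentatives {n : ℕ} (J : Set (List (Fin (n - 1)))) : Prop :=
  Set.BijOn wordPerm J Set.univ ∧
    ∀ l ∈ J, ∀ l' : List (Fin (n - 1)), wordPerm l' = wordPerm l → l.length ≤ l'.length

/-! ### The polynomial representation -/

section PolynomialRepresentation

variable {k : Type*} [CommRing k] {I : Type*} [DecidableEq I] {n : ℕ}

/-- The module `M = ⨁_{v ∈ I^n} k[x_1, …, x_n]` (for `I` finite). -/
abbrev PolyRep (k : Type*) [CommRing k] (I : Type*) (n : ℕ) : Type _ :=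
  (Fin n → I) → MvPolynomial (Fin n) k

/-- The endomorphism of `M` equal to `φ : M_v → M_w` on the summand `M_v` and to zero on the other
summands. -/
def arrowOp (v w : Fin n → I) (φ : MvPolynomial (Fin n) k →ₗ[k] MvPolynomial (Fin n) k) :
    Module.End k (PolyRep k I n) :=
  LinearMap.single k (fun _ : Fin n → I => MvPolynomial (Fin n) k) w ∘ₗ φ ∘ₗ LinearMap.proj v

/-- The operator `τ_{i,v} : M_v → M_{s_i(v)}`: the divided difference
`(x_i - x_{i+1})⁻¹ (s_i - 1)` if `s_i(v) = v`, and `P_{v_i, v_{i+1}}(x_{i+1}, x_i) s_i`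
otherwise. -/
def tauOp (P : I → I → MvPolynomial (Fin 2) k) (i : Fin (n - 1)) (v : Fin n → I) :
    MvPolynomial (Fin n) k →ₗ[k] MvPolynomial (Fin n) k :=
  if sAct i v = v then divDiff k i
  else LinearMap.mulLeft k (eval₂At (P (v (lo i)) (v (hi i))) (hi i) (lo i)) ∘ₗ sPoly k i

end PolynomialRepresentation

end

end QuiverHecke

namespace QuiverHecke

/-! ### Reduced words in the symmetric group -/

section Words

variable {n : ℕ}

/-! Spanning. Modulo products with fewer factors `τ`, the `τ`'s satisfy the nil-Coxeter relations
and polynomials pass through them up to a permutation of the variables. Products of generators can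
therefore be sorted into words in the `τ`'s followed by polynomials. By Matsumoto's theorem
(`IsReduced.braidEq`) two reduced words of the same permutation have equal products up to shorter
words. By the exchange property a non-reduced word is equivalent to one containing a square, hence
reduces to shorter words. Induction on the length shows that the proposed basis spans
(`IsNegligible.wordFil_le`). The argument is stated for abstract generators and abstract error
submodules, so that it applies both to `H_n(Q)`, with errors in the lower filtration step, and to
the nil-wreath algebra, with zero errors.

Independence. The relations of `H_n(Q)` with `Q_ij(u,u') = P_ij(u,u') P_ji(u',u)` are checked on
polynomials (`exists_polyRep`). After clearing a denominator, every `τ_i` acts as `b + b' s_i` with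
`b'` a non-zero-divisor. The operator of a reduced word of `w` is thus a non-zero-divisor times `w`
plus terms with fewer inversions (`exists_wordOp_expansion`). Permutations of the variables are
linearly independent over polynomials (`eq_zero_of_sum_rename_eq_zero`), and triangularity makes the
images of the spanning family independent (`eq_zero_of_sum_arrowOp_eq_zero`). This gives
faithfulness and the basis at once. An arbitrary admissible `Q` is of this form: a total order on
`I` lets one put all of `Q_ij` into `P_ij` for `i < j` and take `P_ij = 1` for `i > j`.

Graded algebra. The defining relations of the nil-wreath algebra hold in `gr`, which gives the
morphism `f`. It sends words spanning the nil-wreath algebra to the symbols of a basis adapted to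
the filtration. These symbols are independent (`AlgFiltration.exists_coordinates`) and span `gr`, so
`f` is bijective. -/

/-- The set of inversions of a permutation. -/
def inversions (w : Equiv.Perm (Fin n)) : Finset (Fin n × Fin n) :=
  {p | p.1 < p.2 ∧ w p.2 < w p.1}

lemma mem_inversions {w : Equiv.Perm (Fin n)} {p : Fin n × Fin n} :
    p ∈ inversions w ↔ p.1 < p.2 ∧ w p.2 < w p.1 := by
  simp [inversions]

/-- The number of inversions of a permutation. -/
def inv (w : Equiv.Perm (Fin n)) : ℕ := (inversions w).card

lemma lo_lt_hi (i : Fin (n - 1)) : lo i < hi i := by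
  simp [lo, hi, Fin.lt_def]

lemma sPerm_lo (i : Fin (n - 1)) : sPerm i (lo i) = hi i := Equiv.swap_apply_left _ _

lemma sPerm_hi (i : Fin (n - 1)) : sPerm i (hi i) = lo i := Equiv.swap_apply_right _ _

lemma sPerm_of_ne {i : Fin (n - 1)} {a : Fin n} (h : a ≠ lo i) (h' : a ≠ hi i) :
    sPerm i a = a := Equiv.swap_apply_of_ne_of_ne h h'

lemma sPerm_mul_self (i : Fin (n - 1)) : sPerm i * sPerm i = 1 := Equiv.swap_mul_self _ _

lemma sPerm_sPerm (i : Fin (n - 1)) (a : Fin n) : sPerm i (sPerm i a) = a :=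
  Equiv.swap_apply_self _ _ _

/-- No position lies strictly between two consecutive ones, so exchanging them reverses the order of
that pair only. -/
lemma sPerm_lt_sPerm {i : Fin (n - 1)} {a b : Fin n} (hab : a < b)
    (h : ¬(a = lo i ∧ b = hi i)) : sPerm i a < sPerm i b := by
  have h1 : (lo i : ℕ) = i := rfl
  have h2 : (hi i : ℕ) = i + 1 := rfl
  have key : ∀ c : Fin n, (c = lo i ∧ sPerm i c = hi i) ∨ (c = hi i ∧ sPerm i c = lo i) ∨
      (c ≠ lo i ∧ c ≠ hi i ∧ sPerm i c = c) := by
    intro c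
    by_cases hc : c = lo i
    · left; exact ⟨hc, hc ▸ sPerm_lo i⟩
    · by_cases hc' : c = hi i
      · right; left; exact ⟨hc', hc' ▸ sPerm_hi i⟩
      · right; right; exact ⟨hc, hc', sPerm_of_ne hc hc'⟩
  rcases key a with ⟨ha, ha'⟩ | ⟨ha, ha'⟩ | ⟨ha, ha2, ha'⟩ <;>
  rcases key b with ⟨hb, hb'⟩ | ⟨hb, hb'⟩ | ⟨hb, hb2, hb'⟩ <;>
  rw [ha', hb'] <;>
  simp only [Fin.ext_iff, Fin.lt_def, h1, h2, ne_eq] at * <;> omega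

/-- Applying `s_i` to both entries matches the inversions of `w * sPerm i` with those of `w`, except
for the pair `(lo i, hi i)`, the only one whose order `s_i` reverses. -/
lemma inversions_mul_sPerm {w : Equiv.Perm (Fin n)} {i : Fin (n - 1)}
    (h : w (lo i) < w (hi i)) :
    inversions (w * sPerm i) =
      insert (lo i, hi i) ((inversions w).image (Prod.map (sPerm i) (sPerm i))) := by
  ext ⟨a, b⟩
  simp only [Finset.mem_insert, Finset.mem_image, mem_inversions, Equiv.Perm.mul_apply,
    Prod.exists, Prod.map_apply, Prod.mk.injEq]
  constructor
  · rintro ⟨hab, hw⟩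
    by_cases hc : a = lo i ∧ b = hi i
    · exact Or.inl hc
    · exact Or.inr ⟨sPerm i a, sPerm i b, ⟨sPerm_lt_sPerm hab hc, hw⟩, sPerm_sPerm _ _,
        sPerm_sPerm _ _⟩
  · rintro (⟨rfl, rfl⟩ | ⟨c, d, ⟨hcd, hw⟩, rfl, rfl⟩)
    · exact ⟨lo_lt_hi i, by rwa [sPerm_lo, sPerm_hi]⟩
    · rw [sPerm_sPerm, sPerm_sPerm]
      refine ⟨sPerm_lt_sPerm hcd ?_, hw⟩
      rintro ⟨rfl, rfl⟩
      exact absurd hw h.le.not_gt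

lemma inv_mul_sPerm_of_lt {w : Equiv.Perm (Fin n)} {i : Fin (n - 1)}
    (h : w (lo i) < w (hi i)) : inv (w * sPerm i) = inv w + 1 := by
  unfold inv
  rw [inversions_mul_sPerm h, Finset.card_insert_of_notMem, Finset.card_image_of_injective]
  · exact (sPerm i).injective.prodMap (sPerm i).injective
  · simp only [Finset.mem_image, mem_inversions, Prod.exists, Prod.map_apply, Prod.mk.injEq,
      not_exists, not_and]
    rintro a b ⟨hab, -⟩ ha hb
    have ha' : a = hi i := by rw [← sPerm_sPerm i a, ha, sPerm_lo]
    have hb' : b = lo i := by rw [← sPerm_sPerm i b, hb, sPerm_hi]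
    rw [ha', hb'] at hab
    exact absurd hab (lo_lt_hi i).le.not_gt

lemma inv_of_gt {w : Equiv.Perm (Fin n)} {i : Fin (n - 1)}
    (h : w (hi i) < w (lo i)) : inv w = inv (w * sPerm i) + 1 := by
  have := inv_mul_sPerm_of_lt (w := w * sPerm i) (i := i)
    (by simpa [Equiv.Perm.mul_apply, sPerm_lo, sPerm_hi] using h)
  rwa [mul_assoc, sPerm_mul_self, mul_one] at this

lemma inv_mul_sPerm_le (w : Equiv.Perm (Fin n)) (i : Fin (n - 1)) :
    inv (w * sPerm i) ≤ inv w + 1 := by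
  rcases lt_or_gt_of_ne (w.injective.ne (lo_ne_hi i)) with h | h
  · exact (inv_mul_sPerm_of_lt h).le
  · have := inv_of_gt h; omega

lemma inv_one : inv (1 : Equiv.Perm (Fin n)) = 0 := by
  rw [inv, Finset.card_eq_zero, Finset.eq_empty_iff_forall_notMem]
  rintro p hp
  rw [mem_inversions] at hp
  exact absurd hp.1 hp.2.le.not_gt

/-- Without descents `w` is an order automorphism of a finite chain, and such an automorphism is
unique. -/
lemma eq_one_of_forall_lt (w : Equiv.Perm (Fin n)) (h : ∀ i, w (lo i) < w (hi i)) : w = 1 := by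
  have hm : StrictMono w := by
    obtain _ | n := n
    · intro a; exact a.elim0
    · rw [Fin.strictMono_iff_lt_succ]
      intro i
      exact h i
  ext a
  have hid := Subsingleton.elim (hm.orderIsoOfSurjective w w.surjective) (OrderIso.refl _)
  have := DFunLike.congr_fun hid a
  exact congrArg Fin.val this

lemma wordPerm_nil : wordPerm ([] : List (Fin (n - 1))) = 1 := rfl

lemma wordPerm_cons (i : Fin (n - 1)) (l : List (Fin (n - 1))) :
    wordPerm (i :: l) = wordPerm l * sPerm i := by
  simp [wordPerm]

lemma inv_wordPerm_le (l : List (Fin (n - 1))) : inv (wordPerm l) ≤ l.length := by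
  induction l with
  | nil => rw [wordPerm_nil, inv_one]; exact le_rfl
  | cons i l ih =>
    rw [wordPerm_cons, List.length_cons]
    exact (inv_mul_sPerm_le _ _).trans (by omega)

/-- Bubble sort: a permutation other than the identity has a descent, and removing it lowers the
inversion number by one. -/
lemma exists_word (w : Equiv.Perm (Fin n)) :
    ∃ l : List (Fin (n - 1)), wordPerm l = w ∧ l.length = inv w := by
  induction hr : inv w generalizing w with
  | zero =>
    refine ⟨[], ?_, rfl⟩
    rw [wordPerm_nil, eq_one_of_forall_lt w]
    intro i
    by_contra! hlt
    have := inv_of_gt (lt_of_le_of_ne hlt (w.injective.ne (lo_ne_hi i).symm))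
    omega
  | succ r ih =>
    have : ∃ i, w (hi i) < w (lo i) := by
      by_contra! hc
      have : w = 1 := eq_one_of_forall_lt w fun i =>
        lt_of_le_of_ne (hc i) (w.injective.ne (lo_ne_hi i))
      rw [this, inv_one] at hr
      omega
    obtain ⟨i, hi⟩ := this
    obtain ⟨l, hl, hl'⟩ := ih (w * sPerm i) (by have := inv_of_gt hi; omega)
    refine ⟨i :: l, ?_, by simp [hl']⟩
    rw [wordPerm_cons, hl, mul_assoc, sPerm_mul_self, mul_one]

/-- A word is reduced if its length is the number of inversions of its permutation. -/
def IsReduced (l : List (Fin (n - 1))) : Prop := inv (wordPerm l) = l.length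

lemma IsReduced.of_cons {i : Fin (n - 1)} {l : List (Fin (n - 1))} (h : IsReduced (i :: l)) :
    IsReduced l := by
  unfold IsReduced at *
  rw [wordPerm_cons, List.length_cons] at h
  have h1 := inv_mul_sPerm_le (wordPerm l) i
  have h2 := inv_wordPerm_le l
  omega

lemma IsReduced.gt {i : Fin (n - 1)} {l : List (Fin (n - 1))} (h : IsReduced (i :: l)) :
    wordPerm (i :: l) (hi i) < wordPerm (i :: l) (lo i) := by
  have h' := h.of_cons
  unfold IsReduced at h h'
  rw [List.length_cons] at h
  rcases lt_or_gt_of_ne ((wordPerm (i :: l)).injective.ne (lo_ne_hi i)) with hlt | hlt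
  · have := inv_mul_sPerm_of_lt hlt
    rw [wordPerm_cons, mul_assoc, sPerm_mul_self, mul_one, ← wordPerm_cons] at this
    omega
  · exact hlt

/-- The inversion number is a lower bound for the length of a word and is attained by some word, so
it is the Coxeter length. This translates the minimality condition on `J` into inversions. -/
lemma isReduced_iff_forall_le {l : List (Fin (n - 1))} :
    IsReduced l ↔ ∀ l' : List (Fin (n - 1)), wordPerm l' = wordPerm l → l.length ≤ l'.length := by
  constructor
  · intro h l' hl'
    rw [← h, ← hl']
    exact inv_wordPerm_le l'
  · intro h
    obtain ⟨l', h1, h2⟩ := exists_word (wordPerm l)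
    exact le_antisymm (inv_wordPerm_le l) (h2 ▸ h l' h1)

/-- The equivalence relation on words generated by the braid and commutation relations at the
end of a word, with letters added at the beginning. -/
inductive BraidEq : List (Fin (n - 1)) → List (Fin (n - 1)) → Prop
  | refl (l) : BraidEq l l
  | symm {l l'} : BraidEq l l' → BraidEq l' l
  | trans {l l' l''} : BraidEq l l' → BraidEq l' l'' → BraidEq l l''
  | cons (i) {l l'} : BraidEq l l' → BraidEq (i :: l) (i :: l')
  | far {i j : Fin (n - 1)} (h : (i : ℕ) + 1 < j) (l) : BraidEq (i :: j :: l) (j :: i :: l)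
  | braid {i j : Fin (n - 1)} (h : (j : ℕ) = i + 1) (l) :
      BraidEq (i :: j :: i :: l) (j :: i :: j :: l)

lemma BraidEq.length_eq {l l' : List (Fin (n - 1))} (h : BraidEq l l') :
    l.length = l'.length := by
  induction h <;> simp_all

/-! ### Commutation and braid identities for the simple transpositions. -/

lemma lo_of_succ {i j : Fin (n - 1)} (h : (j : ℕ) = i + 1) : lo j = hi i := by
  simp [lo, hi, h]

lemma lo_ne_hi_of_succ {i j : Fin (n - 1)} (h : (j : ℕ) = i + 1) : lo i ≠ hi j := by
  simp only [lo, hi, ne_eq, Fin.mk.injEq]; omega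

lemma hi_ne_hi_of_succ {i j : Fin (n - 1)} (h : (j : ℕ) = i + 1) : hi i ≠ hi j := by
  simp only [hi, ne_eq, Fin.mk.injEq]; omega

lemma sPerm_lo_of_far {i j : Fin (n - 1)} (h : (i : ℕ) + 1 < j ∨ (j : ℕ) + 1 < i) :
    sPerm j (lo i) = lo i := by
  apply sPerm_of_ne <;> simp only [lo, hi, ne_eq, Fin.mk.injEq] <;> omega

lemma sPerm_hi_of_far {i j : Fin (n - 1)} (h : (i : ℕ) + 1 < j ∨ (j : ℕ) + 1 < i) :
    sPerm j (hi i) = hi i := by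
  apply sPerm_of_ne <;> simp only [lo, hi, ne_eq, Fin.mk.injEq] <;> omega

lemma sPerm_comm {i j : Fin (n - 1)} (h : (i : ℕ) + 1 < j ∨ (j : ℕ) + 1 < i) :
    sPerm i * sPerm j = sPerm j * sPerm i := by
  have := Equiv.mul_swap_eq_swap_mul (sPerm i) (lo j) (hi j)
  rw [sPerm_lo_of_far (Or.symm h), sPerm_hi_of_far (Or.symm h)] at this
  exact this

lemma sPerm_lo_lower {i j : Fin (n - 1)} (h : (j : ℕ) = i + 1) : sPerm j (lo i) = lo i :=
  sPerm_of_ne (by rw [lo_of_succ h]; exact lo_ne_hi i) (lo_ne_hi_of_succ h)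

lemma sPerm_hi_lower {i j : Fin (n - 1)} (h : (j : ℕ) = i + 1) : sPerm j (hi i) = hi j := by
  rw [← lo_of_succ h, sPerm_lo]

lemma sPerm_hi_upper {i j : Fin (n - 1)} (h : (j : ℕ) = i + 1) : sPerm i (hi j) = hi j :=
  sPerm_of_ne (lo_ne_hi_of_succ h).symm (hi_ne_hi_of_succ h).symm

lemma sPerm_braid {i j : Fin (n - 1)} (h : (j : ℕ) = i + 1) :
    sPerm i * sPerm j * sPerm i = sPerm j * sPerm i * sPerm j := by
  have h1 : sPerm i * sPerm j * sPerm i = Equiv.swap (lo i) (hi j) := by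
    have := Equiv.mul_swap_eq_swap_mul (sPerm i) (lo j) (hi j)
    rw [lo_of_succ h, sPerm_hi, sPerm_hi_upper h] at this
    rw [show sPerm i * sPerm j = Equiv.swap (lo i) (hi j) * sPerm i by
      rw [← this, ← lo_of_succ h]; rfl, mul_assoc, sPerm_mul_self, mul_one]
  have h2 : sPerm j * sPerm i * sPerm j = Equiv.swap (lo i) (hi j) := by
    have := Equiv.mul_swap_eq_swap_mul (sPerm j) (lo i) (hi i)
    rw [sPerm_lo_lower h, sPerm_hi_lower h] at this
    rw [show sPerm j * sPerm i = Equiv.swap (lo i) (hi j) * sPerm j from this, mul_assoc,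
      sPerm_mul_self, mul_one]
  rw [h1, h2]

/-- A permutation with a descent at `i` has a reduced word beginning with `i`. -/
lemma exists_reduced_cons {w : Equiv.Perm (Fin n)} {i : Fin (n - 1)}
    (h : w (hi i) < w (lo i)) : ∃ l, wordPerm (i :: l) = w ∧ IsReduced (i :: l) := by
  obtain ⟨l, hl, hl'⟩ := exists_word (w * sPerm i)
  have hw : wordPerm (i :: l) = w := by
    rw [wordPerm_cons, hl, mul_assoc, sPerm_mul_self, mul_one]
  refine ⟨l, hw, ?_⟩
  rw [IsReduced, hw, List.length_cons, hl', inv_of_gt h]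

lemma wordPerm_eq_of_cons {i : Fin (n - 1)} {l l' : List (Fin (n - 1))}
    (h : wordPerm (i :: l) = wordPerm (i :: l')) : wordPerm l = wordPerm l' := by
  rw [wordPerm_cons, wordPerm_cons] at h
  exact mul_right_cancel h

lemma isReduced_congr {l l' : List (Fin (n - 1))} (h : IsReduced l)
    (hw : wordPerm l = wordPerm l') (hl : l.length = l'.length) : IsReduced l' := by
  rw [IsReduced, ← hw, ← hl]; exact h

lemma IsReduced.length_eq {l l' : List (Fin (n - 1))} (h : IsReduced l) (h' : IsReduced l')
    (hw : wordPerm l = wordPerm l') : l.length = l'.length := by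
  rw [← h, ← h', hw]

/-- Matsumoto's theorem for the symmetric group. -/
theorem IsReduced.braidEq {l l' : List (Fin (n - 1))} (h : IsReduced l) (h' : IsReduced l')
    (hw : wordPerm l = wordPerm l') : BraidEq l l' := by
  induction hr : l.length generalizing l l' with
  | zero =>
    have h0 := h.length_eq h' hw
    rw [List.length_eq_zero_iff.1 hr, List.length_eq_zero_iff.1 (h0.symm.trans hr)]
    exact .refl _
  | succ r ih =>
    have hlen := h.length_eq h' hw
    obtain _ | ⟨i, l⟩ := l
    · simp at hr
    obtain _ | ⟨j, l'⟩ := l'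
    · simp at hlen
    have hr' : l.length = r := by simpa using hr
    have hr'' : l'.length = r := by rw [List.length_cons, List.length_cons] at hlen; omega
    -- it suffices to find reduced words beginning with `i` and `j` that are related
    have glue : ∀ {m m' : List (Fin (n - 1))}, wordPerm (i :: m) = wordPerm (i :: l) →
        wordPerm (j :: m') = wordPerm (i :: l) → m.length = r → m'.length = r →
        BraidEq (i :: m) (j :: m') → BraidEq (i :: l) (j :: l') := by
      intro m m' hm hm' hmr hmr' hb
      have hm1 : IsReduced m := isReduced_congr h.of_cons
        (wordPerm_eq_of_cons hm).symm (by omega)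
      have hm1' : IsReduced m' := isReduced_congr h'.of_cons
        (wordPerm_eq_of_cons (hm'.trans hw)).symm (by omega)
      exact ((ih h.of_cons hm1 (wordPerm_eq_of_cons hm).symm hr').cons i).trans
        (hb.trans ((ih hm1' h'.of_cons (wordPerm_eq_of_cons (hm'.trans hw)) hmr').cons j))
    -- With descents at both `i` and `j`, the longest element of the subgroup generated by `s_i` and
    -- `s_j` can be split off from `w` with lengths adding. Its two reduced words, completed by one
    -- common word, yield words of `w` beginning with `i` and with `j` that differ by a single move.
    have key : ∀ {i j : Fin (n - 1)} {w : Equiv.Perm (Fin n)}, w (hi i) < w (lo i) →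
        w (hi j) < w (lo j) → (i : ℕ) < j →
        ∃ m m', wordPerm (i :: m) = w ∧ wordPerm (j :: m') = w ∧
          m.length + 1 = inv w ∧ m'.length + 1 = inv w ∧ BraidEq (i :: m) (j :: m') := by
      clear * -
      intro i j w hi' hj' hij
      have h1 := inv_of_gt hi'
      by_cases hadj : (j : ℕ) = i + 1
      -- Here `w` is decreasing on three consecutive positions, so each of the three multiplications
      -- lowers the inversion number.
      · have h2 : inv (w * sPerm i) = inv (w * sPerm i * sPerm j) + 1 := by
          apply inv_of_gt
          rw [Equiv.Perm.mul_apply, Equiv.Perm.mul_apply, lo_of_succ hadj, sPerm_hi,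
            sPerm_hi_upper hadj]
          rw [lo_of_succ hadj] at hj'
          exact hj'.trans hi'
        have h3 : inv (w * sPerm i * sPerm j) = inv (w * sPerm i * sPerm j * sPerm i) + 1 := by
          apply inv_of_gt
          simp only [Equiv.Perm.mul_apply]
          rw [sPerm_lo_lower hadj, sPerm_lo, sPerm_hi_lower hadj, sPerm_hi_upper hadj]
          rwa [lo_of_succ hadj] at hj'
        obtain ⟨m, hm, hmr⟩ := exists_word (w * sPerm i * sPerm j * sPerm i)
        have e1 : wordPerm (i :: j :: i :: m) = w := by
          simp only [wordPerm_cons, hm]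
          rw [mul_assoc _ (sPerm i) (sPerm i), sPerm_mul_self, mul_one,
            mul_assoc _ (sPerm j) (sPerm j), sPerm_mul_self, mul_one,
            mul_assoc _ (sPerm i) (sPerm i), sPerm_mul_self, mul_one]
        refine ⟨j :: i :: m, i :: j :: m, e1, ?_, ?_, ?_, .braid hadj m⟩
        · rw [← e1]
          simp only [wordPerm_cons]
          have := sPerm_braid hadj
          simp only [mul_assoc] at this ⊢
          rw [this]
        · simp only [List.length_cons]; omega
        · simp only [List.length_cons]; omega
      · have hfar : (i : ℕ) + 1 < j := by omega
        have h2 : inv (w * sPerm i) = inv (w * sPerm i * sPerm j) + 1 := by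
          apply inv_of_gt
          rw [Equiv.Perm.mul_apply, Equiv.Perm.mul_apply, sPerm_lo_of_far (Or.inr hfar),
            sPerm_hi_of_far (Or.inr hfar)]
          exact hj'
        obtain ⟨m, hm, hmr⟩ := exists_word (w * sPerm i * sPerm j)
        have e1 : wordPerm (i :: j :: m) = w := by
          simp only [wordPerm_cons, hm]
          rw [mul_assoc _ (sPerm j) (sPerm j), sPerm_mul_self, mul_one,
            mul_assoc _ (sPerm i) (sPerm i), sPerm_mul_self, mul_one]
        refine ⟨j :: m, i :: m, e1, ?_, ?_, ?_, .far hfar m⟩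
        · rw [← e1]
          simp only [wordPerm_cons, mul_assoc, sPerm_comm (Or.inl hfar)]
        · simp only [List.length_cons]; omega
        · simp only [List.length_cons]; omega
    have hinv : inv (wordPerm (i :: l)) = r + 1 := by rw [← hr]; exact h
    have hgi := h.gt
    have hgj := h'.gt
    rw [← hw] at hgj
    rcases lt_trichotomy (i : ℕ) j with hij | hij | hij
    · obtain ⟨m, m', h1, h2, h3, h4, h5⟩ := key hgi hgj hij
      exact glue h1 h2 (by omega) (by omega) h5
    · obtain rfl := Fin.ext hij
      exact (ih h.of_cons h'.of_cons (wordPerm_eq_of_cons hw) hr').cons i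
    · obtain ⟨m, m', h1, h2, h3, h4, h5⟩ := key hgj hgi hij
      exact glue h2 h1 (by omega) (by omega) h5.symm

/-- The exchange property: if `l` is reduced but `i :: l` is not, then some word equivalent to `l`
begins with `i`. -/
theorem IsReduced.exists_braidEq_cons {i : Fin (n - 1)} {l : List (Fin (n - 1))}
    (h : IsReduced l) (hi : ¬IsReduced (i :: l)) : ∃ l', BraidEq l (i :: l') := by
  rcases lt_or_gt_of_ne ((wordPerm l).injective.ne (lo_ne_hi i)) with hlt | hlt
  · refine absurd ?_ hi
    rw [IsReduced, wordPerm_cons, inv_mul_sPerm_of_lt hlt, h, List.length_cons]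
  · obtain ⟨l', h1, h2⟩ := exists_reduced_cons hlt
    exact ⟨l', h.braidEq h2 h1.symm⟩

lemma IsReducedRepresentatives.isReduced {J : Set (List (Fin (n - 1)))}
    (hJ : IsReducedRepresentatives J) {l : List (Fin (n - 1))} (hl : l ∈ J) : IsReduced l :=
  isReduced_iff_forall_le.2 (hJ.2 l hl)

lemma exists_isReducedRepresentatives :
    ∃ J : Set (List (Fin (n - 1))), IsReducedRepresentatives J := by
  choose f hf hf' using exists_word (n := n)
  refine ⟨Set.range f, ⟨fun _ _ => Set.mem_univ _, ?_, fun w _ => ⟨f w, ⟨w, rfl⟩, hf w⟩⟩, ?_⟩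
  · rintro _ ⟨w, rfl⟩ _ ⟨w', rfl⟩ h
    rw [hf, hf] at h
    rw [h]
  · rintro _ ⟨w, rfl⟩
    exact isReduced_iff_forall_le.1 (by rw [IsReduced, hf, hf'])

end Words

end QuiverHecke

namespace QuiverHecke

noncomputable section

/-! ### Systems of generators indexed by the quiver `Ψ_{I,n}` -/

section PsiSystem

open MvPolynomial

variable {k : Type*} [CommRing k] {I : Type*} {n : ℕ}
  {A : Type*} [Ring A] [Algebra k A]

lemma sAct_sAct (i : Fin (n - 1)) (v : Fin n → I) : sAct i (sAct i v) = v := by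
  ext a; simp [sAct, sPerm_sPerm]

/-- A family of elements of a ring satisfying the path relations of the quiver `Ψ_{I,n}` and the
commutation of the loops. -/
structure IsPsiSystem [Fintype I] (e : (Fin n → I) → A) (τ : Fin (n - 1) → (Fin n → I) → A)
    (x : Fin n → (Fin n → I) → A) : Prop where
  e_mul_self : ∀ v, e v * e v = e v
  e_mul_of_ne : ∀ {v w}, v ≠ w → e v * e w = 0
  sum_e : ∑ v, e v = 1
  e_mul_τ : ∀ i v, e (sAct i v) * τ i v = τ i v
  e_mul_τ_of_ne : ∀ i v w, sAct i v ≠ w → e w * τ i v = 0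
  τ_mul_e : ∀ i v, τ i v * e v = τ i v
  τ_mul_e_of_ne : ∀ i v w, v ≠ w → τ i v * e w = 0
  e_mul_x : ∀ a v, e v * x a v = x a v
  e_mul_x_of_ne : ∀ a v w, v ≠ w → e w * x a v = 0
  x_mul_e : ∀ a v, x a v * e v = x a v
  x_mul_e_of_ne : ∀ a v w, v ≠ w → x a v * e w = 0
  xx : ∀ a b v, x a v * x b v = x b v * x a v

/-- The element of an algebra attached to a generator of the free algebra on `Ψ_{I,n}`. -/
def genMap (e : (Fin n → I) → A) (τ : Fin (n - 1) → (Fin n → I) → A)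
    (x : Fin n → (Fin n → I) → A) : (Fin n → I) ⊕ Arrow I n → A
  | Sum.inl v => e v
  | Sum.inr (Arrow.tau i v) => τ i v
  | Sum.inr (Arrow.x a v) => x a v

/-- The morphism from the free algebra on `Ψ_{I,n}` attached to a family of elements. -/
def freeLift (k : Type*) [CommRing k] [Algebra k A] (e : (Fin n → I) → A)
    (τ : Fin (n - 1) → (Fin n → I) → A) (x : Fin n → (Fin n → I) → A) : Free k I n →ₐ[k] A :=
  FreeAlgebra.lift k (genMap e τ x)

section

variable (e : (Fin n → I) → A) (τ : Fin (n - 1) → (Fin n → I) → A) (x : Fin n → (Fin n → I) → A)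

@[simp] lemma freeLift_fE (v : Fin n → I) : freeLift k e τ x (fE k v) = e v :=
  FreeAlgebra.lift_ι_apply _ _

@[simp] lemma freeLift_fT (i : Fin (n - 1)) (v : Fin n → I) :
    freeLift k e τ x (fT k i v) = τ i v := FreeAlgebra.lift_ι_apply _ _

@[simp] lemma freeLift_fX (a : Fin n) (v : Fin n → I) :
    freeLift k e τ x (fX k a v) = x a v := FreeAlgebra.lift_ι_apply _ _

/-- The product of the `τ_{i,v}` along a word. -/
def wordProd : List (Fin (n - 1)) → (Fin n → I) → A
  | [], v => e v
  | i :: l, v => wordProd l (sAct i v) * τ i v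

/-- The sum of the loops `x_{a,v}` over all vertices. -/
def loopSum [Fintype I] (a : Fin n) : A := ∑ v, x a v

end

namespace IsPsiSystem

variable [Fintype I] {e : (Fin n → I) → A} {τ : Fin (n - 1) → (Fin n → I) → A} {x : Fin n → (Fin n → I) → A}

/-- The morphism from the algebra of a quiver with relations attached to a system satisfying these
relations. -/
lemma exists_lift (h : IsPsiSystem e τ x) {R : Free k I n → Free k I n → Prop}
    (hR : ∀ a b, R a b → freeLift k e τ x a = freeLift k e τ x b) :
    ∃ f : PathAlgebra k (Arrow.src (I := I) (n := n)) Arrow.tgt R →ₐ[k] A,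
      ∀ y, f (gen k Arrow.src Arrow.tgt R y) = genMap e τ x y := by
  have hR' : ∀ ⦃a b⦄, PathRel k (Arrow.src (I := I) (n := n)) Arrow.tgt R a b →
      freeLift k e τ x a = freeLift k e τ x b := by
    intro a b hab
    induction hab with
    | target a =>
      cases a <;> simp only [freeLift, map_mul, FreeAlgebra.lift_ι_apply, genMap, Arrow.tgt]
      · exact h.e_mul_τ _ _
      · exact h.e_mul_x _ _
    | target_ne a s hs =>
      cases a <;> simp only [freeLift, map_mul, map_zero, FreeAlgebra.lift_ι_apply, genMap]
      · exact h.e_mul_τ_of_ne _ _ _ hs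
      · exact h.e_mul_x_of_ne _ _ _ hs
    | source a =>
      cases a <;> simp only [freeLift, map_mul, FreeAlgebra.lift_ι_apply, genMap, Arrow.src]
      · exact h.τ_mul_e _ _
      · exact h.x_mul_e _ _
    | source_ne a s hs =>
      cases a <;> simp only [freeLift, map_mul, map_zero, FreeAlgebra.lift_ι_apply, genMap]
      · exact h.τ_mul_e_of_ne _ _ _ hs
      · exact h.x_mul_e_of_ne _ _ _ hs
    | idem s => simp only [freeLift, map_mul, FreeAlgebra.lift_ι_apply, genMap, h.e_mul_self]
    | orthogonal s t hst =>
      simp only [freeLift, map_mul, map_zero, FreeAlgebra.lift_ι_apply, genMap, h.e_mul_of_ne hst]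
    | unit => simp only [freeLift, map_sum, map_one, FreeAlgebra.lift_ι_apply, genMap, h.sum_e]
    | rel a b hab => exact hR a b hab
  refine ⟨RingQuot.liftAlgHom k ⟨freeLift k e τ x, hR'⟩, fun y => ?_⟩
  rw [gen, RingQuot.liftAlgHom_mkAlgHom_apply, freeLift, FreeAlgebra.lift_ι_apply]

/-! ### Loop sums and polynomials in them. -/

lemma e_mul_loopSum (h : IsPsiSystem e τ x) (a : Fin n) (v : Fin n → I) :
    e v * loopSum x a = x a v := by
  classical
  rw [loopSum, Finset.mul_sum, Finset.sum_eq_single v, h.e_mul_x]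
  · intro w _ hw; exact h.e_mul_x_of_ne _ _ _ hw
  · intro hv; exact absurd (Finset.mem_univ v) hv

lemma loopSum_mul_e (h : IsPsiSystem e τ x) (a : Fin n) (v : Fin n → I) :
    loopSum x a * e v = x a v := by
  classical
  rw [loopSum, Finset.sum_mul, Finset.sum_eq_single v, h.x_mul_e]
  · intro w _ hw; exact h.x_mul_e_of_ne _ _ _ hw
  · intro hv; exact absurd (Finset.mem_univ v) hv

lemma ext_e (h : IsPsiSystem e τ x) {a b : A} (hab : ∀ v, e v * a = e v * b) : a = b := by
  rw [← one_mul a, ← one_mul b, ← h.sum_e, Finset.sum_mul, Finset.sum_mul]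
  exact Finset.sum_congr rfl fun v _ => hab v

lemma loopSum_comm (h : IsPsiSystem e τ x) (a b : Fin n) :
    loopSum x a * loopSum x b = loopSum x b * loopSum x a := by
  refine h.ext_e fun v => ?_
  have key : ∀ a b, e v * (loopSum x a * loopSum x b) = x a v * x b v := by
    intro a b
    rw [← mul_assoc, h.e_mul_loopSum, ← h.x_mul_e, mul_assoc, h.e_mul_loopSum, h.x_mul_e]
  rw [key, key, h.xx]

/-- `A` is not commutative, so the evaluation of polynomials takes place in the commutative
subalgebra generated by the loop sums. -/
lemma exists_polyMap (h : IsPsiSystem e τ x) :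
    ∃ f : MvPolynomial (Fin n) k →ₐ[k] A, ∀ a, f (X a) = loopSum x a := by
  let S : Subalgebra k A := Algebra.adjoin k (Set.range (loopSum x))
  have hS : IsMulCommutative S := Algebra.isMulCommutative_adjoin k (by
    rintro _ ⟨a, rfl⟩ _ ⟨b, rfl⟩
    exact h.loopSum_comm a b)
  let _ : CommRing S := { (inferInstance : Ring S) with mul_comm := hS.is_comm.comm }
  let g : Fin n → S := fun a => ⟨loopSum x a, Algebra.subset_adjoin ⟨a, rfl⟩⟩
  refine ⟨S.val.comp (MvPolynomial.aeval g), fun a => ?_⟩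
  simp [g]

/-- The morphism from the polynomial algebra sending the variables to the sums of loops. -/
def polyMap (k : Type*) [CommRing k] [Algebra k A] (h : IsPsiSystem e τ x) :
    MvPolynomial (Fin n) k →ₐ[k] A :=
  (h.exists_polyMap (k := k)).choose

lemma polyMap_X (h : IsPsiSystem e τ x) (a : Fin n) : h.polyMap k (X a) = loopSum x a :=
  (h.exists_polyMap (k := k)).choose_spec a

lemma e_mul_polyMap (h : IsPsiSystem e τ x) (v : Fin n → I) (p : MvPolynomial (Fin n) k) :
    e v * h.polyMap k p = h.polyMap k p * e v := by
  induction p using MvPolynomial.induction_on with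
  | C r => rw [← MvPolynomial.algebraMap_eq, AlgHom.commutes, Algebra.commutes]
  | add p q hp hq => rw [map_add, mul_add, add_mul, hp, hq]
  | mul_X p a hp =>
    rw [map_mul, polyMap_X, ← mul_assoc, hp, mul_assoc, mul_assoc, h.e_mul_loopSum,
      h.loopSum_mul_e]

/-- The factor `e v` is essential: an exponent `0` contributes `1` rather than `e v`, and `x j v`
agrees with the loop sum only after multiplication by `e v`. -/
lemma e_mul_ofFn (h : IsPsiSystem e τ x) (v : Fin n → I) (a : Fin n → ℕ) :
    e v * (List.ofFn fun j => x j v ^ a j).prod =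
      e v * h.polyMap k (monomial (Finsupp.equivFunOnFinite.symm a) 1) := by
  have h1 : monomial (Finsupp.equivFunOnFinite.symm a) (1 : k) =
      (List.ofFn fun j => (X j : MvPolynomial (Fin n) k) ^ a j).prod := by
    rw [List.prod_ofFn, monomial_eq, C_1, one_mul, Finsupp.prod_fintype _ _ (by simp)]
    rfl
  rw [h1, List.ofFn_eq_map, List.ofFn_eq_map]
  generalize List.finRange n = m
  induction m with
  | nil => simp
  | cons j m ih =>
    have hpow : ∀ r, e v * x j v ^ r = h.polyMap k (X j ^ r) * e v := by
      intro r
      induction r with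
      | zero => simp
      | succ r ihr =>
        rw [pow_succ, ← mul_assoc, ihr, mul_assoc, h.e_mul_x, pow_succ, map_mul, polyMap_X,
          mul_assoc, h.loopSum_mul_e]
    rw [List.map_cons, List.map_cons, List.prod_cons, List.prod_cons, ← mul_assoc, hpow, mul_assoc,
      ih, map_mul, ← mul_assoc, ← mul_assoc, h.e_mul_polyMap]

/-- This replaces the ordered monomials of `polyAt` by values of an algebra morphism, the form in
which the quadratic and braid relations are used afterwards. -/
lemma freeLift_polyAt (h : IsPsiSystem e τ x) (v : Fin n → I) (p : MvPolynomial (Fin n) k) :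
    freeLift k e τ x (polyAt v p) = e v * h.polyMap k p := by
  conv_rhs => rw [p.as_sum]
  rw [polyAt, map_sum, map_sum, Finset.mul_sum]
  refine Finset.sum_congr rfl fun m _ => ?_
  have h1 : monomial m (p.coeff m) = p.coeff m • monomial m (1 : k) := by
    rw [smul_monomial, smul_eq_mul, mul_one]
  rw [h1, map_smul, map_smul, map_mul, map_list_prod, List.map_ofFn, freeLift_fE, mul_smul_comm]
  congr 1
  have h2 := h.e_mul_ofFn (k := k) v m
  rw [show Finsupp.equivFunOnFinite.symm ⇑m = m from Finsupp.equivFunOnFinite.symm_apply_apply m]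
    at h2
  rw [← h2]
  congr 3
  ext1 j
  simp

lemma wordProd_mul_e (h : IsPsiSystem e τ x) (l : List (Fin (n - 1))) (v : Fin n → I) :
    wordProd e τ l v * e v = wordProd e τ l v := by
  cases l with
  | nil => exact h.e_mul_self v
  | cons i l => rw [wordProd, mul_assoc, h.τ_mul_e]

lemma wordProd_mul_e_of_ne (h : IsPsiSystem e τ x) (l : List (Fin (n - 1))) {v w : Fin n → I}
    (hvw : v ≠ w) : wordProd e τ l v * e w = 0 := by
  rw [← h.wordProd_mul_e, mul_assoc, h.e_mul_of_ne hvw, mul_zero]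

/-- Each variable passes `τ` at the cost of a scalar multiple of `e v`, so by induction the total
error is a polynomial without any `τ`. The scalar `c` is left free to cover the Hecke relations
(`-1`, `1` or `0`) and the nil-wreath relations (`0`) together. -/
lemma polyMap_mul_τ (h : IsPsiSystem e τ x)
    (htx : ∀ i a v, ∃ c : k, τ i v * x a v - x (sPerm i a) (sAct i v) * τ i v = c • e v)
    (i : Fin (n - 1)) (v : Fin n → I) (p : MvPolynomial (Fin n) k) :
    ∃ q, h.polyMap k p * τ i v =
      τ i v * h.polyMap k (rename (sPerm i) p) + e v * h.polyMap k q := by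
  induction p using MvPolynomial.induction_on with
  | C r =>
    refine ⟨0, ?_⟩
    rw [rename_C, ← MvPolynomial.algebraMap_eq, AlgHom.commutes, Algebra.commutes, map_zero,
      mul_zero, add_zero]
  | add p q hp hq =>
    obtain ⟨p', hp⟩ := hp
    obtain ⟨q', hq⟩ := hq
    refine ⟨p' + q', ?_⟩
    simp only [map_add, add_mul, mul_add, hp, hq]
    abel
  | mul_X p a hp =>
    obtain ⟨q, hq⟩ := hp
    -- The relation is solved for `x_a τ_i` rather than `τ_i x_a`, hence its use at `s_i(a)`.
    obtain ⟨c, hc⟩ := htx i (sPerm i a) v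
    rw [sPerm_sPerm, sub_eq_iff_eq_add] at hc
    refine ⟨q * X (sPerm i a) - c • p, ?_⟩
    have h1 : loopSum x a * τ i v = x a (sAct i v) * τ i v := by
      rw [← h.e_mul_τ, ← mul_assoc, h.loopSum_mul_e, ← mul_assoc, h.x_mul_e]
    have h2 : x a (sAct i v) * τ i v = τ i v * loopSum x (sPerm i a) - c • e v := by
      have h3 : τ i v * x (sPerm i a) v = τ i v * loopSum x (sPerm i a) := by
        rw [← h.e_mul_loopSum, ← mul_assoc, h.τ_mul_e]
      rw [← h3, hc]; abel
    rw [map_mul, polyMap_X, mul_assoc, h1, h2, mul_sub, ← mul_assoc, hq, map_mul, rename_X,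
      map_mul, polyMap_X, map_sub, map_mul, polyMap_X, map_smul, mul_smul_comm, mul_sub,
      ← h.e_mul_polyMap, mul_smul_comm]
    simp only [add_mul, mul_assoc]
    abel

/-- The span of the products of a word of length at most `r` and a polynomial. -/
def wordFil (k : Type*) [CommRing k] [Algebra k A] (h : IsPsiSystem e τ x) (r : ℕ) :
    Submodule k A :=
  Submodule.span k {a | ∃ l v p, l.length ≤ r ∧ a = wordProd e τ l v * h.polyMap k p}

lemma mem_wordFil (h : IsPsiSystem e τ x) {r : ℕ} {l : List (Fin (n - 1))} (hl : l.length ≤ r)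
    (v : Fin n → I) (p : MvPolynomial (Fin n) k) :
    wordProd e τ l v * h.polyMap k p ∈ h.wordFil k r :=
  Submodule.subset_span ⟨l, v, p, hl, rfl⟩

/-! ### Stability of `wordFil` under right multiplication. -/

lemma mul_mem_of_mem_wordFil (h : IsPsiSystem e τ x) {r : ℕ} {N : Submodule k A} {b : A}
    (hb : ∀ l v p, l.length ≤ r → wordProd e τ l v * h.polyMap k p * b ∈ N) {a : A}
    (ha : a ∈ h.wordFil k r) : a * b ∈ N := by
  induction ha using Submodule.span_induction with
  | mem a ha => obtain ⟨l, v, p, hl, rfl⟩ := ha; exact hb l v p hl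
  | zero => rw [zero_mul]; exact N.zero_mem
  | add a a' _ _ ha ha' => rw [add_mul]; exact N.add_mem ha ha'
  | smul c a _ ha => rw [smul_mul_assoc]; exact N.smul_mem c ha

lemma mul_e_mem_wordFil (h : IsPsiSystem e τ x) {r : ℕ} {a : A} (ha : a ∈ h.wordFil k r)
    (w : Fin n → I) : a * e w ∈ h.wordFil k r := by
  refine h.mul_mem_of_mem_wordFil (fun l v p hl => ?_) ha
  rw [mul_assoc, ← h.e_mul_polyMap, ← mul_assoc]
  by_cases hvw : v = w
  · subst hvw
    rw [h.wordProd_mul_e]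
    exact h.mem_wordFil hl v p
  · rw [h.wordProd_mul_e_of_ne _ hvw, zero_mul]
    exact Submodule.zero_mem _

lemma mul_polyMap_mem_wordFil (h : IsPsiSystem e τ x) {r : ℕ} {a : A} (ha : a ∈ h.wordFil k r)
    (q : MvPolynomial (Fin n) k) : a * h.polyMap k q ∈ h.wordFil k r := by
  refine h.mul_mem_of_mem_wordFil (fun l v p hl => ?_) ha
  rw [mul_assoc, ← map_mul]
  exact h.mem_wordFil hl v _

lemma mul_x_mem_wordFil (h : IsPsiSystem e τ x) {r : ℕ} {a : A} (ha : a ∈ h.wordFil k r)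
    (b : Fin n) (w : Fin n → I) : a * x b w ∈ h.wordFil k r := by
  rw [← h.loopSum_mul_e, ← h.polyMap_X (k := k), ← mul_assoc]
  exact h.mul_e_mem_wordFil (h.mul_polyMap_mem_wordFil ha _) w

/-- The polynomial at the right end must first be moved past the new `τ`: the main term is a word
longer by one letter, and the error keeps the old length. -/
lemma mul_τ_mem_wordFil (h : IsPsiSystem e τ x)
    (htx : ∀ i a v, ∃ c : k, τ i v * x a v - x (sPerm i a) (sAct i v) * τ i v = c • e v)
    {r : ℕ} {a : A} (ha : a ∈ h.wordFil k r)
    (i : Fin (n - 1)) (w : Fin n → I) : a * τ i w ∈ h.wordFil k (r + 1) := by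
  have ha' := h.mul_e_mem_wordFil ha (sAct i w)
  rw [← h.e_mul_τ, ← mul_assoc]
  refine h.mul_mem_of_mem_wordFil (r := r) (fun l v p hl => ?_) ha'
  obtain ⟨q, hq⟩ := h.polyMap_mul_τ htx i w p
  rw [mul_assoc, hq, mul_add, ← mul_assoc, ← mul_assoc]
  refine Submodule.add_mem _ ?_ ?_
  · by_cases hv : v = sAct i w
    · subst hv
      exact h.mem_wordFil (l := i :: l) (by simpa using hl) w _
    · rw [← h.e_mul_τ, ← mul_assoc (wordProd e τ l v), h.wordProd_mul_e_of_ne _ hv, zero_mul,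
        zero_mul]
      exact Submodule.zero_mem _
  · exact h.mul_polyMap_mem_wordFil (h.mul_e_mem_wordFil
      (by simpa using h.mem_wordFil (k := k) (hl.trans (Nat.le_succ r)) v 1) w) q

lemma one_mem_wordFil (h : IsPsiSystem e τ x) (r : ℕ) : (1 : A) ∈ h.wordFil k r := by
  rw [← h.sum_e]
  refine Submodule.sum_mem _ fun v _ => ?_
  simpa [wordProd] using h.mem_wordFil (k := k) (l := []) (r := r) (by simp) v 1

/-- Arbitrary products of generators are sorted by appending one generator at a time on the right;
only a `τ` raises the length of the words. The induction therefore peels lists from their right end.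
-/
lemma ofDegrees_le_wordFil (h : IsPsiSystem e τ x)
    (htx : ∀ i a v, ∃ c : k, τ i v * x a v - x (sPerm i a) (sAct i v) * τ i v = c • e v) (r : ℕ) :
    (AlgFiltration.ofDegrees k (genMap e τ x) genDegree).F r ≤ h.wordFil k r := by
  refine Submodule.span_le.2 ?_
  rintro _ ⟨m, hm, rfl⟩
  induction m using List.reverseRecOn generalizing r with
  | nil => simpa using h.one_mem_wordFil r
  | append_singleton m y ih =>
    rw [List.map_append, List.sum_append] at hm
    rw [List.map_append, List.prod_append]
    simp only [List.map_cons, List.map_nil, List.prod_singleton, List.sum_singleton] at hm ⊢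
    rcases y with v | ⟨i, v⟩ | ⟨a, v⟩
    · exact h.mul_e_mem_wordFil (ih r (by simpa [genDegree] using hm)) v
    · obtain _ | r := r
      · simp [genDegree] at hm
      · exact h.mul_τ_mem_wordFil htx (ih r (by simpa [genDegree] using hm)) i v
    · exact h.mul_x_mem_wordFil (ih r (by simpa [genDegree] using hm)) a v

end IsPsiSystem

end PsiSystem

/-! ### Straightening -/

section Straightening

open MvPolynomial

variable {k : Type*} [CommRing k] {I : Type*} {n : ℕ} [Fintype I]
  {A : Type*} [Ring A] [Algebra k A]
  {e : (Fin n → I) → A} {τ : Fin (n - 1) → (Fin n → I) → A} {x : Fin n → (Fin n → I) → A}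

lemma sAct_comm {I : Type*} {i j : Fin (n - 1)} (h : (i : ℕ) + 1 < j) (v : Fin n → I) :
    sAct i (sAct j v) = sAct j (sAct i v) := by
  ext a
  have := DFunLike.congr_fun (sPerm_comm (Or.inl h)) a
  simp only [Equiv.Perm.mul_apply] at this
  simp [sAct, this]

lemma sAct_braid {I : Type*} {i j : Fin (n - 1)} (h : (j : ℕ) = i + 1) (v : Fin n → I) :
    sAct i (sAct j (sAct i v)) = sAct j (sAct i (sAct j v)) := by
  ext a
  have := DFunLike.congr_fun (sPerm_braid h) a
  simp only [Equiv.Perm.mul_apply] at this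
  simp [sAct, this]

/-- The element of the spanning family attached to a word, an exponent and a vertex. -/
def wordMonomial (e : (Fin n → I) → A) (τ : Fin (n - 1) → (Fin n → I) → A)
    (x : Fin n → (Fin n → I) → A) (l : List (Fin (n - 1))) (a : Fin n → ℕ) (v : Fin n → I) : A :=
  wordProd e τ l v * (List.ofFn fun j => x j v ^ a j).prod

lemma IsPsiSystem.wordMonomial_eq (h : IsPsiSystem e τ x) (l : List (Fin (n - 1)))
    (a : Fin n → ℕ) (v : Fin n → I) : wordMonomial e τ x l a v =
      wordProd e τ l v * h.polyMap k (monomial (Finsupp.equivFunOnFinite.symm a) 1) := by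
  rw [wordMonomial, ← h.wordProd_mul_e, mul_assoc, h.e_mul_ofFn (k := k), ← mul_assoc]

/-- Submodules of elements that are negligible in each degree, modulo which the `τ_{i,v}` satisfy
the nil-Coxeter relations. -/
structure IsNegligible (h : IsPsiSystem e τ x) (L : ℕ → Submodule k A) : Prop where
  zero : L 0 = ⊥
  succ_le : ∀ r, L (r + 1) ≤ h.wordFil k r
  mul_τ : ∀ {r a} i v, a ∈ L r → a * τ i v ∈ L (r + 1)
  τ_mul : ∀ {r a} i v, a ∈ L r → τ i v * a ∈ L (r + 1)
  e_mul : ∀ {r a} v, a ∈ L r → e v * a ∈ L r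
  mul_polyMap : ∀ {r a} p, a ∈ L r → a * h.polyMap k p ∈ L r
  sq : ∀ i v, τ i (sAct i v) * τ i v ∈ L 2
  far : ∀ (i j : Fin (n - 1)) v, (i : ℕ) + 1 < j → τ i (sAct j v) * τ j v - τ j (sAct i v) * τ i v ∈ L 2
  braid : ∀ (i j : Fin (n - 1)) v, (j : ℕ) = i + 1 →
    τ i (sAct j (sAct i v)) * τ j (sAct i v) * τ i v
      - τ j (sAct i (sAct j v)) * τ i (sAct j v) * τ j v ∈ L 3

namespace IsNegligible

variable {h : IsPsiSystem e τ x} {L : ℕ → Submodule k A}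

lemma wordProd_mul_mem (hL : IsNegligible h L) (l : List (Fin (n - 1))) (v : Fin n → I) {r : ℕ}
    {a : A} (ha : a ∈ L r) : wordProd e τ l v * a ∈ L (r + l.length) := by
  induction l generalizing v r a with
  | nil => exact hL.e_mul v ha
  | cons i l ih =>
    rw [wordProd, mul_assoc, List.length_cons, show r + (l.length + 1) = r + 1 + l.length by omega]
    exact ih _ (hL.τ_mul i v ha)

/-- A single move changes two or three consecutive factors by an error in `L 2` or `L 3`, and each
remaining factor `τ` raises the index by one, so that the index ends up equal to the length. -/
lemma wordProd_sub_mem (hL : IsNegligible h L) {l l' : List (Fin (n - 1))} (hl : BraidEq l l')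
    (v : Fin n → I) : wordProd e τ l v - wordProd e τ l' v ∈ L l.length := by
  induction hl generalizing v with
  | refl l => rw [sub_self]; exact Submodule.zero_mem _
  | symm hl ih =>
    rw [← neg_sub, ← hl.length_eq]
    exact Submodule.neg_mem _ (ih v)
  | trans hl _ ih ih' =>
    rw [← sub_add_sub_cancel]
    exact Submodule.add_mem _ (ih v) (hl.length_eq ▸ ih' v)
  | cons i _ ih =>
    rw [wordProd, wordProd, ← sub_mul]
    exact hL.mul_τ i v (ih _)
  | @far i j hij l =>
    simp only [wordProd, mul_assoc]
    rw [sAct_comm hij, ← mul_sub, ← neg_sub, mul_neg]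
    refine Submodule.neg_mem _ ?_
    have := hL.wordProd_mul_mem l (sAct j (sAct i v)) (hL.far i j v hij)
    rw [show (i :: j :: l).length = 2 + l.length by simp only [List.length_cons]; omega]
    exact this
  | @braid i j hij l =>
    simp only [wordProd]
    simp only [mul_assoc]
    rw [sAct_braid hij, ← mul_sub]
    have := hL.wordProd_mul_mem l (sAct j (sAct i (sAct j v))) (hL.braid i j v hij)
    simp only [mul_assoc] at this
    rw [show (i :: j :: i :: l).length = 3 + l.length by simp only [List.length_cons]; omega]
    exact this

/-- In a shortest non-reduced tail `i :: l`, the exchange property replaces `l` by a word beginning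
with `i`. The product then acquires a negligible factor of the form `τ_i τ_i`. -/
lemma wordProd_mem (hL : IsNegligible h L) {l : List (Fin (n - 1))} (hl : ¬IsReduced l)
    (v : Fin n → I) : wordProd e τ l v ∈ L l.length := by
  induction l generalizing v with
  | nil => exact absurd (by rw [IsReduced, wordPerm_nil, inv_one]; rfl) hl
  | cons i l ih =>
    rw [wordProd, List.length_cons]
    by_cases hl' : IsReduced l
    · obtain ⟨l', hb⟩ := hl'.exists_braidEq_cons hl
      rw [← sub_add_cancel (wordProd e τ l (sAct i v)) (wordProd e τ (i :: l') (sAct i v)), add_mul]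
      refine Submodule.add_mem _ (hL.mul_τ _ _ (hL.wordProd_sub_mem hb _)) ?_
      rw [wordProd, mul_assoc, hb.length_eq, List.length_cons,
        show l'.length + 1 + 1 = 2 + l'.length by omega]
      exact hL.wordProd_mul_mem _ _ (hL.sq i v)
    · exact hL.mul_τ _ _ (ih hl' _)

/-- Modulo negligible elements a non-reduced word vanishes and a reduced one depends only on its
permutation, so the representatives in `J` suffice by induction on the length. -/
theorem wordFil_le (hL : IsNegligible h L) {J : Set (List (Fin (n - 1)))}
    (hJ : IsReducedRepresentatives J) (r : ℕ) :
    h.wordFil k r ≤ Submodule.span k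
      {y | ∃ l ∈ J, ∃ a v, l.length ≤ r ∧ y = wordMonomial e τ x l a v} := by
  induction r using Nat.strong_induction_on with
  | _ r ih =>
  -- Negligible elements of index `s + 1` are combinations of words of length at most `s`, to which
  -- the induction hypothesis applies; `L 0 = ⊥` starts the induction.
  have hlow : ∀ s ≤ r, L s ≤ Submodule.span k
      {y | ∃ l ∈ J, ∃ a v, l.length ≤ r ∧ y = wordMonomial e τ x l a v} := by
    intro s hs
    obtain _ | s := s
    · rw [hL.zero]; exact bot_le
    · refine (hL.succ_le s).trans ((ih s hs).trans (Submodule.span_mono ?_))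
      rintro _ ⟨l, hl, a, v, hlr, rfl⟩
      exact ⟨l, hl, a, v, by omega, rfl⟩
  refine Submodule.span_le.2 ?_
  rintro _ ⟨l, v, p, hl, rfl⟩
  by_cases hred : IsReduced l
  · obtain ⟨l', hl', hw⟩ := hJ.1.surjOn (Set.mem_univ (wordPerm l))
    have hb := hred.braidEq (hJ.isReduced hl') hw.symm
    rw [← sub_add_cancel (wordProd e τ l v) (wordProd e τ l' v), add_mul]
    refine Submodule.add_mem _
      (hlow _ hl (hL.mul_polyMap p (hL.wordProd_sub_mem hb v))) ?_
    rw [p.as_sum, map_sum, Finset.mul_sum]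
    refine Submodule.sum_mem _ fun m _ => ?_
    have h1 : monomial m (p.coeff m) = p.coeff m • monomial m (1 : k) := by
      rw [smul_monomial, smul_eq_mul, mul_one]
    rw [h1, map_smul, mul_smul_comm]
    refine Submodule.smul_mem _ _ (Submodule.subset_span ⟨l', hl', m, v, ?_, ?_⟩)
    · rw [← hb.length_eq]; exact hl
    · rw [h.wordMonomial_eq (k := k)]
      rw [show Finsupp.equivFunOnFinite.symm ⇑m = m from
        Finsupp.equivFunOnFinite.symm_apply_apply m]
  · exact hlow _ hl (hL.mul_polyMap p (hL.wordProd_mem hred v))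

end IsNegligible

end Straightening

/-! ### The generators of the quiver Hecke algebra and of the nil-wreath algebra -/

section Generators

open MvPolynomial

variable {k : Type*} [CommRing k] {I : Type*} {n : ℕ} [Fintype I]

/-- The morphism from the free algebra to the algebra of the quiver `Ψ_{I,n}` with relations. -/
abbrev quot (R : Free k I n → Free k I n → Prop) :
    Free k I n →ₐ[k] PathAlgebra k (Arrow.src (I := I) (n := n)) Arrow.tgt R :=
  RingQuot.mkAlgHom k (PathRel k Arrow.src Arrow.tgt R)

lemma quot_rel {R : Free k I n → Free k I n → Prop} {a b : Free k I n}
    (h : PathRel k (Arrow.src (I := I) (n := n)) Arrow.tgt R a b) : quot R a = quot R b :=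
  RingQuot.mkAlgHom_rel k h

lemma isPsiSystem_pathAlgebra (R : Free k I n → Free k I n → Prop)
    (hxx : ∀ a b v, R (fX k a v * fX k b v) (fX k b v * fX k a v)) :
    IsPsiSystem (fun v => quot R (fE k v)) (fun i v => quot R (fT k i v))
      (fun a v => quot R (fX k a v)) where
  e_mul_self v := by rw [← map_mul]; exact quot_rel (.idem v)
  e_mul_of_ne h := by rw [← map_mul, ← map_zero (quot R)]; exact quot_rel (.orthogonal _ _ h)
  sum_e := by rw [← map_sum, ← map_one (quot R)]; exact quot_rel .unit
  e_mul_τ i v := by rw [← map_mul]; exact quot_rel (.target (Arrow.tau i v))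
  e_mul_τ_of_ne i v w h := by
    rw [← map_mul, ← map_zero (quot R)]; exact quot_rel (.target_ne (Arrow.tau i v) w h)
  τ_mul_e i v := by rw [← map_mul]; exact quot_rel (.source (Arrow.tau i v))
  τ_mul_e_of_ne i v w h := by
    rw [← map_mul, ← map_zero (quot R)]; exact quot_rel (.source_ne (Arrow.tau i v) w h)
  e_mul_x a v := by rw [← map_mul]; exact quot_rel (.target (Arrow.x a v))
  e_mul_x_of_ne a v w h := by
    rw [← map_mul, ← map_zero (quot R)]; exact quot_rel (.target_ne (Arrow.x a v) w h)
  x_mul_e a v := by rw [← map_mul]; exact quot_rel (.source (Arrow.x a v))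
  x_mul_e_of_ne a v w h := by
    rw [← map_mul, ← map_zero (quot R)]; exact quot_rel (.source_ne (Arrow.x a v) w h)
  xx a b v := by rw [← map_mul, ← map_mul]; exact quot_rel (.rel _ _ (hxx a b v))

lemma freeLift_quot (R : Free k I n → Free k I n → Prop) :
    freeLift k (fun v => quot R (fE k v)) (fun i v => quot R (fT k i v))
      (fun a v => quot R (fX k a v)) = quot R := by
  refine FreeAlgebra.hom_ext (funext fun y => ?_)
  rcases y with v | ⟨i, v⟩ | ⟨a, v⟩
  · exact freeLift_fE _ _ _ v
  · exact freeLift_fT _ _ _ i v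
  · exact freeLift_fX _ _ _ a v

lemma ofDegrees_eq_top (R : Free k I n → Free k I n → Prop)
    (a : PathAlgebra k (Arrow.src (I := I) (n := n)) Arrow.tgt R) :
    ∃ r, a ∈ (AlgFiltration.ofDegrees k (gen k (Arrow.src (I := I) (n := n)) Arrow.tgt R)
      genDegree).F r := by
  set G := AlgFiltration.ofDegrees k (gen k (Arrow.src (I := I) (n := n)) Arrow.tgt R) genDegree
  obtain ⟨a, rfl⟩ := RingQuot.mkAlgHom_surjective k _ a
  induction a using FreeAlgebra.induction with
  | grade0 r => exact ⟨0, by rw [AlgHom.commutes]; exact G.algebraMap_mem r⟩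
  | grade1 y => exact ⟨genDegree y, AlgFiltration.gen_mem_ofDegrees _ _ y le_rfl⟩
  | mul a b ha hb =>
    obtain ⟨r, ha⟩ := ha
    obtain ⟨s, hb⟩ := hb
    exact ⟨r + s, by rw [map_mul]; exact G.mul_mem ha hb⟩
  | add a b ha hb =>
    obtain ⟨r, ha⟩ := ha
    obtain ⟨s, hb⟩ := hb
    refine ⟨max r s, ?_⟩
    rw [map_add]
    exact Submodule.add_mem _ (G.mono (le_max_left _ _) ha) (G.mono (le_max_right _ _) hb)

lemma genMap_quot (R : Free k I n → Free k I n → Prop) :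
    genMap (fun v => quot R (fE k v)) (fun i v => quot R (fT k i v))
      (fun a v => quot R (fX k a v)) = gen k (Arrow.src (I := I) (n := n)) Arrow.tgt R := by
  ext y
  rcases y with v | ⟨i, v⟩ | ⟨a, v⟩ <;> rfl

namespace NilWreath

lemma isPsiSystem : IsPsiSystem (e k (I := I) (n := n)) (T k) (x k) :=
  isPsiSystem_pathAlgebra (NilRel k I n) .xx

lemma T_mul_x (i : Fin (n - 1)) (a : Fin n) (v : Fin n → I) :
    T k i v * x k a v - x k (sPerm i a) (sAct i v) * T k i v = 0 := by
  have h : ∀ {a b}, NilRel k I n a b → quot (NilRel k I n) a = quot _ b :=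
    fun hab => quot_rel (.rel _ _ hab)
  rw [sub_eq_zero]
  by_cases h1 : a = lo i
  · subst h1
    rw [sPerm_lo]
    have := h (.tx_lo i v)
    rw [map_mul, map_mul] at this
    exact this
  by_cases h2 : a = hi i
  · subst h2
    rw [sPerm_hi]
    have := h (.tx_hi i v)
    rw [map_mul, map_mul] at this
    exact this
  rw [sPerm_of_ne h1 h2]
  have := h (.tx i a h1 h2 v)
  rw [map_mul, map_mul] at this
  exact this

/-- The nil-Coxeter relations hold exactly here, so no error terms are needed. -/
lemma isNegligible : IsNegligible (isPsiSystem (k := k) (I := I) (n := n)) 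
    (fun _ => (⊥ : Submodule k (NilWreath k I n))) where
  zero := rfl
  succ_le _ := bot_le
  mul_τ i v ha := by rw [Submodule.mem_bot] at *; rw [ha, zero_mul]
  τ_mul i v ha := by rw [Submodule.mem_bot] at *; rw [ha, mul_zero]
  e_mul v ha := by rw [Submodule.mem_bot] at *; rw [ha, mul_zero]
  mul_polyMap p ha := by rw [Submodule.mem_bot] at *; rw [ha, zero_mul]
  sq i v := by
    have := quot_rel (PathRel.rel _ _ (NilRel.sq (k := k) i v))
    rw [map_mul, map_zero] at this
    exact (Submodule.mem_bot _).2 this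
  far i j v h := by
    have := quot_rel (PathRel.rel _ _ (NilRel.far (k := k) i j h v))
    rw [map_mul, map_mul] at this
    exact (Submodule.mem_bot _).2 (sub_eq_zero.2 this)
  braid i j v h := by
    have := quot_rel (PathRel.rel _ _ (NilRel.braid (k := k) i j h v))
    simp only [map_mul] at this
    exact (Submodule.mem_bot _).2 (sub_eq_zero.2 this)

theorem span_eq_top {J : Set (List (Fin (n - 1)))} (hJ : IsReducedRepresentatives J) :
    Submodule.span k {y | ∃ l ∈ J, ∃ a v, y = wordMonomial (e k (I := I)) (T k) (x k) l a v} =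
      ⊤ := by
  refine eq_top_iff.2 fun y _ => ?_
  obtain ⟨r, hr⟩ := ofDegrees_eq_top _ y
  rw [← genMap_quot] at hr
  have hr' := isNegligible.wordFil_le hJ r (isPsiSystem.ofDegrees_le_wordFil
    (fun i a v => ⟨0, by rw [zero_smul]; exact T_mul_x i a v⟩) r hr)
  refine Submodule.span_mono ?_ hr'
  rintro _ ⟨l, hl, a, v, -, rfl⟩
  exact ⟨l, hl, a, v, rfl⟩

end NilWreath

namespace Hn

variable (Q : I → I → MvPolynomial (Fin 2) k)

lemma isPsiSystem : IsPsiSystem (e Q (n := n)) (τ Q) (x Q) :=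
  isPsiSystem_pathAlgebra (HeckeRel Q n) .xx

lemma freeLift_eq : freeLift k (e Q (n := n)) (τ Q) (x Q) = quot (HeckeRel Q n) :=
  freeLift_quot _

lemma quot_polyAt (v : Fin n → I) (p : MvPolynomial (Fin n) k) :
    quot (HeckeRel Q n) (polyAt v p) = e Q v * (isPsiSystem Q).polyMap k p := by
  rw [← freeLift_eq, (isPsiSystem Q).freeLift_polyAt]

lemma τ_mul_x [DecidableEq I] (i : Fin (n - 1)) (a : Fin n) (v : Fin n → I) :
    ∃ c : k, τ Q i v * x Q a v - x Q (sPerm i a) (sAct i v) * τ Q i v = c • e Q v := by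
  have h : ∀ {a b}, HeckeRel Q n a b → quot (HeckeRel Q n) a = quot _ b :=
    fun hab => quot_rel (.rel _ _ hab)
  by_cases hv : v (lo i) = v (hi i)
  · by_cases h1 : a = lo i
    · subst h1
      refine ⟨-1, ?_⟩
      have := h (.tx_lo i v hv)
      rw [map_sub, map_mul, map_mul, map_neg] at this
      exact this.trans (neg_one_smul k (e Q v)).symm
    by_cases h2 : a = hi i
    · subst h2
      refine ⟨1, ?_⟩
      have := h (.tx_hi i v hv)
      rw [map_sub, map_mul, map_mul] at this
      exact this.trans (one_smul k (e Q v)).symm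
    · refine ⟨0, ?_⟩
      have := h (.tx i a v (by tauto))
      rw [map_sub, map_mul, map_mul, map_zero] at this
      exact this.trans (zero_smul k (e Q v)).symm
  · refine ⟨0, ?_⟩
    have := h (.tx i a v (by tauto))
    rw [map_sub, map_mul, map_mul, map_zero] at this
    exact this.trans (zero_smul k (e Q v)).symm

lemma filtration_eq : filtration Q n =
    AlgFiltration.ofDegrees k (genMap (e Q (n := n)) (τ Q) (x Q)) genDegree := by
  rw [filtration]
  congr 1
  exact (genMap_quot (HeckeRel Q n)).symm

lemma mul_mem_zero {a b : Hn Q n} (ha : a ∈ (filtration Q n).F 0)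
    (hb : b ∈ (filtration Q n).F 0) : a * b ∈ (filtration Q n).F 0 := by
  have := (filtration Q n).mul_mem ha hb
  rwa [add_zero] at this

lemma e_mem (v : Fin n → I) : e Q v ∈ (filtration Q n).F 0 :=
  AlgFiltration.gen_mem_ofDegrees _ _ _ le_rfl

lemma x_mem (a : Fin n) (v : Fin n → I) : x Q a v ∈ (filtration Q n).F 0 :=
  AlgFiltration.gen_mem_ofDegrees _ _ _ le_rfl

lemma τ_mem (i : Fin (n - 1)) (v : Fin n → I) : τ Q i v ∈ (filtration Q n).F 1 :=
  AlgFiltration.gen_mem_ofDegrees _ _ _ le_rfl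

lemma polyMap_mem (p : MvPolynomial (Fin n) k) :
    (isPsiSystem Q).polyMap k p ∈ (filtration Q n).F 0 := by
  induction p using MvPolynomial.induction_on with
  | C r => rw [← MvPolynomial.algebraMap_eq, AlgHom.commutes]; exact AlgFiltration.algebraMap_mem _ _
  | add p q hp hq => rw [map_add]; exact Submodule.add_mem _ hp hq
  | mul_X p a hp =>
    rw [map_mul, IsPsiSystem.polyMap_X]
    exact mul_mem_zero Q hp (Submodule.sum_mem _ fun v _ => x_mem Q a v)

lemma e_mul_polyMap_mem (v : Fin n → I) (p : MvPolynomial (Fin n) k) :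
    e Q v * (isPsiSystem Q).polyMap k p ∈ (filtration Q n).F 0 :=
  mul_mem_zero Q (e_mem Q v) (polyMap_mem Q p)

/-- The right-hand sides of the quadratic and braid relations are polynomials in the loops. They
have filtration degree `0`, below the degrees `2` and `3` of the left-hand sides. -/
lemma isNegligible : IsNegligible (isPsiSystem Q (n := n)) (filtration Q n).prev where
  zero := rfl
  succ_le r := by
    classical
    have := (isPsiSystem Q (n := n)).ofDegrees_le_wordFil (τ_mul_x Q) r
    rwa [← filtration_eq] at this
  mul_τ i v ha := (filtration Q n).mul_mem_prev_left ha (τ_mem Q i v)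
  τ_mul {r a} i v ha := by
    rw [add_comm]
    exact (filtration Q n).mul_mem_prev_right (τ_mem Q i v) ha
  e_mul {r a} v ha := by
    have := (filtration Q n).mul_mem_prev_right (e_mem Q v) ha
    rwa [zero_add] at this
  mul_polyMap p ha := (filtration Q n).mul_mem_prev_left ha (polyMap_mem Q p)
  sq i v := by
    have := quot_rel (PathRel.rel _ _ (HeckeRel.sq (Q := Q) i v))
    rw [map_mul, quot_polyAt] at this
    change τ Q i (sAct i v) * τ Q i v = _ at this
    rw [this]
    exact (filtration Q n).mono zero_le_one (e_mul_polyMap_mem Q v _)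
  far i j v h := by
    have := quot_rel (PathRel.rel _ _ (HeckeRel.far (Q := Q) i j h v))
    rw [map_mul, map_mul, ← sub_eq_zero] at this
    change τ Q i (sAct j v) * τ Q j v - τ Q j (sAct i v) * τ Q i v = _ at this
    rw [this]
    exact Submodule.zero_mem _
  braid i j v h := by
    -- The Hecke braid relation puts the word with two letters `j` first, opposite to the
    -- nil-Coxeter convention.
    rw [← neg_sub]
    refine Submodule.neg_mem _ ?_
    by_cases hv : v (lo i) ≠ v (hi j) ∨ (v (lo i) = v (hi i) ∧ v (hi i) = v (hi j))
    · have := quot_rel (PathRel.rel _ _ (HeckeRel.braid (Q := Q) i j h v hv))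
      simp only [map_mul] at this
      rw [← sub_eq_zero] at this
      change τ Q j (sAct i (sAct j v)) * τ Q i (sAct j v) * τ Q j v -
        τ Q i (sAct j (sAct i v)) * τ Q j (sAct i v) * τ Q i v = _ at this
      rw [this]
      exact Submodule.zero_mem _
    · push Not at hv
      have := quot_rel (PathRel.rel _ _ (HeckeRel.braid_ne (Q := Q) i j h v hv.1
        fun h' => hv.2 h' (h'.symm.trans hv.1)))
      rw [quot_polyAt] at this
      simp only [map_mul, map_sub] at this
      change τ Q j (sAct i (sAct j v)) * τ Q i (sAct j v) * τ Q j v -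
        τ Q i (sAct j (sAct i v)) * τ Q j (sAct i v) * τ Q i v = _ at this
      rw [this]
      exact (filtration Q n).mono (Nat.zero_le 2) (e_mul_polyMap_mem Q v _)

lemma basisElt_eq (l : List (Fin (n - 1))) (a : Fin n → ℕ) (v : Fin n → I) :
    basisElt Q l a v = wordMonomial (e Q) (τ Q) (x Q) l a v := by
  have : ∀ (l : List (Fin (n - 1))) v, tauWord Q l v = wordProd (e Q) (τ Q) l v := by
    intro l
    induction l with
    | nil => intro v; rfl
    | cons i l ih => intro v; rw [tauWord, wordProd, ih]
  rw [basisElt, wordMonomial, this]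

theorem filtration_le {J : Set (List (Fin (n - 1)))} (hJ : IsReducedRepresentatives J) (r : ℕ) :
    (filtration Q n).F r ≤
      Submodule.span k {y | ∃ l ∈ J, ∃ a v, l.length ≤ r ∧ y = basisElt Q l a v} := by
  simp only [basisElt_eq]
  exact ((isNegligible Q).succ_le r).trans ((isNegligible Q).wordFil_le hJ r)

theorem span_eq_top {J : Set (List (Fin (n - 1)))} (hJ : IsReducedRepresentatives J) :
    Submodule.span k {y | ∃ l ∈ J, ∃ a v, y = basisElt Q l a v} = ⊤ := by
  refine eq_top_iff.2 fun y _ => ?_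
  obtain ⟨r, hr⟩ := ofDegrees_eq_top _ y
  refine Submodule.span_mono ?_ (filtration_le Q hJ r hr)
  rintro _ ⟨l, hl, a, v, -, rfl⟩
  exact ⟨l, hl, a, v, rfl⟩

end Hn

end Generators

/-! ### Divided differences -/

section DividedDifferences

open MvPolynomial

variable {k : Type*} [CommRing k] {n : ℕ}

lemma rename_eval₂At (σ : Fin n → Fin n) (p : MvPolynomial (Fin 2) k) (a b : Fin n) :
    rename σ (eval₂At p a b) = eval₂At p (σ a) (σ b) := by
  unfold eval₂At
  induction p using MvPolynomial.induction_on with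
  | C r => simp
  | add p q hp hq => simp only [map_add, hp, hq]
  | mul_X p i hp =>
    rw [map_mul, map_mul, map_mul, hp]
    fin_cases i <;> simp

lemma eval₂At_mul (p q : MvPolynomial (Fin 2) k) (a b : Fin n) :
    eval₂At (p * q) a b = eval₂At p a b * eval₂At q a b := map_mul _ _ _

lemma eval₂At_flipVars (p : MvPolynomial (Fin 2) k) (a b : Fin n) :
    eval₂At (flipVars p) a b = eval₂At p b a := by
  unfold eval₂At flipVars
  induction p using MvPolynomial.induction_on with
  | C r => simp
  | add p q hp hq => simp only [map_add, hp, hq]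
  | mul_X p i hp =>
    rw [map_mul, map_mul, map_mul, hp]
    fin_cases i <;> simp

lemma rename_sPerm_sPerm (i : Fin (n - 1)) (f : MvPolynomial (Fin n) k) :
    rename (sPerm i) (rename (sPerm i) f) = f := by
  rw [rename_rename]
  convert rename_id_apply f
  ext1 a
  exact sPerm_sPerm i a

lemma rename_sPerm_comm {i j : Fin (n - 1)} (h : (i : ℕ) + 1 < j ∨ (j : ℕ) + 1 < i)
    (f : MvPolynomial (Fin n) k) :
    rename (sPerm i) (rename (sPerm j) f) = rename (sPerm j) (rename (sPerm i) f) := by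
  rw [rename_rename, rename_rename, ← Equiv.Perm.coe_mul, ← Equiv.Perm.coe_mul, sPerm_comm h]

lemma rename_sPerm_braid {i j : Fin (n - 1)} (h : (j : ℕ) = i + 1) (f : MvPolynomial (Fin n) k) :
    rename (sPerm i) (rename (sPerm j) (rename (sPerm i) f)) =
      rename (sPerm j) (rename (sPerm i) (rename (sPerm j) f)) := by
  simp only [rename_rename]
  rw [← Equiv.Perm.coe_mul, ← Equiv.Perm.coe_mul, ← Equiv.Perm.coe_mul, ← Equiv.Perm.coe_mul,
    ← mul_assoc, ← mul_assoc, sPerm_braid h]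

lemma X_sub_X_mul_divDiff (i : Fin (n - 1)) (f : MvPolynomial (Fin n) k) :
    (X (lo i) - X (hi i)) * divDiff k i f = rename (sPerm i) f - f := divDiff_spec i f

/-- Such a `σ` conjugates `s_i` into `s_j` and carries the denominator for `i` to that for `j`. As
for the other identities on divided differences, the denominator is cleared and then cancelled by
`X_sub_X_cancel`, over any `k`. -/
lemma rename_divDiff {σ : Equiv.Perm (Fin n)} {i j : Fin (n - 1)} (h : σ (lo i) = lo j)
    (h' : σ (hi i) = hi j) (f : MvPolynomial (Fin n) k) :
    rename σ (divDiff k i f) = divDiff k j (rename σ f) := by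
  apply X_sub_X_cancel (lo_ne_hi j)
  have h1 := congrArg (rename σ) (X_sub_X_mul_divDiff i f)
  rw [map_mul, map_sub, map_sub, rename_X, rename_X, h, h'] at h1
  have h2 : σ * sPerm i = sPerm j * σ := by
    have := Equiv.mul_swap_eq_swap_mul σ (lo i) (hi i)
    rwa [h, h'] at this
  rw [X_sub_X_mul_divDiff, h1, rename_rename, rename_rename, ← Equiv.Perm.coe_mul, h2,
    Equiv.Perm.coe_mul]

lemma divDiff_mul_of_symm {i : Fin (n - 1)} {p : MvPolynomial (Fin n) k}
    (hp : rename (sPerm i) p = p) (f : MvPolynomial (Fin n) k) :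
    divDiff k i (p * f) = p * divDiff k i f := by
  apply X_sub_X_cancel (lo_ne_hi i)
  rw [X_sub_X_mul_divDiff, map_mul, hp, mul_left_comm, X_sub_X_mul_divDiff, mul_sub]

lemma rename_sPerm_divDiff (i : Fin (n - 1)) (f : MvPolynomial (Fin n) k) :
    rename (sPerm i) (divDiff k i f) = divDiff k i f := by
  apply X_sub_X_cancel (lo_ne_hi i)
  have h1 := congrArg (rename (sPerm i)) (X_sub_X_mul_divDiff i f)
  rw [map_mul, map_sub, map_sub, rename_X, rename_X, sPerm_lo, sPerm_hi, rename_sPerm_sPerm] at h1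
  have h2 := X_sub_X_mul_divDiff i f
  linear_combination -h1 - h2

/-- A divided difference is already `s_i`-invariant, so the next numerator vanishes. -/
lemma divDiff_divDiff (i : Fin (n - 1)) (f : MvPolynomial (Fin n) k) :
    divDiff k i (divDiff k i f) = 0 := by
  apply X_sub_X_cancel (lo_ne_hi i)
  rw [X_sub_X_mul_divDiff, rename_sPerm_divDiff, sub_self, mul_zero]

lemma divDiff_comm {i j : Fin (n - 1)} (h : (i : ℕ) + 1 < j ∨ (j : ℕ) + 1 < i)
    (f : MvPolynomial (Fin n) k) :
    divDiff k i (divDiff k j f) = divDiff k j (divDiff k i f) := by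
  apply X_sub_X_cancel (lo_ne_hi i)
  rw [← divDiff_mul_of_symm (i := j), X_sub_X_mul_divDiff, X_sub_X_mul_divDiff, map_sub,
    rename_divDiff (sPerm_lo_of_far (Or.symm h)) (sPerm_hi_of_far (Or.symm h))]
  rw [map_sub, rename_X, rename_X, sPerm_lo_of_far h, sPerm_hi_of_far h]

/-- Multiplied by the three differences of the variables involved, both sides become the same
alternating sum of the six permuted copies of `f`. -/
lemma divDiff_braid {i j : Fin (n - 1)} (h : (j : ℕ) = i + 1) (f : MvPolynomial (Fin n) k) :
    divDiff k i (divDiff k j (divDiff k i f)) = divDiff k j (divDiff k i (divDiff k j f)) := by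
  have e1 : ∀ f : MvPolynomial (Fin n) k, (X (lo i) - X (hi i)) * divDiff k i f =
    rename (sPerm i) f - f := X_sub_X_mul_divDiff i
  have e2 : ∀ f : MvPolynomial (Fin n) k, (X (hi i) - X (hi j)) * divDiff k j f =
    rename (sPerm j) f - f := by rw [← lo_of_succ h]; exact X_sub_X_mul_divDiff j
  have e3 : ∀ f : MvPolynomial (Fin n) k, (X (lo i) - X (hi j)) * rename (sPerm j) (divDiff k i f) =
    rename (sPerm j) (rename (sPerm i) f) - rename (sPerm j) f := fun f => by
      simpa [sPerm_lo_lower h, sPerm_hi_lower h] using congrArg (rename (sPerm j)) (e1 f)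
  have e4 : ∀ f : MvPolynomial (Fin n) k, (X (lo i) - X (hi j)) * rename (sPerm i) (divDiff k j f) =
    rename (sPerm i) (rename (sPerm j) f) - rename (sPerm i) f := fun f => by
      simpa [sPerm_hi, sPerm_hi_upper h] using congrArg (rename (sPerm i)) (e2 f)
  have e5 : ∀ f : MvPolynomial (Fin n) k, (X (hi i) - X (hi j)) *
      rename (sPerm i) (rename (sPerm j) (divDiff k i f)) =
    rename (sPerm i) (rename (sPerm j) (rename (sPerm i) f))
      - rename (sPerm i) (rename (sPerm j) f) := fun f => by
      simpa [sPerm_lo, sPerm_hi_upper h] using congrArg (rename (sPerm i)) (e3 f)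
  have e6 : ∀ f : MvPolynomial (Fin n) k, (X (lo i) - X (hi i)) *
      rename (sPerm j) (rename (sPerm i) (divDiff k j f)) =
    rename (sPerm j) (rename (sPerm i) (rename (sPerm j) f))
      - rename (sPerm j) (rename (sPerm i) f) := fun f => by
      simpa [sPerm_lo_lower h, sPerm_hi, lo_of_succ h] using congrArg (rename (sPerm j)) (e4 f)
  apply X_sub_X_cancel (lo_ne_hi i)
  apply X_sub_X_cancel (lo_ne_hi_of_succ h)
  apply X_sub_X_cancel (hi_ne_hi_of_succ h)
  have a1 := e1 (divDiff k j (divDiff k i f))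
  have a2 := e2 (divDiff k i f)
  have a3 := e4 (divDiff k i f)
  rw [rename_sPerm_divDiff] at a3
  have a4 := e1 f
  have a5 := e3 f
  have a6 := e5 f
  have b1 := e2 (divDiff k i (divDiff k j f))
  have b2 := e1 (divDiff k j f)
  have b3 := e3 (divDiff k j f)
  rw [rename_sPerm_divDiff] at b3
  have b4 := e2 f
  have b5 := e4 f
  have b6 := e6 f
  have c := rename_sPerm_braid h f
  linear_combination (X (hi i) - X (hi j)) * (X (lo i) - X (hi j)) * a1
    + (X (hi i) - X (hi j)) * a3 - (X (lo i) - X (hi j)) * a2 - a5 + a4 + a6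
    - (X (lo i) - X (hi i)) * (X (lo i) - X (hi j)) * b1
    - (X (lo i) - X (hi i)) * b3 + (X (lo i) - X (hi j)) * b2 + b5 - b4 - b6 + c

end DividedDifferences

/-! ### The polynomial representation -/

section Representation

open MvPolynomial

variable {k : Type*} [CommRing k] {I : Type*} [DecidableEq I] {n : ℕ}

lemma arrowOp_apply (v w : Fin n → I) (φ : MvPolynomial (Fin n) k →ₗ[k] MvPolynomial (Fin n) k)
    (f : PolyRep k I n) (u : Fin n → I) :
    arrowOp v w φ f u = if u = w then φ (f v) else 0 := by
  simp [arrowOp, Pi.single_apply]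

lemma arrowOp_mul (u v w : Fin n → I)
    (φ ψ : MvPolynomial (Fin n) k →ₗ[k] MvPolynomial (Fin n) k) :
    arrowOp v w φ * arrowOp u v ψ = arrowOp u w (φ ∘ₗ ψ) := by
  refine LinearMap.ext fun f => funext fun t => ?_
  rw [Module.End.mul_apply]
  simp [arrowOp_apply]

lemma arrowOp_mul_of_ne {u v v' w : Fin n → I} (h : v' ≠ v)
    (φ ψ : MvPolynomial (Fin n) k →ₗ[k] MvPolynomial (Fin n) k) :
    arrowOp v w φ * arrowOp u v' ψ = 0 := by
  refine LinearMap.ext fun f => funext fun t => ?_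
  rw [Module.End.mul_apply]
  simp [arrowOp_apply, h.symm]

lemma arrowOp_sub (v w : Fin n → I)
    (φ ψ : MvPolynomial (Fin n) k →ₗ[k] MvPolynomial (Fin n) k) :
    arrowOp v w (φ - ψ) = arrowOp v w φ - arrowOp v w ψ := by
  refine LinearMap.ext fun f => funext fun t => ?_
  simp only [arrowOp_apply, LinearMap.sub_apply, Pi.sub_apply]
  split_ifs <;> simp

lemma arrowOp_add (v w : Fin n → I)
    (φ ψ : MvPolynomial (Fin n) k →ₗ[k] MvPolynomial (Fin n) k) :
    arrowOp v w (φ + ψ) = arrowOp v w φ + arrowOp v w ψ := by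
  refine LinearMap.ext fun f => funext fun t => ?_
  simp only [arrowOp_apply, LinearMap.add_apply, Pi.add_apply]
  split_ifs <;> simp

lemma arrowOp_smul (v w : Fin n → I) (c : k)
    (φ : MvPolynomial (Fin n) k →ₗ[k] MvPolynomial (Fin n) k) :
    arrowOp v w (c • φ) = c • arrowOp v w φ := by
  refine LinearMap.ext fun f => funext fun t => ?_
  simp only [arrowOp_apply, LinearMap.smul_apply, Pi.smul_apply]
  split_ifs <;> simp

lemma arrowOp_zero (v w : Fin n → I) :
    arrowOp v w (0 : MvPolynomial (Fin n) k →ₗ[k] MvPolynomial (Fin n) k) = 0 := by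
  refine LinearMap.ext fun f => funext fun t => ?_
  simp [arrowOp_apply]

/-- The operator by which `1_v` acts in the polynomial representation. -/
def eOp (k : Type*) [CommRing k] (v : Fin n → I) : Module.End k (PolyRep k I n) :=
  arrowOp v v LinearMap.id

/-- The operator by which `x_{a,v}` acts in the polynomial representation. -/
def xOp (k : Type*) [CommRing k] (a : Fin n) (v : Fin n → I) : Module.End k (PolyRep k I n) :=
  arrowOp v v (LinearMap.mulLeft k (X a))

/-- The operator by which `τ_{i,v}` acts in the polynomial representation. -/
def tOp (P : I → I → MvPolynomial (Fin 2) k) (i : Fin (n - 1)) (v : Fin n → I) :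
    Module.End k (PolyRep k I n) :=
  arrowOp v (sAct i v) (tauOp P i v)

variable (P : I → I → MvPolynomial (Fin 2) k)

lemma isPsiSystem_polyRep [Fintype I] : IsPsiSystem (eOp k (I := I) (n := n)) (tOp P) (xOp k) where
  e_mul_self v := arrowOp_mul _ _ _ _ _
  e_mul_of_ne h := arrowOp_mul_of_ne h.symm _ _
  sum_e := by
    refine LinearMap.ext fun f => funext fun t => ?_
    rw [LinearMap.sum_apply, Finset.sum_apply]
    simp [eOp, arrowOp_apply]
  e_mul_τ i v := arrowOp_mul _ _ _ _ _
  e_mul_τ_of_ne i v w h := arrowOp_mul_of_ne h _ _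
  τ_mul_e i v := arrowOp_mul _ _ _ _ _
  τ_mul_e_of_ne i v w h := arrowOp_mul_of_ne h.symm _ _
  e_mul_x a v := arrowOp_mul _ _ _ _ _
  e_mul_x_of_ne a v w h := arrowOp_mul_of_ne h _ _
  x_mul_e a v := arrowOp_mul _ _ _ _ _
  x_mul_e_of_ne a v w h := arrowOp_mul_of_ne h.symm _ _
  xx a b v := by
    rw [xOp, xOp, arrowOp_mul, arrowOp_mul]
    congr 1
    refine LinearMap.ext fun f => ?_
    simp [mul_left_comm]

lemma eOp_mul_polyMap [Fintype I] (v : Fin n → I) (p : MvPolynomial (Fin n) k) :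
    eOp k v * (isPsiSystem_polyRep P).polyMap k p = arrowOp v v (LinearMap.mulLeft k p) := by
  induction p using MvPolynomial.induction_on with
  | C r =>
    rw [← MvPolynomial.algebraMap_eq, AlgHom.commutes, Algebra.algebraMap_eq_smul_one,
      Algebra.algebraMap_eq_smul_one, mul_smul_comm, mul_one, eOp, ← arrowOp_smul]
    congr 1
    refine LinearMap.ext fun f => ?_
    simp
  | add p q hp hq =>
    rw [map_add, mul_add, hp, hq, ← arrowOp_add]
    congr 1
    refine LinearMap.ext fun f => ?_
    simp [add_mul]
  | mul_X p a hp =>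
    have h := isPsiSystem_polyRep P (n := n)
    rw [map_mul, IsPsiSystem.polyMap_X, ← mul_assoc, IsPsiSystem.e_mul_polyMap, mul_assoc,
      h.e_mul_loopSum, ← h.e_mul_x, ← mul_assoc, ← IsPsiSystem.e_mul_polyMap, hp, xOp,
      arrowOp_mul]
    congr 1
    refine LinearMap.ext fun f => ?_
    simp

lemma sAct_apply {I : Type*} (i : Fin (n - 1)) (v : Fin n → I) (a : Fin n) :
    sAct i v a = v (sPerm i a) := rfl

lemma sAct_eq_self_iff {I : Type*} {i : Fin (n - 1)} {v : Fin n → I} :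
    sAct i v = v ↔ v (lo i) = v (hi i) := by
  constructor
  · intro h
    conv_lhs => rw [← h]
    rw [sAct_apply, sPerm_lo]
  · intro h
    ext1 a
    rw [sAct_apply]
    by_cases h1 : a = lo i
    · rw [h1, sPerm_lo, h]
    by_cases h2 : a = hi i
    · rw [h2, sPerm_hi, h]
    rw [sPerm_of_ne h1 h2]

/-! ### The Hecke relations for the operators `tauOp`. -/

lemma tauOp_of_eq {i : Fin (n - 1)} {v : Fin n → I} (h : v (lo i) = v (hi i)) :
    tauOp P i v = divDiff k i := if_pos (sAct_eq_self_iff.2 h)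

lemma tauOp_of_ne {i : Fin (n - 1)} {v : Fin n → I} (h : v (lo i) ≠ v (hi i))
    (f : MvPolynomial (Fin n) k) :
    tauOp P i v f = eval₂At (P (v (lo i)) (v (hi i))) (hi i) (lo i) * rename (sPerm i) f := by
  rw [tauOp, if_neg (mt sAct_eq_self_iff.1 h)]
  rfl

/-- For equal neighbours both sides vanish, because `divDiff` squares to zero and `P i i = 0`. For
distinct ones the second operator permutes the variables in the first factor `P`, and the two
factors multiply to `Q`. -/
lemma tauOp_sq (hP : ∀ i, P i i = 0) (i : Fin (n - 1)) (v : Fin n → I)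
    (f : MvPolynomial (Fin n) k) :
    tauOp P i (sAct i v) (tauOp P i v f) =
      eval₂At (P (v (lo i)) (v (hi i)) * flipVars (P (v (hi i)) (v (lo i)))) (lo i) (hi i) * f := by
  by_cases h : v (lo i) = v (hi i)
  · rw [tauOp_of_eq P h, tauOp_of_eq P (by simp [sAct_apply, sPerm_lo, sPerm_hi, h]),
      divDiff_divDiff, h, hP, zero_mul, eval₂At, map_zero, zero_mul]
  · rw [tauOp_of_ne P h, tauOp_of_ne P (by simpa [sAct_apply, sPerm_lo, sPerm_hi] using Ne.symm h),
      map_mul, rename_sPerm_sPerm, rename_eval₂At, eval₂At_mul, eval₂At_flipVars]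
    simp only [sAct_apply, sPerm_lo, sPerm_hi]
    ring

lemma tauOp_far {i j : Fin (n - 1)} (h : (i : ℕ) + 1 < j) (v : Fin n → I)
    (f : MvPolynomial (Fin n) k) :
    tauOp P i (sAct j v) (tauOp P j v f) = tauOp P j (sAct i v) (tauOp P i v f) := by
  have h1 := sPerm_lo_of_far (Or.inl h)
  have h2 := sPerm_hi_of_far (Or.inl h)
  have h3 := sPerm_lo_of_far (Or.inr h)
  have h4 := sPerm_hi_of_far (Or.inr h)
  by_cases hi' : v (lo i) = v (hi i) <;> by_cases hj' : v (lo j) = v (hi j)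
  · rw [tauOp_of_eq P hi', tauOp_of_eq P hj', tauOp_of_eq, tauOp_of_eq,
      divDiff_comm (Or.inl h)]
    all_goals simpa only [sAct_apply, h1, h2, h3, h4]
  · rw [tauOp_of_eq P hi', tauOp_of_ne P hj', tauOp_of_eq, tauOp_of_ne, divDiff_mul_of_symm,
      rename_divDiff h1 h2]
    all_goals simp only [sAct_apply, rename_eval₂At, h1, h2, h3, h4]
    all_goals assumption
  · rw [tauOp_of_ne P hi', tauOp_of_eq P hj', tauOp_of_ne, tauOp_of_eq, divDiff_mul_of_symm,
      rename_divDiff h3 h4]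
    all_goals simp only [sAct_apply, rename_eval₂At, h1, h2, h3, h4]
    all_goals assumption
  · rw [tauOp_of_ne P hi', tauOp_of_ne P hj', tauOp_of_ne, tauOp_of_ne, map_mul, map_mul,
      rename_sPerm_comm (Or.inl h)]
    all_goals simp only [sAct_apply, rename_eval₂At, h1, h2, h3, h4]
    · ring
    all_goals assumption

/-- With three equal colours this is the braid relation for divided differences. With exactly one
equal neighbouring pair, the single divided difference on each side is carried across the two
transpositions by `rename_divDiff`, and the product of the two factors `P` is symmetric in its
variables, hence passes through it. With three distinct colours the three factors `P` on each side
agree. -/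
lemma tauOp_braid {i j : Fin (n - 1)} (h : (j : ℕ) = i + 1) (v : Fin n → I)
    (hv : v (lo i) ≠ v (hi j) ∨ (v (lo i) = v (hi i) ∧ v (hi i) = v (hi j)))
    (f : MvPolynomial (Fin n) k) :
    tauOp P j (sAct i (sAct j v)) (tauOp P i (sAct j v) (tauOp P j v f)) =
      tauOp P i (sAct j (sAct i v)) (tauOp P j (sAct i v) (tauOp P i v f)) := by
  have h0 := lo_of_succ h
  have h1 := sPerm_lo_lower h
  have h2 := sPerm_hi_lower h
  have h3 := sPerm_hi_upper h
  have h4 : sPerm j (hi j) = hi i := by rw [sPerm_hi, h0]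
  by_cases hab : v (lo i) = v (hi i) <;> by_cases hbc : v (hi i) = v (hi j)
  · rw [tauOp_of_eq, tauOp_of_eq, tauOp_of_eq, tauOp_of_eq, tauOp_of_eq, tauOp_of_eq,
      divDiff_braid h]
    all_goals simp only [sAct_apply, h0, h1, h2, h3, h4, sPerm_lo, sPerm_hi, hab, hbc]
  · have hac : v (lo i) ≠ v (hi j) := fun h => hbc (hab.symm.trans h)
    rw [tauOp_of_ne P (i := j) (v := v) (by rwa [h0]), tauOp_of_ne P (i := i) (v := sAct j v),
      tauOp_of_eq P (i := j), tauOp_of_eq P (i := i) (v := v) hab,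
      tauOp_of_ne P (i := j) (v := sAct i v), tauOp_of_ne P (i := i)]
    · simp only [map_mul, rename_eval₂At, sAct_apply, h0, h1, h2, h3, sPerm_lo, sPerm_hi]
      rw [← mul_assoc, ← mul_assoc, divDiff_mul_of_symm]
      · have := rename_divDiff (σ := sPerm i * sPerm j) (i := i) (j := j)
          (by rw [Equiv.Perm.mul_apply, h1, sPerm_lo, h0])
          (by rw [Equiv.Perm.mul_apply, h2, h3]) f
        rw [Equiv.Perm.coe_mul, ← rename_rename, ← rename_rename] at this
        rw [this, hab]
      · simp only [map_mul, rename_eval₂At, h1, h2, h4]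
        rw [hab]
        ring
    all_goals simpa only [sAct_apply, h0, h1, h2, h3, h4, sPerm_lo, sPerm_hi]
  · have hac : v (lo i) ≠ v (hi j) := fun h => hab (h.trans hbc.symm)
    rw [tauOp_of_eq P (i := j) (v := v) (by rwa [h0]), tauOp_of_ne P (i := i) (v := sAct j v),
      tauOp_of_ne P (i := j), tauOp_of_ne P (i := i) (v := v) hab,
      tauOp_of_ne P (i := j) (v := sAct i v), tauOp_of_eq P (i := i)]
    · simp only [map_mul, rename_eval₂At, sAct_apply, h0, h1, h2, h3, h4, sPerm_hi]
      rw [← mul_assoc, ← mul_assoc, divDiff_mul_of_symm]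
      · have := rename_divDiff (σ := sPerm j * sPerm i) (i := j) (j := i)
          (by rw [Equiv.Perm.mul_apply, h0, sPerm_hi, h1])
          (by rw [Equiv.Perm.mul_apply, h3, h4]) f
        rw [Equiv.Perm.coe_mul, ← rename_rename, ← rename_rename] at this
        rw [this, hbc]
      · simp only [map_mul, rename_eval₂At, h3, sPerm_lo, sPerm_hi]
        rw [hbc]
        ring
    all_goals simpa only [sAct_apply, h0, h1, h2, h3, h4, sPerm_lo, sPerm_hi]
  · have hac : v (lo i) ≠ v (hi j) := hv.resolve_right fun h => hab h.1
    rw [tauOp_of_ne P (i := j) (v := v) (by rwa [h0]), tauOp_of_ne P (i := i) (v := sAct j v),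
      tauOp_of_ne P (i := j), tauOp_of_ne P (i := i) (v := v) hab,
      tauOp_of_ne P (i := j) (v := sAct i v), tauOp_of_ne P (i := i)]
    · simp only [map_mul, rename_eval₂At, sAct_apply, h0, h1, h2, h3, h4, sPerm_lo, sPerm_hi]
      rw [rename_sPerm_braid h]
      ring
    all_goals simpa only [sAct_apply, h0, h1, h2, h3, h4, sPerm_lo, sPerm_hi]

/-- On each side the middle operator is a divided difference while the outer two are twisted
transpositions. After multiplication by `x_{i+2} - x_i`, each side has a term in the longest
permutation of the three variables and a term in `f`. The former cancel, and the latter give the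
difference of two values of `Q`. -/
lemma tauOp_braid_ne {i j : Fin (n - 1)} (h : (j : ℕ) = i + 1) (v : Fin n → I)
    (hv : v (lo i) = v (hi j)) (hv' : v (lo i) ≠ v (hi i)) (f : MvPolynomial (Fin n) k) :
    tauOp P j (sAct i (sAct j v)) (tauOp P i (sAct j v) (tauOp P j v f)) -
      tauOp P i (sAct j (sAct i v)) (tauOp P j (sAct i v) (tauOp P i v f)) =
    diffQuot (P (v (lo i)) (v (hi i)) * flipVars (P (v (hi i)) (v (lo i)))) (lo i) (hi i) (hi j)
      * f := by
  have h0 := lo_of_succ h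
  have h1 := sPerm_lo_lower h
  have h2 := sPerm_hi_lower h
  have h3 := sPerm_hi_upper h
  have h4 : sPerm j (hi j) = hi i := by rw [sPerm_hi, h0]
  have hbc : v (hi i) ≠ v (hi j) := by rw [← hv]; exact hv'.symm
  apply X_sub_X_cancel (lo_ne_hi_of_succ h).symm
  rw [← mul_assoc, diffQuot_spec, eval₂At_mul, eval₂At_flipVars, eval₂At_mul, eval₂At_flipVars]
  rw [tauOp_of_ne P (i := j) (v := v) (by rwa [h0]), tauOp_of_eq P (i := i) (v := sAct j v),
    tauOp_of_ne P (i := j) (v := sAct i (sAct j v)), tauOp_of_ne P (i := i) (v := v) hv',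
    tauOp_of_eq P (i := j) (v := sAct i v), tauOp_of_ne P (i := i)]
  · simp only [sAct_apply, h0, h1, h2, h3, h4, sPerm_lo, sPerm_hi]
    rw [← hv]
    generalize v (lo i) = a, v (hi i) = b
    have e1 := congrArg (rename (sPerm j)) (X_sub_X_mul_divDiff (k := k) i
      (eval₂At (P b a) (hi j) (hi i) * rename (sPerm j) f))
    have e2 := congrArg (rename (sPerm i)) (X_sub_X_mul_divDiff (k := k) j
      (eval₂At (P a b) (hi i) (lo i) * rename (sPerm i) f))
    rw [map_mul, map_sub, map_sub, rename_X, rename_X] at e1 e2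
    simp only [map_mul, rename_eval₂At, h0, h1, h2, h3, h4, sPerm_lo, sPerm_hi,
      rename_sPerm_sPerm] at e1 e2
    rw [rename_sPerm_braid h] at e2
    linear_combination -(eval₂At (P a b) (hi j) (hi i)) * e1 + eval₂At (P b a) (hi i) (lo i) * e2
  all_goals simp only [sAct_apply, h0, h1, h2, h3, h4, sPerm_lo, sPerm_hi]
  all_goals assumption

lemma tauOp_mul_X (i : Fin (n - 1)) (a : Fin n) (v : Fin n → I) (f : MvPolynomial (Fin n) k) :
    tauOp P i v (X a * f) - X (sPerm i a) * tauOp P i v f =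
      if v (lo i) = v (hi i) then (if a = lo i then -f else if a = hi i then f else 0) else 0 := by
  split_ifs with hv h1 h2
  · rw [tauOp_of_eq P hv, h1, sPerm_lo]
    apply X_sub_X_cancel (lo_ne_hi i)
    have e1 := X_sub_X_mul_divDiff i (X (lo i) * f)
    have e2 := X_sub_X_mul_divDiff i f
    rw [map_mul (rename _), rename_X, sPerm_lo] at e1
    linear_combination e1 - X (hi i) * e2
  · rw [tauOp_of_eq P hv, h2, sPerm_hi]
    apply X_sub_X_cancel (lo_ne_hi i)
    have e1 := X_sub_X_mul_divDiff i (X (hi i) * f)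
    have e2 := X_sub_X_mul_divDiff i f
    rw [map_mul (rename _), rename_X, sPerm_hi] at e1
    linear_combination e1 - X (lo i) * e2
  · rw [tauOp_of_eq P hv, sPerm_of_ne h1 h2, divDiff_mul_of_symm, sub_self]
    rw [rename_X, sPerm_of_ne h1 h2]
  · rw [tauOp_of_ne P hv, tauOp_of_ne P hv, map_mul, rename_X]
    ring

theorem exists_polyRep [Fintype I] (hP : ∀ i, P i i = 0) :
    ∃ ρ : Hn (fun i j => P i j * flipVars (P j i)) n →ₐ[k] Module.End k (PolyRep k I n),
      (∀ v, ρ (Hn.e _ v) = eOp k v) ∧ (∀ a v, ρ (Hn.x _ a v) = xOp k a v) ∧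
      (∀ i v, ρ (Hn.τ _ i v) = tOp P i v) := by
  have h := isPsiSystem_polyRep P (n := n)
  obtain ⟨ρ, hρ⟩ := h.exists_lift
    (R := HeckeRel (fun i j => P i j * flipVars (P j i)) n) (by
      have ext_mul : ∀ {u v w : Fin n → I}
          {φ ψ : MvPolynomial (Fin n) k →ₗ[k] MvPolynomial (Fin n) k},
          (∀ f, φ f = ψ f) → arrowOp u w φ = arrowOp u w ψ :=
        fun hf => by rw [LinearMap.ext hf]
      have hpoly : ∀ (v : Fin n → I) p,
          freeLift k (eOp k (I := I)) (tOp P) (xOp k) (polyAt v p) =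
            arrowOp v v (LinearMap.mulLeft k p) := fun v p => by
        rw [h.freeLift_polyAt, eOp_mul_polyMap]
      intro a b hab
      cases hab with
      | sq i v =>
        rw [hpoly, map_mul, freeLift_fT, freeLift_fT, tOp, tOp, arrowOp_mul, sAct_sAct]
        exact ext_mul (v := v) (tauOp_sq P hP i v)
      | far i j hij v =>
        simp only [map_mul, freeLift_fT]
        rw [tOp, tOp, tOp, tOp, arrowOp_mul, arrowOp_mul, sAct_comm hij]
        exact ext_mul (v := v) (tauOp_far P hij v)
      | braid i j hij v hv =>
        simp only [map_mul, freeLift_fT]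
        simp only [tOp, arrowOp_mul]
        rw [sAct_braid hij]
        exact ext_mul (v := v) (tauOp_braid P hij v hv)
      | braid_ne i j hij v hv hv' =>
        rw [hpoly]
        simp only [map_sub, map_mul, freeLift_fT]
        simp only [tOp, arrowOp_mul]
        rw [← sAct_braid hij, ← arrowOp_sub]
        -- Since the outer colours agree, both paths of length three return to `v`, as the loop
        -- polynomial on the right requires.
        have hw : sAct i (sAct j (sAct i v)) = v := by
          rw [sAct_eq_self_iff.2 (show sAct i v (lo j) = sAct i v (hi j) by
            rw [sAct_apply, sAct_apply, lo_of_succ hij, sPerm_hi, sPerm_hi_upper hij, hv]),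
            sAct_sAct]
        rw [hw]
        exact ext_mul (v := v) (tauOp_braid_ne P hij v hv hv')
      | xx a b v => simpa using h.xx a b v
      | tx_lo i v hv =>
        simp only [map_sub, map_mul, map_neg, freeLift_fT, freeLift_fX, freeLift_fE]
        rw [tOp, xOp, xOp, eOp, arrowOp_mul, arrowOp_mul, ← arrowOp_sub, ← neg_one_smul k,
          ← arrowOp_smul, sAct_eq_self_iff.2 hv]
        refine ext_mul (v := v) fun f => ?_
        have := tauOp_mul_X P i (lo i) v f
        rw [if_pos hv, if_pos rfl] at this
        simpa using this
      | tx_hi i v hv =>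
        simp only [map_sub, map_mul, freeLift_fT, freeLift_fX, freeLift_fE]
        rw [tOp, xOp, xOp, eOp, arrowOp_mul, arrowOp_mul, ← arrowOp_sub, sAct_eq_self_iff.2 hv]
        refine ext_mul (v := v) fun f => ?_
        have := tauOp_mul_X P i (hi i) v f
        rw [if_pos hv, if_neg (lo_ne_hi i).symm, if_pos rfl] at this
        simpa using this
      | tx i a v hav =>
        simp only [map_sub, map_mul, map_zero, freeLift_fT, freeLift_fX]
        rw [tOp, xOp, xOp, arrowOp_mul, arrowOp_mul, ← arrowOp_sub,
          ← arrowOp_zero (k := k) v (sAct i v)]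
        refine ext_mul (v := v) fun f => ?_
        have := tauOp_mul_X P i a v f
        simpa using this.trans (by split_ifs <;> tauto))
  exact ⟨ρ, fun v => hρ _, fun a v => hρ _, fun i v => hρ _⟩

end Representation

/-! ### Independence of permutations over polynomials -/

section Independence

open MvPolynomial

variable {k : Type*} [CommRing k] {n : ℕ}

/-! ### Non-zero-divisors in polynomial rings. -/

lemma X_sub_X_mem_nonZeroDivisors {a b : Fin n} (h : a ≠ b) :
    (X a - X b : MvPolynomial (Fin n) k) ∈ nonZeroDivisors _ :=
  mem_nonZeroDivisors_iff_right.2 fun f hf =>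
    X_sub_X_cancel h (by rw [mul_comm, hf, mul_zero])

lemma algEquiv_mem_nonZeroDivisors {A B : Type*} [CommRing A] [CommRing B] [Algebra k A]
    [Algebra k B] (E : A ≃ₐ[k] B) {a : A} (ha : a ∈ nonZeroDivisors A) :
    E a ∈ nonZeroDivisors B := by
  refine mem_nonZeroDivisors_iff_right.2 fun b hb => ?_
  have := congrArg E.symm hb
  rw [map_mul, AlgEquiv.symm_apply_apply, map_zero] at this
  exact (map_eq_zero_iff E.symm E.symm.injective).1 (mem_nonZeroDivisors_iff_right.1 ha _ this)

lemma rename_mem_nonZeroDivisors (w : Equiv.Perm (Fin n)) {p : MvPolynomial (Fin n) k}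
    (hp : p ∈ nonZeroDivisors (MvPolynomial (Fin n) k)) :
    rename w p ∈ nonZeroDivisors (MvPolynomial (Fin n) k) :=
  algEquiv_mem_nonZeroDivisors (renameEquiv k w) hp

lemma C_mem_nonZeroDivisors {σ R : Type*} [CommRing R] {r : R} (hr : r ∈ nonZeroDivisors R) :
    (C r : MvPolynomial σ R) ∈ nonZeroDivisors (MvPolynomial σ R) := by
  refine mem_nonZeroDivisors_iff_right.2 fun f hf => ?_
  ext m
  have := congrArg (coeff m) hf
  rw [mul_comm, coeff_C_mul, coeff_zero, mul_comm] at this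
  rw [coeff_zero]
  exact (mem_nonZeroDivisors_iff_right.1 hr) _ this

/-- Regard polynomials in the larger set of variables as polynomials in the remaining variables over
`MvPolynomial σ k`. The image of `p` becomes a constant, and multiplication by it can be checked on
coefficients. -/
lemma rename_injective_mem_nonZeroDivisors {σ τ : Type*} {f : σ → τ} (hf : Function.Injective f)
    {p : MvPolynomial σ k} (hp : p ∈ nonZeroDivisors (MvPolynomial σ k)) :
    rename f p ∈ nonZeroDivisors (MvPolynomial τ k) := by
  classical
  let g : σ ⊕ ((Set.range f)ᶜ : Set τ) ≃ τ :=
    ((Equiv.ofInjective f hf).sumCongr (Equiv.refl _)).trans (Equiv.Set.sumCompl (Set.range f))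
  have hg : ∀ s, g (Sum.inl s) = f s := fun s => by simp [g]
  let E : MvPolynomial τ k ≃ₐ[k] MvPolynomial ((Set.range f)ᶜ : Set τ) (MvPolynomial σ k) :=
    (renameEquiv k (g.symm.trans (Equiv.sumComm _ _))).trans (sumAlgEquiv k _ _)
  have hE : E.toAlgHom.comp (rename f) = Algebra.algHom k _ _ := by
    ext1 i
    have : g.symm (f i) = Sum.inl i := by rw [← hg, Equiv.symm_apply_apply]
    simp [E, this]
    rfl
  have hE' : E (rename f p) = C p := DFunLike.congr_fun hE p
  have := algEquiv_mem_nonZeroDivisors E.symm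
    (C_mem_nonZeroDivisors (σ := ((Set.range f)ᶜ : Set τ)) hp)
  rwa [← hE', AlgEquiv.symm_apply_apply] at this

lemma eval₂At_mem_nonZeroDivisors {p : MvPolynomial (Fin 2) k}
    (hp : p ∈ nonZeroDivisors (MvPolynomial (Fin 2) k)) {a b : Fin n} (h : a ≠ b) :
    eval₂At p a b ∈ nonZeroDivisors (MvPolynomial (Fin n) k) := by
  have h1 : eval₂At p a b = rename ![a, b] p := by
    refine DFunLike.congr_fun (?_ : aeval ![X a, X b] = rename ![a, b]) p
    ext1 i
    fin_cases i <;> simp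
  rw [h1]
  refine rename_injective_mem_nonZeroDivisors ?_ hp
  intro i j hij
  fin_cases i <;> fin_cases j <;> simp_all

/-- This supplies a common denominator `T` for the denominators `t i`, in place of a localization.
-/
lemma exists_cofactors {R ι : Type*} [CommRing R] [Fintype ι] (t : ι → R)
    (ht : ∀ i, t i ∈ nonZeroDivisors R) :
    ∃ T ∈ nonZeroDivisors R, ∃ E : ι → R, (∀ i, E i ∈ nonZeroDivisors R) ∧ ∀ i, E i * t i = T := by
  classical
  refine ⟨∏ i, t i, prod_mem fun i _ => ht i, fun i => ∏ j ∈ Finset.univ.erase i, t j,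
    fun i => prod_mem fun j _ => ht j, fun i => ?_⟩
  rw [mul_comm]
  exact Finset.mul_prod_erase _ t (Finset.mem_univ i)

/-- Distinct permutations of the variables are linearly independent over polynomials. -/
theorem eq_zero_of_sum_rename_eq_zero {c : Equiv.Perm (Fin n) → MvPolynomial (Fin n) k}
    (hc : ∀ f, ∑ w, c w * rename w f = 0) : c = 0 := by
  ext1 w₀
  -- Dedekind's argument: `S` contains the permutations other than `w₀` whose coefficients may be
  -- nonzero, and is emptied one element at a time.
  suffices H : ∀ S : Finset (Equiv.Perm (Fin n)),
      ∀ c : Equiv.Perm (Fin n) → MvPolynomial (Fin n) k,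
        (∀ w, w ∉ S → w ≠ w₀ → c w = 0) → (∀ f, ∑ w, c w * rename w f = 0) → c w₀ = 0 from
    H Finset.univ c (fun w hw => absurd (Finset.mem_univ w) hw) hc
  intro S
  induction S using Finset.induction_on with
  | empty =>
    intro c h0 hc
    have := hc 1
    rwa [Finset.sum_eq_single w₀ (fun w _ hw => by rw [h0 w (by simp) hw, zero_mul])
      (fun h => absurd (Finset.mem_univ _) h), map_one, mul_one] at this
  | insert w₁ S _ ih =>
    intro c h0 hc
    by_cases hw : w₁ = w₀
    · refine ih c (fun w hwS hw0 => h0 w ?_ hw0) hc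
      rw [Finset.mem_insert, not_or]
      exact ⟨fun h => hw0 (h.trans hw), hwS⟩
    · obtain ⟨a, ha⟩ : ∃ a, w₁ a ≠ w₀ a := by
        by_contra! h
        exact hw (Equiv.ext h)
      -- Subtracting `X (w₁ a)` times the relation at `f` from the relation at `X a * f` kills the
      -- term of `w₁`. It multiplies the coefficient of `w₀` by a non-zero-divisor, because `w₁ a ≠
      -- w₀ a`.
      have := ih (fun w => c w * (X (w a) - X (w₁ a))) (fun w hwS hw0 => by
          by_cases hww : w = w₁
          · rw [hww, sub_self, mul_zero]
          · rw [h0 w (by simp [hww, hwS]) hw0, zero_mul])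
        (fun f => by
          have e1 := hc (X a * f)
          have e2 := hc f
          calc ∑ w, c w * (X (w a) - X (w₁ a)) * rename w f
              = ∑ w, (c w * rename w (X a * f) - X (w₁ a) * (c w * rename w f)) :=
                Finset.sum_congr rfl fun w _ => by rw [map_mul, rename_X]; ring
            _ = 0 := by rw [Finset.sum_sub_distrib, ← Finset.mul_sum, e1, e2, mul_zero, sub_zero])
      exact (mem_nonZeroDivisors_iff_right.1 (X_sub_X_mem_nonZeroDivisors ha.symm)) _ this

end Independence

/-! ### Leading terms of the operators attached to words -/

section LeadingTerms

open MvPolynomial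

variable {k : Type*} [CommRing k] {I : Type*} [DecidableEq I] {n : ℕ}
  (P : I → I → MvPolynomial (Fin 2) k)

/-- The target of the path attached to a word starting at a vertex. -/
def wordAct {I : Type*} : List (Fin (n - 1)) → (Fin n → I) → (Fin n → I)
  | [], v => v
  | i :: l, v => wordAct l (sAct i v)

/-- The operator on polynomials attached to a word and a starting vertex. -/
def wordOp : List (Fin (n - 1)) → (Fin n → I) →
    MvPolynomial (Fin n) k →ₗ[k] MvPolynomial (Fin n) k
  | [], _ => LinearMap.id
  | i :: l, v => wordOp l (sAct i v) ∘ₗ tauOp P i v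

lemma wordProd_polyRep (l : List (Fin (n - 1))) (v : Fin n → I) :
    wordProd (eOp k) (tOp P) l v = arrowOp v (wordAct l v) (wordOp P l v) := by
  induction l generalizing v with
  | nil => rfl
  | cons i l ih => rw [wordProd, ih, tOp, arrowOp_mul]; rfl

/-- A common shape for the two kinds of operators: the divided difference has denominator `x_i -
x_{i+1}` and leading coefficient `1`, the twisted transposition has denominator `1` and leading
coefficient a value of `P`. -/
lemma exists_tauOp_expansion (hP : ∀ i j, i ≠ j → P i j ∈ nonZeroDivisors (MvPolynomial (Fin 2) k))
    (i : Fin (n - 1)) (v : Fin n → I) :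
    ∃ d ∈ nonZeroDivisors (MvPolynomial (Fin n) k), ∃ b,
      ∃ b' ∈ nonZeroDivisors (MvPolynomial (Fin n) k),
      ∀ f, d * tauOp P i v f = b * f + b' * rename (sPerm i) f := by
  by_cases h : v (lo i) = v (hi i)
  · refine ⟨_, X_sub_X_mem_nonZeroDivisors (lo_ne_hi i), -1, 1, one_mem _, fun f => ?_⟩
    rw [tauOp_of_eq P h, X_sub_X_mul_divDiff]
    ring
  · refine ⟨1, one_mem _, 0, _, eval₂At_mem_nonZeroDivisors (hP _ _ h) (lo_ne_hi i).symm,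
      fun f => ?_⟩
    rw [tauOp_of_ne P h]
    ring

/-- Composing on the right with `b + b' s_i` turns a term at `w` into terms at `w` and `w s_i`.
Inversion numbers grow by at most one, and the new top permutation comes only from the previous top
one. -/
theorem exists_wordOp_expansion
    (hP : ∀ i j, i ≠ j → P i j ∈ nonZeroDivisors (MvPolynomial (Fin 2) k))
    {l : List (Fin (n - 1))} (hl : IsReduced l) (v : Fin n → I) :
    ∃ d ∈ nonZeroDivisors (MvPolynomial (Fin n) k),
      ∃ c : Equiv.Perm (Fin n) → MvPolynomial (Fin n) k,
      (∀ f, d * wordOp P l v f = ∑ w, c w * rename w f) ∧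
      c (wordPerm l) ∈ nonZeroDivisors (MvPolynomial (Fin n) k) ∧
      ∀ w, c w ≠ 0 → w = wordPerm l ∨ inv w < l.length := by
  induction l generalizing v with
  | nil =>
    refine ⟨1, one_mem _, fun w => if w = 1 then 1 else 0, fun f => ?_, ?_, ?_⟩
    · simp [wordOp]
    · simp [wordPerm_nil, one_mem]
    · intro w hw
      left
      by_contra h
      exact hw (if_neg h)
  | cons i l ih =>
    have hl' := hl.of_cons
    obtain ⟨d, hd, c, h1, h2, h3⟩ := ih hl' (sAct i v)
    obtain ⟨t, ht, b, b', hb', h4⟩ := exists_tauOp_expansion P hP i v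
    -- Moving the denominator `t` to the left of a permutation `y` turns it into `rename y t`, which
    -- depends on `y`; hence a common multiple over all permutations.
    obtain ⟨T, hT, E, hE, hE'⟩ := exists_cofactors (fun y : Equiv.Perm (Fin n) => rename y t)
      fun y => rename_mem_nonZeroDivisors y ht
    have hinv : inv (wordPerm l * sPerm i) = l.length + 1 := by
      rw [← wordPerm_cons]; exact hl
    -- The new top permutation has too many inversions to occur in the old expansion, so the
    -- contribution of `b` to its coefficient is zero.
    have hc0 : c (wordPerm l * sPerm i) = 0 := by
      by_contra h
      rcases h3 _ h with h | h
      · rw [h, hl'] at hinv; omega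
      · omega
    refine ⟨T * d, mul_mem hT hd,
      fun w => c w * E w * rename w b + c (w * sPerm i) * E (w * sPerm i) *
        rename (w * sPerm i : Equiv.Perm (Fin n)) b', fun f => ?_, ?_, ?_⟩
    · rw [wordOp, LinearMap.comp_apply, mul_assoc, h1, Finset.mul_sum]
      simp only [add_mul, Finset.sum_add_distrib]
      rw [← Equiv.sum_comp (Equiv.mulRight (sPerm i)) (fun w => c (w * sPerm i) *
        E (w * sPerm i) * rename (w * sPerm i : Equiv.Perm (Fin n)) b' * rename w f),
        ← Finset.sum_add_distrib]
      refine Finset.sum_congr rfl fun w _ => ?_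
      have h5 := congrArg (rename w) (h4 f)
      rw [map_mul, map_add, map_mul, map_mul, rename_rename, ← Equiv.Perm.coe_mul] at h5
      simp only [Equiv.coe_mulRight, mul_assoc, sPerm_mul_self, mul_one]
      rw [← hE' w]
      linear_combination c w * E w * h5
    · beta_reduce
      rw [wordPerm_cons, hc0, zero_mul, zero_mul, zero_add, mul_assoc (wordPerm l), sPerm_mul_self,
        mul_one]
      exact mul_mem (mul_mem h2 (hE _)) (rename_mem_nonZeroDivisors _ hb')
    · intro w hw
      rw [List.length_cons]
      by_cases hcw : c w = 0
      · have hcs : c (w * sPerm i) ≠ 0 := by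
          intro h
          simp [hcw, h] at hw
        rcases h3 _ hcs with h | h
        · left
          rw [wordPerm_cons, ← h, mul_assoc, sPerm_mul_self, mul_one]
        · right
          have := inv_mul_sPerm_le (w * sPerm i) i
          rw [mul_assoc, sPerm_mul_self, mul_one] at this
          omega
      · right
        rcases h3 _ hcw with h | h
        · rw [h, hl']; omega
        · omega

/-- For a fixed starting vertex, take `w₀` with the most inversions among the permutations with
nonzero coefficient. By triangularity only the word of `w₀` contributes to the coefficient of
`rename w₀`, and it does so with a non-zero-divisor. -/
theorem eq_zero_of_sum_arrowOp_eq_zero [Fintype I]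
    (hP : ∀ i j, i ≠ j → P i j ∈ nonZeroDivisors (MvPolynomial (Fin 2) k))
    {r : Equiv.Perm (Fin n) → List (Fin (n - 1))} (hr : ∀ w, wordPerm (r w) = w)
    (hred : ∀ w, IsReduced (r w)) {p : Equiv.Perm (Fin n) → (Fin n → I) → MvPolynomial (Fin n) k}
    (hp : ∑ w, ∑ v, arrowOp v (wordAct (r w) v) (wordOp P (r w) v ∘ₗ LinearMap.mulLeft k (p w v))
      = 0) : p = 0 := by
  classical
  ext1 w
  ext1 v
  by_contra hpw
  obtain ⟨w₀, hw₀, hmax⟩ := Finset.exists_max_image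
    (Finset.univ.filter fun w => p w v ≠ 0) inv ⟨w, by simpa using hpw⟩
  simp only [Finset.mem_filter, Finset.mem_univ, true_and] at hw₀ hmax
  choose d hd c h1 h2 h3 using fun w => exists_wordOp_expansion P hP (hred w) v
  set u := wordAct (r w₀) v with hu
  obtain ⟨T, -, D, hDm, hD⟩ := exists_cofactors d hd
  -- The relation is tested on vectors supported at `v` and read off at the target `u` of the word
  -- of `w₀`; words ending elsewhere drop out.
  have key : ∀ f, ∑ w, (if u = wordAct (r w) v then wordOp P (r w) v (p w v * f) else 0) = 0 := by
    intro f
    have := congrFun (LinearMap.congr_fun hp (Pi.single v f)) u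
    simp only [LinearMap.sum_apply, Finset.sum_apply, arrowOp_apply, LinearMap.zero_apply,
      Pi.zero_apply, LinearMap.comp_apply, LinearMap.mulLeft_apply] at this
    refine Eq.trans ?_ this
    refine Finset.sum_congr rfl fun w _ => ?_
    rw [Finset.sum_eq_single v]
    · rw [Pi.single_eq_same]
    · intro v' _ hv'
      rw [Pi.single_eq_of_ne hv', mul_zero, map_zero, ite_self]
    · intro h; exact absurd (Finset.mem_univ _) h
  have hcoef := eq_zero_of_sum_rename_eq_zero (c := fun y => ∑ w, if u = wordAct (r w) v then
      D w * c w y * rename y (p w v) else 0) (fun f => by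
    have := congrArg (fun g => T * g) (key f)
    simp only [mul_zero, Finset.mul_sum] at this
    refine Eq.trans ?_ this
    simp only [Finset.sum_mul]
    rw [Finset.sum_comm]
    refine Finset.sum_congr rfl fun w _ => ?_
    split_ifs
    · rw [← hD w, mul_assoc, h1, Finset.mul_sum]
      refine Finset.sum_congr rfl fun y _ => ?_
      rw [map_mul]
      ring
    · simp)
  have h0 := congrFun hcoef w₀
  simp only [Pi.zero_apply] at h0
  rw [Finset.sum_eq_single w₀, if_pos hu] at h0
  · have h5 : D w₀ * c w₀ w₀ ∈ nonZeroDivisors (MvPolynomial (Fin n) k) := by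
      refine mul_mem (hDm _) ?_
      have := h2 w₀
      rwa [hr] at this
    rw [mul_comm] at h0
    have h6 := (mem_nonZeroDivisors_iff_right.1 h5) _ h0
    exact hw₀ (rename_injective _ w₀.injective (h6.trans (map_zero _).symm))
  · intro w _ hw
    split_ifs
    · by_cases hpw : p w v = 0
      · rw [hpw, map_zero, mul_zero]
      · have : c w w₀ = 0 := by
          by_contra hc
          rcases h3 w w₀ hc with h | h
          · rw [hr] at h; exact hw h.symm
          · have h7 := hmax w hpw
            have h8 := hred w
            rw [IsReduced, hr] at h8
            omega
        rw [this, mul_zero, zero_mul]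
    · rfl
  · intro h; exact absurd (Finset.mem_univ _) h

end LeadingTerms

/-! ### Faithfulness of the polynomial representation and bases -/

section Faithful

open MvPolynomial

variable {k : Type*} [CommRing k] {I : Type*} {n : ℕ} [Fintype I]

namespace Hn

/-- The map sending a family of polynomials indexed by permutations and vertices to the
corresponding combination of words `r w` with polynomial coefficients on the right. -/
def ofPolys (Q : I → I → MvPolynomial (Fin 2) k) (r : Equiv.Perm (Fin n) → List (Fin (n - 1))) :
    (Equiv.Perm (Fin n) → (Fin n → I) → MvPolynomial (Fin n) k) →ₗ[k] Hn Q n where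
  toFun p := ∑ w, ∑ v, wordProd (e Q) (τ Q) (r w) v * (isPsiSystem Q).polyMap k (p w v)
  map_add' p q := by simp only [Pi.add_apply, map_add, mul_add, Finset.sum_add_distrib]
  map_smul' c p := by
    simp only [Pi.smul_apply, map_smul, Algebra.mul_smul_comm, Finset.smul_sum, RingHom.id_apply]

variable {Q : I → I → MvPolynomial (Fin 2) k} {r : Equiv.Perm (Fin n) → List (Fin (n - 1))}

lemma ofPolys_single [DecidableEq I] (w : Equiv.Perm (Fin n)) (a : Fin n → ℕ) (v : Fin n → I) :
    ofPolys Q r (Pi.single w (Pi.single v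
      (monomial (Finsupp.equivFunOnFinite.symm a) 1))) = basisElt Q (r w) a v := by
  rw [basisElt_eq, (isPsiSystem Q).wordMonomial_eq (k := k)]
  change ∑ w', ∑ v', _ = _
  rw [Finset.sum_eq_single w, Finset.sum_eq_single v]
  · simp only [Pi.single_eq_same]
  · intro v' _ hv
    rw [Pi.single_eq_same, Pi.single_eq_of_ne hv, map_zero, mul_zero]
  · intro h; exact absurd (Finset.mem_univ _) h
  · intro w' _ hw
    refine Finset.sum_eq_zero fun v' _ => ?_
    rw [Pi.single_eq_of_ne hw, Pi.zero_apply, map_zero, mul_zero]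
  · intro h; exact absurd (Finset.mem_univ _) h

lemma ofPolys_surjective {J : Set (List (Fin (n - 1)))} (hJ : IsReducedRepresentatives J)
    (hr : ∀ l ∈ J, r (wordPerm l) = l) : Function.Surjective (ofPolys Q r) := by
  classical
  rw [← LinearMap.range_eq_top, eq_top_iff, ← span_eq_top Q hJ, Submodule.span_le]
  rintro _ ⟨l, hl, a, v, rfl⟩
  refine ⟨_, (ofPolys_single (wordPerm l) a v).trans ?_⟩
  rw [hr l hl]

lemma map_wordProd_mul_polyMap [DecidableEq I] {P : I → I → MvPolynomial (Fin 2) k}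
    {ρ : Hn Q n →ₐ[k] Module.End k (PolyRep k I n)} (he : ∀ v, ρ (e Q v) = eOp k v)
    (hx : ∀ a v, ρ (x Q a v) = xOp k a v) (hτ : ∀ i v, ρ (τ Q i v) = tOp P i v)
    (l : List (Fin (n - 1))) (v : Fin n → I) (p : MvPolynomial (Fin n) k) :
    ρ (wordProd (e Q) (τ Q) l v * (isPsiSystem Q).polyMap k p) =
      arrowOp v (wordAct l v) (wordOp P l v ∘ₗ LinearMap.mulLeft k p) := by
  have h1 : ρ (wordProd (e Q) (τ Q) l v) = wordProd (eOp k) (tOp P) l v := by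
    induction l generalizing v with
    | nil => exact he v
    | cons i l ih => rw [wordProd, map_mul, ih, hτ, wordProd]
  have h2 : ρ ((isPsiSystem Q).polyMap k p) = (isPsiSystem_polyRep P).polyMap k p := by
    refine DFunLike.congr_fun
      (?_ : ρ.comp ((isPsiSystem Q).polyMap k) = (isPsiSystem_polyRep P).polyMap k) p
    ext1 a
    rw [AlgHom.comp_apply, IsPsiSystem.polyMap_X, IsPsiSystem.polyMap_X, loopSum, loopSum, map_sum]
    exact Finset.sum_congr rfl fun v _ => hx a v
  rw [map_mul, h1, h2, ← (isPsiSystem_polyRep P).wordProd_mul_e, mul_assoc, eOp_mul_polyMap,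
    wordProd_polyRep, arrowOp_mul]

end Hn

lemma IsReducedRepresentatives.exists_section {J : Set (List (Fin (n - 1)))}
    (hJ : IsReducedRepresentatives J) :
    ∃ E : J ≃ Equiv.Perm (Fin n), ∀ l, E l = wordPerm l.1 := by
  refine ⟨Equiv.ofBijective (fun l : J => wordPerm l.1) ⟨?_, ?_⟩, fun l => rfl⟩
  · exact hJ.1.injOn.injective
  · intro w
    obtain ⟨l, hl, hw⟩ := hJ.1.surjOn (Set.mem_univ w)
    exact ⟨⟨l, hl⟩, hw⟩

namespace Hn

/-- The composite of `ρ` with `ofPolys` is injective by triangularity and `ofPolys` is surjective by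
straightening, so each of the two maps is injective. Faithfulness and linear independence thus come
together. -/
theorem exists_faithful_polyRep [DecidableEq I] (P : I → I → MvPolynomial (Fin 2) k)
    (hP : ∀ i, P i i = 0)
    (hP' : ∀ i j, i ≠ j → P i j ∈ nonZeroDivisors (MvPolynomial (Fin 2) k))
    {J : Set (List (Fin (n - 1)))} (hJ : IsReducedRepresentatives J)
    {E : J ≃ Equiv.Perm (Fin n)} (hE : ∀ l, E l = wordPerm l.1) :
    ∃ ρ : Hn (fun i j => P i j * flipVars (P j i)) n →ₐ[k] Module.End k (PolyRep k I n),
      ((∀ v, ρ (e _ v) = eOp k v) ∧ (∀ a v, ρ (x _ a v) = xOp k a v) ∧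
      (∀ i v, ρ (τ _ i v) = tOp P i v)) ∧ Function.Injective ρ ∧ Function.Injective
        (ofPolys (fun i j => P i j * flipVars (P j i)) fun w => (E.symm w).1) := by
  obtain ⟨ρ, he, hx, hτ⟩ := exists_polyRep (n := n) P hP
  set T := ofPolys (fun i j => P i j * flipVars (P j i)) fun w => (E.symm w).1
  have hinj : ∀ p, ρ (T p) = 0 → p = 0 := by
    intro p hp
    refine eq_zero_of_sum_arrowOp_eq_zero P hP' (r := fun w => (E.symm w).1)
      (fun w => by rw [← hE, Equiv.apply_symm_apply])
      (fun w => hJ.isReduced (E.symm w).2) ?_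
    rw [← hp]
    change _ = ρ (∑ w, ∑ v, _)
    rw [map_sum]
    refine Finset.sum_congr rfl fun w _ => ?_
    rw [map_sum]
    exact Finset.sum_congr rfl fun v _ => (map_wordProd_mul_polyMap he hx hτ _ v _).symm
  have hsurj : Function.Surjective T := ofPolys_surjective hJ fun l hl => by
    rw [← hE ⟨l, hl⟩, Equiv.symm_apply_apply]
  refine ⟨ρ, ⟨he, hx, hτ⟩, ?_, ?_⟩
  · rw [injective_iff_map_eq_zero]
    intro y hy
    obtain ⟨p, rfl⟩ := hsurj y
    rw [hinj p hy, map_zero]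
  · rw [injective_iff_map_eq_zero]
    intro p hp
    exact hinj p (by rw [hp, map_zero])

/-- An enumeration of `I` orders each pair of distinct indices: the smaller-to-larger entry of `P`
carries all of `Q` and the opposite one is `1`. The symmetry of `Q` accounts for the pairs in the
other order. -/
lemma exists_factorization [DecidableEq I] (Q : I → I → MvPolynomial (Fin 2) k)
    (hQ : ∀ i, Q i i = 0) (hQ' : ∀ i j, i ≠ j → Q i j ∈ nonZeroDivisors (MvPolynomial (Fin 2) k))
    (hQs : ∀ i j, Q i j = flipVars (Q j i)) :
    ∃ P : I → I → MvPolynomial (Fin 2) k, (∀ i, P i i = 0) ∧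
      (∀ i j, i ≠ j → P i j ∈ nonZeroDivisors (MvPolynomial (Fin 2) k)) ∧
      Q = fun i j => P i j * flipVars (P j i) := by
  let ε := Fintype.equivFin I
  refine ⟨fun i j => if i = j then 0 else if ε i < ε j then Q i j else 1, fun i => if_pos rfl,
    fun i j hij => ?_, ?_⟩
  · beta_reduce
    rw [if_neg hij]
    split_ifs
    · exact hQ' i j hij
    · exact one_mem _
  · ext1 i
    ext1 j
    have h1 : flipVars (1 : MvPolynomial (Fin 2) k) = 1 := map_one _
    beta_reduce
    by_cases hij : i = j
    · rw [hij, hQ, if_pos rfl, zero_mul]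
    · rw [if_neg hij, if_neg (Ne.symm hij)]
      rcases lt_or_gt_of_ne (ε.injective.ne hij) with h | h
      · rw [if_pos h, if_neg h.not_gt, h1, mul_one]
      · rw [if_neg h.not_gt, if_pos h, one_mul, ← hQs]

/-- After factoring `Q`, the map `ofPolys` is an isomorphism from a finite product of polynomial
modules, and it transports the monomial basis. -/
theorem exists_basis [DecidableEq I] (Q : I → I → MvPolynomial (Fin 2) k)
    (hQ : ∀ i, Q i i = 0) (hQ' : ∀ i j, i ≠ j → Q i j ∈ nonZeroDivisors (MvPolynomial (Fin 2) k))
    (hQs : ∀ i j, Q i j = flipVars (Q j i)) {J : Set (List (Fin (n - 1)))}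
    (hJ : IsReducedRepresentatives J) :
    ∃ b : Module.Basis (J × (Fin n → ℕ) × (Fin n → I)) k (Hn Q n),
      ∀ l a v, b (l, a, v) = basisElt Q l a v := by
  obtain ⟨P, hP, hP', rfl⟩ := exists_factorization Q hQ hQ' hQs
  obtain ⟨E, hE⟩ := hJ.exists_section
  obtain ⟨ρ, -, -, hinj⟩ := exists_faithful_polyRep P hP hP' hJ hE
  have hsurj := ofPolys_surjective (Q := fun i j => P i j * flipVars (P j i))
    (r := fun w => (E.symm w).1) hJ fun l hl => by
      rw [← hE ⟨l, hl⟩, Equiv.symm_apply_apply]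
  let b₀ := Pi.basis fun _ : Equiv.Perm (Fin n) => Pi.basis fun _ : Fin n → I =>
    basisMonomials (Fin n) k
  let ε : ((_ : Equiv.Perm (Fin n)) × (_ : Fin n → I) × (Fin n →₀ ℕ)) ≃
      J × (Fin n → ℕ) × (Fin n → I) :=
    { toFun := fun y => (E.symm y.1, y.2.2, y.2.1)
      invFun := fun y => ⟨E y.1, y.2.2, Finsupp.equivFunOnFinite.symm y.2.1⟩
      left_inv := fun y => by simp
      right_inv := fun y => by simp }
  refine ⟨(b₀.map (LinearEquiv.ofBijective _ ⟨hinj, hsurj⟩)).reindex ε, fun l a v => ?_⟩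
  rw [Module.Basis.reindex_apply, Module.Basis.map_apply]
  change ofPolys _ _ (b₀ ⟨E l, v, Finsupp.equivFunOnFinite.symm a⟩) = _
  have hb : b₀ ⟨E l, v, Finsupp.equivFunOnFinite.symm a⟩ =
      Pi.single (E l) (Pi.single v (monomial (Finsupp.equivFunOnFinite.symm a) 1)) := by
    rw [Pi.basis_apply, Pi.basis_apply, coe_basisMonomials]
  rw [hb, ofPolys_single, Equiv.symm_apply_apply]

end Hn

end Faithful

/-! ### The associated graded algebra -/

section Graded

open MvPolynomial

variable {k : Type*} [CommRing k] {I : Type*} {n : ℕ}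

namespace AlgFiltration

variable {A : Type*} [Ring A] [Algebra k A] (G : AlgFiltration k A)

lemma symbol_mul_symbol {i j : ℕ} {a b : A} (ha : a ∈ G.F i) (hb : b ∈ G.F j) :
    G.symbol i a ha * G.symbol j b hb = G.symbol (i + j) (a * b) (G.mul_mem ha hb) :=
  DirectSum.of_mul_of _ _

lemma symbol_eq {i j : ℕ} (hij : i = j) {a b : A} (ha : a ∈ G.F i) (hb : b ∈ G.F j)
    (h : a - b ∈ G.prev i) : G.symbol i a ha = G.symbol j b hb := by
  subst hij
  have : G.cls i a ha = G.cls i b hb := (Submodule.Quotient.eq _).2 h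
  exact congrArg (DirectSum.of G.Piece i) this

lemma symbol_congr {i j : ℕ} (hij : i = j) {a b : A} (hab : a = b) (ha : a ∈ G.F i)
    (hb : b ∈ G.F j) : G.symbol i a ha = G.symbol j b hb := by
  subst hij; subst hab; rfl

/-- The map from `F i` to the associated graded algebra. -/
def symbolMap (i : ℕ) : G.F i →ₗ[k] G.Gr :=
  DirectSum.lof k ℕ G.Piece i ∘ₗ ((G.prev i).comap (G.F i).subtype).mkQ

lemma symbolMap_apply {i : ℕ} (a : G.F i) : G.symbolMap i a = G.symbol i a.1 a.2 := rfl

lemma symbol_eq_zero {i : ℕ} {a : A} (ha : a ∈ G.F i) (h : a ∈ G.prev i) :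
    G.symbol i a ha = 0 :=
  (G.symbol_eq rfl ha (Submodule.zero_mem _) (by rwa [sub_zero])).trans
    (map_zero (G.symbolMap i))

/-- An element of the associated graded algebra is the class in degree `i` of `a`. -/
def IsSymbol (i : ℕ) (z : G.Gr) (a : A) : Prop := ∃ h : a ∈ G.F i, z = G.symbol i a h

variable {G}

lemma IsSymbol.mul {i j : ℕ} {z z' : G.Gr} {a b : A} (h : G.IsSymbol i z a)
    (h' : G.IsSymbol j z' b) : G.IsSymbol (i + j) (z * z') (a * b) := by
  obtain ⟨ha, rfl⟩ := h
  obtain ⟨hb, rfl⟩ := h'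
  exact ⟨G.mul_mem ha hb, G.symbol_mul_symbol ha hb⟩

lemma IsSymbol.one : G.IsSymbol 0 1 1 := ⟨G.one_mem, rfl⟩

lemma IsSymbol.pow {z : G.Gr} {a : A} (h : G.IsSymbol 0 z a) (m : ℕ) :
    G.IsSymbol 0 (z ^ m) (a ^ m) := by
  induction m with
  | zero => rw [pow_zero, pow_zero]; exact .one
  | succ m ih => rw [pow_succ, pow_succ]; exact ih.mul h

lemma IsSymbol.list_prod {ι : Type*} {z : ι → G.Gr} {a : ι → A}
    (h : ∀ i, G.IsSymbol 0 (z i) (a i)) (m : List ι) :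
    G.IsSymbol 0 (m.map z).prod (m.map a).prod := by
  induction m with
  | nil => exact .one
  | cons i m ih => rw [List.map_cons, List.map_cons, List.prod_cons, List.prod_cons]
                   exact (h i).mul ih

/-- A basis adapted to a filtration yields coordinates on the associated graded algebra. -/
lemma exists_coordinates {ι : Type*} (b : Module.Basis ι k A) (d : ι → ℕ)
    (hb : ∀ i, b i ∈ G.F (d i)) (hF : ∀ r, G.F r ≤ Submodule.span k {y | ∃ i, d i ≤ r ∧ y = b i}) :
    ∃ φ : G.Gr →ₗ[k] (ι →₀ k), ∀ i, φ (G.symbol (d i) (b i) (hb i)) = Finsupp.single i 1 := by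
  classical
  -- The coordinates on the basis vectors of degree exactly `r`. They vanish on the preceding
  -- filtration step by `hF`, hence descend to the piece of degree `r`.
  let part (r : ℕ) : A →ₗ[k] (ι →₀ k) :=
    (Finsupp.supported k k {i | d i = r}).subtype ∘ₗ
      Finsupp.restrictDom k k {i | d i = r} ∘ₗ b.repr.toLinearMap
  have hpart : ∀ r i, part r (b i) = if d i = r then Finsupp.single i 1 else 0 := by
    intro r i
    have : part r (b i) = Finsupp.filter (· ∈ {i | d i = r}) (b.repr (b i)) := rfl
    rw [this, Module.Basis.repr_self]
    split_ifs with h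
    · exact Finsupp.filter_single_of_pos _ h
    · exact Finsupp.filter_single_of_neg _ h
  have hker : ∀ r, (G.prev r).comap (G.F r).subtype ≤ LinearMap.ker (part r ∘ₗ (G.F r).subtype) := by
    intro r y hy
    obtain _ | r := r
    · have : y.1 = 0 := (Submodule.mem_bot k).1 hy
      rw [LinearMap.mem_ker, LinearMap.comp_apply, Submodule.subtype_apply, this, map_zero]
    · have : G.F r ≤ LinearMap.ker (part (r + 1)) := by
        refine (hF r).trans (Submodule.span_le.2 ?_)
        rintro _ ⟨i, hi, rfl⟩
        rw [SetLike.mem_coe, LinearMap.mem_ker, hpart, if_neg (by omega)]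
      exact this hy
  refine ⟨DirectSum.toModule k ℕ _ fun r =>
    (Submodule.liftQ _ (part r ∘ₗ (G.F r).subtype) (hker r) : G.Piece r →ₗ[k] (ι →₀ k)), fun i => ?_⟩
  have h1 : part (d i) (b i) = Finsupp.single i 1 := by rw [hpart, if_pos rfl]
  rw [← h1]
  exact DirectSum.toModule_lof k (M := G.Piece) (d i) (G.cls (d i) (b i) (hb i))

end AlgFiltration

lemma map_wordMonomial {A B : Type*} [Ring A] [Algebra k A] [Ring B] [Algebra k B] (f : A →ₐ[k] B)
    (e : (Fin n → I) → A) (τ : Fin (n - 1) → (Fin n → I) → A) (x : Fin n → (Fin n → I) → A)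
    (l : List (Fin (n - 1))) (a : Fin n → ℕ) (v : Fin n → I) :
    f (wordMonomial e τ x l a v) =
      wordMonomial (fun v => f (e v)) (fun i v => f (τ i v)) (fun a v => f (x a v)) l a v := by
  have : f (wordProd e τ l v) = wordProd (fun v => f (e v)) (fun i v => f (τ i v)) l v := by
    induction l generalizing v with
    | nil => rfl
    | cons i l ih => rw [wordProd, map_mul, ih, wordProd]
  rw [wordMonomial, wordMonomial, map_mul, this, map_list_prod, List.map_ofFn]
  congr 3
  ext1 j
  exact map_pow f _ _

namespace Hn

variable [Fintype I] (Q : I → I → MvPolynomial (Fin 2) k)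

lemma isSymbol_grE (v : Fin n → I) : (filtration Q n).IsSymbol 0 (grE Q v) (e Q v) := ⟨_, rfl⟩

lemma isSymbol_grX (a : Fin n) (v : Fin n → I) :
    (filtration Q n).IsSymbol 0 (grX Q a v) (x Q a v) := ⟨_, rfl⟩

lemma isSymbol_grT (i : Fin (n - 1)) (v : Fin n → I) :
    (filtration Q n).IsSymbol 1 (grT Q i v) (τ Q i v) := ⟨_, rfl⟩

lemma isSymbol_wordMonomial (l : List (Fin (n - 1))) (a : Fin n → ℕ) (v : Fin n → I) :
    (filtration Q n).IsSymbol l.length (wordMonomial (grE Q) (grT Q) (grX Q) l a v)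
      (basisElt Q l a v) := by
  have h1 : (filtration Q n).IsSymbol l.length (wordProd (grE Q) (grT Q) l v)
      (wordProd (e Q) (τ Q) l v) := by
    induction l generalizing v with
    | nil => exact isSymbol_grE Q v
    | cons i l ih => exact (ih _).mul (isSymbol_grT Q i v)
  rw [basisElt_eq, wordMonomial, wordMonomial, List.ofFn_eq_map, List.ofFn_eq_map]
  have h2 := h1.mul (AlgFiltration.IsSymbol.list_prod
    (fun j => (isSymbol_grX Q j v).pow (a j)) (List.finRange n))
  rw [add_zero] at h2
  exact h2

/-- Identities in the graded algebra are reduced in this way to congruences in `H_n(Q)` modulo the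
preceding filtration step. -/
lemma eq_of_isSymbol {i j : ℕ} {z z' : Gr Q n} {a b : Hn Q n}
    (h : (filtration Q n).IsSymbol i z a) (h' : (filtration Q n).IsSymbol j z' b) (hij : i = j)
    (hab : a - b ∈ (filtration Q n).prev i) : z = z' := by
  obtain ⟨ha, rfl⟩ := h
  obtain ⟨hb, rfl⟩ := h'
  exact AlgFiltration.symbol_eq _ hij _ _ hab

lemma eq_zero_of_isSymbol {i : ℕ} {z : Gr Q n} {a : Hn Q n}
    (h : (filtration Q n).IsSymbol i z a) (ha : a ∈ (filtration Q n).prev i) : z = 0 := by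
  obtain ⟨ha, rfl⟩ := h
  exact AlgFiltration.symbol_eq_zero _ _ ‹_›

lemma isPsiSystem_gr : IsPsiSystem (grE Q (n := n)) (grT Q) (grX Q) := by
  have h := isPsiSystem Q (n := n)
  have eq' : ∀ {i j : ℕ} {z z' : Gr Q n} {a b : Hn Q n}, (filtration Q n).IsSymbol i z a →
      (filtration Q n).IsSymbol j z' b → i = j → a = b → z = z' := by
    intro i j z z' a b h1 h2 hij hab
    exact eq_of_isSymbol Q h1 h2 hij (by rw [hab, sub_self]; exact Submodule.zero_mem _)
  have zero' : ∀ {i : ℕ} {z : Gr Q n} {a : Hn Q n}, (filtration Q n).IsSymbol i z a →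
      a = 0 → z = 0 := by
    intro i z a h1 ha
    exact eq_zero_of_isSymbol Q h1 (by rw [ha]; exact Submodule.zero_mem _)
  have hE := isSymbol_grE Q (n := n)
  have hT := isSymbol_grT Q (n := n)
  have hX := isSymbol_grX Q (n := n)
  exact
  { e_mul_self := fun v => eq' ((hE v).mul (hE v)) (hE v) rfl (h.e_mul_self v)
    e_mul_of_ne := fun hvw => zero' ((hE _).mul (hE _)) (h.e_mul_of_ne hvw)
    sum_e := by
      have h1 : ∑ v, grE Q v = (filtration Q n).symbolMap 0 (∑ v, ⟨e Q v, e_mem Q v⟩) := by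
        rw [map_sum]; rfl
      rw [h1, AlgFiltration.symbolMap_apply]
      refine eq' ⟨_, rfl⟩ .one rfl ?_
      rw [AddSubmonoidClass.coe_finsetSum]
      exact h.sum_e
    e_mul_τ := fun i v => eq' ((hE _).mul (hT i v)) (hT i v) rfl (h.e_mul_τ i v)
    e_mul_τ_of_ne := fun i v w hvw => zero' ((hE _).mul (hT i v)) (h.e_mul_τ_of_ne i v w hvw)
    τ_mul_e := fun i v => eq' ((hT i v).mul (hE _)) (hT i v) rfl (h.τ_mul_e i v)
    τ_mul_e_of_ne := fun i v w hvw => zero' ((hT i v).mul (hE _)) (h.τ_mul_e_of_ne i v w hvw)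
    e_mul_x := fun a v => eq' ((hE _).mul (hX a v)) (hX a v) rfl (h.e_mul_x a v)
    e_mul_x_of_ne := fun a v w hvw => zero' ((hE _).mul (hX a v)) (h.e_mul_x_of_ne a v w hvw)
    x_mul_e := fun a v => eq' ((hX a v).mul (hE _)) (hX a v) rfl (h.x_mul_e a v)
    x_mul_e_of_ne := fun a v w hvw => zero' ((hX a v).mul (hE _)) (h.x_mul_e_of_ne a v w hvw)
    xx := fun a b v => eq' ((hX a v).mul (hX b v)) ((hX b v).mul (hX a v)) rfl (h.xx a b v) }

/-- The canonical morphism from the nil-wreath algebra to the associated graded algebra. -/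
lemma exists_nilWreath_hom : ∃ f : NilWreath k I n →ₐ[k] Gr Q n,
    (∀ v, f (NilWreath.e k v) = grE Q v) ∧ (∀ a v, f (NilWreath.x k a v) = grX Q a v) ∧
    (∀ i v, f (NilWreath.T k i v) = grT Q i v) := by
  classical
  have hN := isNegligible Q (n := n)
  have hT := isSymbol_grT Q (n := n)
  have hX := isSymbol_grX Q (n := n)
  -- The commutator error is a multiple of `e Q v`, of degree `0`, so it disappears in degree `1`.
  have htx : ∀ (i : Fin (n - 1)) (a : Fin n) (v : Fin n → I), grT Q i v * grX Q a v = grX Q (sPerm i a) (sAct i v) * grT Q i v := by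
    intro i a v
    refine eq_of_isSymbol Q ((hT i v).mul (hX a v)) ((hX _ _).mul (hT i v)) rfl ?_
    obtain ⟨c, hc⟩ := τ_mul_x Q i a v
    rw [hc]
    exact Submodule.smul_mem _ c (e_mem Q v)
  obtain ⟨f, hf⟩ := (isPsiSystem_gr Q (n := n)).exists_lift (R := NilRel k I n) (by
    intro a b hab
    cases hab with
    | sq i v =>
      simp only [map_mul, map_zero, freeLift_fT]
      exact eq_zero_of_isSymbol Q ((hT _ _).mul (hT _ _)) (hN.sq i v)
    | far i j hij v =>
      simp only [map_mul, freeLift_fT]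
      exact eq_of_isSymbol Q ((hT _ _).mul (hT _ _)) ((hT _ _).mul (hT _ _)) rfl (hN.far i j v hij)
    | braid i j hij v =>
      simp only [map_mul, freeLift_fT]
      exact eq_of_isSymbol Q (((hT _ _).mul (hT _ _)).mul (hT _ _))
        (((hT _ _).mul (hT _ _)).mul (hT _ _)) rfl (hN.braid i j v hij)
    | xx a b v =>
      simp only [map_mul, freeLift_fX]
      exact (isPsiSystem_gr Q).xx a b v
    | tx i a h h' v =>
      simp only [map_mul, freeLift_fT, freeLift_fX]
      rw [htx, sPerm_of_ne h h']
    | tx_lo i v =>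
      simp only [map_mul, freeLift_fT, freeLift_fX]
      rw [htx, sPerm_lo]
    | tx_hi i v =>
      simp only [map_mul, freeLift_fT, freeLift_fX]
      rw [htx, sPerm_hi])
  exact ⟨f, fun v => hf _, fun a v => hf _, fun i v => hf _⟩

/-- The words in `J` need only span the nil-wreath algebra: their images are symbols of basis
elements, whose independence gives injectivity. These symbols also span the graded algebra, which
gives surjectivity. -/
theorem exists_nilWreath_equiv {J : Set (List (Fin (n - 1)))} (hJ : IsReducedRepresentatives J)
    (b : Module.Basis (J × (Fin n → ℕ) × (Fin n → I)) k (Hn Q n))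
    (hb : ∀ l a v, b (l, a, v) = basisElt Q l a v) :
    ∃ f : NilWreath k I n ≃ₐ[k] Gr Q n,
      (∀ v, f (NilWreath.e k v) = grE Q v) ∧ (∀ a v, f (NilWreath.x k a v) = grX Q a v) ∧
      (∀ i v, f (NilWreath.T k i v) = grT Q i v) := by
  obtain ⟨f, he, hx, hT⟩ := exists_nilWreath_hom Q (n := n)
  let N : J × (Fin n → ℕ) × (Fin n → I) → NilWreath k I n := fun y =>
    wordMonomial (NilWreath.e k) (NilWreath.T k) (NilWreath.x k) y.1.1 y.2.1 y.2.2
  have hfN : ∀ l a v, f (wordMonomial (NilWreath.e k) (NilWreath.T k) (NilWreath.x k) l a v) =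
      wordMonomial (grE Q) (grT Q) (grX Q) l a v := by
    intro l a v
    rw [map_wordMonomial]
    simp only [he, hx, hT]
  have hmem : ∀ l a v, basisElt Q l a v ∈ (filtration Q n).F l.length := fun l a v =>
    (isSymbol_wordMonomial Q l a v).1
  have hbmem : ∀ y, b y ∈ (filtration Q n).F y.1.1.length := by
    rintro ⟨l, a, v⟩
    rw [hb]
    exact hmem l a v
  have hfN' : ∀ y, f (N y) = (filtration Q n).symbol y.1.1.length (b y) (hbmem y) := by
    rintro ⟨l, a, v⟩
    obtain ⟨h1, h2⟩ := isSymbol_wordMonomial Q l.1 a v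
    rw [hfN, h2]
    exact AlgFiltration.symbol_congr _ rfl (hb l a v).symm _ _
  have hF : ∀ r, (filtration Q n).F r ≤
      Submodule.span k {y | ∃ i : J × (Fin n → ℕ) × (Fin n → I), i.1.1.length ≤ r ∧ y = b i} := by
    intro r
    refine (filtration_le Q hJ r).trans (Submodule.span_mono ?_)
    rintro _ ⟨l, hl, a, v, hlr, rfl⟩
    exact ⟨(⟨l, hl⟩, a, v), hlr, (hb ⟨l, hl⟩ a v).symm⟩
  obtain ⟨φ, hφ⟩ := AlgFiltration.exists_coordinates b _ hbmem hF
  have hN : ⊤ ≤ Submodule.span k (Set.range N) := by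
    rw [← NilWreath.span_eq_top hJ]
    refine Submodule.span_mono ?_
    rintro _ ⟨l, hl, a, v, rfl⟩
    exact ⟨(⟨l, hl⟩, a, v), rfl⟩
  have hinj : Function.Injective f := by
    rw [injective_iff_map_eq_zero]
    intro z hz
    obtain ⟨c, rfl⟩ := Finsupp.mem_span_range_iff_exists_finsupp.1 (hN (Submodule.mem_top (x := z)))
    -- The coordinate map recovers the coefficients of a combination of words from its image under
    -- `f`.
    have h1 : φ (f (c.sum fun i a => a • N i)) = c := by
      simp only [Finsupp.sum, map_sum, map_smul, hfN', hφ]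
      conv_rhs => rw [← Finsupp.sum_single c]
      refine Finset.sum_congr rfl fun y _ => ?_
      rw [Finsupp.smul_single, smul_eq_mul, mul_one]
    rw [hz, map_zero] at h1
    rw [← h1, Finsupp.sum_zero_index]
  have hsurj : Function.Surjective f := by
    intro z
    induction z using DirectSum.induction_on with
    | zero => exact ⟨0, map_zero f⟩
    | add z z' hz hz' =>
      obtain ⟨y, rfl⟩ := hz
      obtain ⟨y', rfl⟩ := hz'
      exact ⟨y + y', map_add f y y'⟩
    | of r z =>
      obtain ⟨a, ha, rfl⟩ := (filtration Q n).cls_surj z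
      -- The right side consists of the elements of `F r` whose class in degree `r` lies in the
      -- range of `f`. Basis elements of degree `r` are covered by the words `N y`, and those of
      -- lower degree have class zero.
      have hle : (filtration Q n).F r ≤ ((LinearMap.range f.toLinearMap).comap
          ((filtration Q n).symbolMap r)).map ((filtration Q n).F r).subtype := by
        refine (hF r).trans (Submodule.span_le.2 ?_)
        rintro _ ⟨y, hy, rfl⟩
        refine ⟨⟨b y, (filtration Q n).mono hy (hbmem y)⟩, ?_, rfl⟩
        rw [SetLike.mem_coe, Submodule.mem_comap, AlgFiltration.symbolMap_apply]
        rcases hy.eq_or_lt with h | h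
        · refine ⟨N y, (hfN' y).trans ?_⟩
          exact AlgFiltration.symbol_congr _ h rfl _ _
        · rw [AlgFiltration.symbol_eq_zero]
          · exact Submodule.zero_mem _
          · obtain _ | r := r
            · omega
            · exact (filtration Q n).mono (by omega) (hbmem y)
      obtain ⟨⟨a', ha'⟩, ⟨y, hy⟩, rfl⟩ := hle ha
      exact ⟨y, hy⟩
  exact ⟨AlgEquiv.ofBijective f ⟨hinj, hsurj⟩, he, hx, hT⟩

end Hn

end Graded

end

end QuiverHecke

/-! ### The three assertions together. -/

theorem mainTheorem9 {k : Type*} [CommRing k] {I : Type*} [Fintype I] [DecidableEq I] (n : ℕ) :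
    -- the polynomial representation is well defined and faithful
    (∀ P : I → I → MvPolynomial (Fin 2) k,
      (∀ i, P i i = 0) →
      (∀ i j, i ≠ j → P i j ∈ nonZeroDivisors (MvPolynomial (Fin 2) k)) →
      ∃ ρ : QuiverHecke.Hn (fun i j => P i j * QuiverHecke.flipVars (P j i)) n →ₐ[k]
          Module.End k (QuiverHecke.PolyRep k I n),
        (∀ v, ρ (QuiverHecke.Hn.e _ v) = QuiverHecke.arrowOp v v LinearMap.id) ∧
        (∀ a v, ρ (QuiverHecke.Hn.x _ a v) =
          QuiverHecke.arrowOp v v (LinearMap.mulLeft k (MvPolynomial.X a))) ∧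
        (∀ i v, ρ (QuiverHecke.Hn.τ _ i v) =
          QuiverHecke.arrowOp v (QuiverHecke.sAct i v) (QuiverHecke.tauOp P i v)) ∧
        Function.Injective ρ) ∧
    -- the Poincaré-Birkhoff-Witt property and the basis
    (∀ Q : I → I → MvPolynomial (Fin 2) k,
      (∀ i, Q i i = 0) →
      (∀ i j, i ≠ j → Q i j ∈ nonZeroDivisors (MvPolynomial (Fin 2) k)) →
      (∀ i j, Q i j = QuiverHecke.flipVars (Q j i)) →
      (∃ f : QuiverHecke.NilWreath k I n ≃ₐ[k] QuiverHecke.Hn.Gr Q n,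
        (∀ v, f (QuiverHecke.NilWreath.e k v) = QuiverHecke.Hn.grE Q v) ∧
        (∀ a v, f (QuiverHecke.NilWreath.x k a v) = QuiverHecke.Hn.grX Q a v) ∧
        (∀ i v, f (QuiverHecke.NilWreath.T k i v) = QuiverHecke.Hn.grT Q i v)) ∧
      (∀ J : Set (List (Fin (n - 1))), QuiverHecke.IsReducedRepresentatives J →
        ∃ b : Module.Basis (J × (Fin n → ℕ) × (Fin n → I)) k (QuiverHecke.Hn Q n),
          ∀ l a v, b (l, a, v) = QuiverHecke.Hn.basisElt Q l a v)) := by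
  -- The first two assertions do not mention `J`, but their proofs require some choice of reduced
  -- words.
  obtain ⟨J, hJ⟩ := QuiverHecke.exists_isReducedRepresentatives (n := n)
  refine ⟨fun P hP hP' => ?_, fun Q hQ hQ' hQs => ⟨?_, fun J hJ => ?_⟩⟩
  · obtain ⟨E, hE⟩ := hJ.exists_section
    obtain ⟨ρ, ⟨he, hx, hτ⟩, hinj, -⟩ :=
      QuiverHecke.Hn.exists_faithful_polyRep P hP hP' hJ hE
    exact ⟨ρ, he, hx, hτ, hinj⟩
  · obtain ⟨b, hb⟩ := QuiverHecke.Hn.exists_basis Q hQ hQ' hQs hJ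
    exact QuiverHecke.Hn.exists_nilWreath_equiv Q hJ b hb
  · exact QuiverHecke.Hn.exists_basis Q hQ hQ' hQs hJ
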